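/- **Setting.** Let $\mathcal H$ be a complex Hilbert space. A closed real subspace $H\subset\mathcal H$ is standard if $H\cap iH=\{0\}$ and $\overline{H+iH}=\mathcal H$; put $H'=\{x:\operatorname{Im}\langle h,x\rangle=0\ \forall h\in H\}$, and let $S_H=J_H\Delta_H^{1/2}$ be the polar decomposition of the closed antilinear involution $S_H:f+ig\mapsto f-ig$ $(f,g\in H)$. A standard pair $(H,T)$ consists of a standard subspace $H$ and a strongly continuous one-parameter unitary group $T(t)=e^{itP}$ with $T(t)H\subset H$ for $t\ge 0$, $P\ge 0$ and $\ker P=\{0\}$. The irreducible standard pair $(H_0,T_0)$ on $L^2(\mathbb R)$ is given by $(T_0(t)f)(q)=e^{ite^q}f(q)$, and $f\in H_0$ iff $f$ has an analytic continuation to the strip $\mathbb R+i(0,\pi)$ with uniformly bounded $L^2$-norms on the horizontal lines, whose $L^2$-boundary values are $f$ on $\mathbb R$ and $f(q+i\pi)=\overline{f(q)}$. The pair $(H,T)$ has multiplicity $n\in\mathbb N$ if it is unitarily equivalent to the direct sum of $n$ copies of $(H_0,T_0)$. The set $\mathcal S(H,T)$ consists of all unitaries $R$ on $\mathcal H\otimes\mathcal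 H$ such that 1. $R_{21}=R^*$, where $R_{21}=FRF$ and $F(\xi\otimes\eta)=\eta\otimes\xi$; 2. $R_{12}R_{13}R_{23}=R_{23}R_{13}R_{12}$ on $\mathcal H^{\otimes 3}$; 3. $[R,T(t_1)\otimes T(t_2)]=0$ for all $t_1,t_2\in\mathbb R$; 4. $[R,\Delta_H^{it}\otimes\Delta_H^{it}]=0$ for all $t\in\mathbb R$, and $R(J_H\otimes J_H)=(J_H\otimes J_H)R^*$; 5. $\langle g'\otimes\eta,R(f\otimes\xi)\rangle=\langle f\otimes\eta,R^*(g'\otimes\xi)\rangle$ for all $f\in H$, $g'\in H'$, $\xi,\eta\in\mathcal H$. **Proposition.** Let $(H,T)$ be a standard pair of finite multiplicity $n$, let $I$ be an index set with $n$ elements and let $\alpha\mapsto\bar\alpha$ be an involution of $I$. Then there is a unitary $U:\mathcal H\to L^2(\mathbb R,\mathbb C^{I})$ such that $T(t)$ becomes multiplication by $e^{ite^q}$, and $H$ becomes the set of all $f=(f^\alpha)$ whose components have analytic continuations to $\mathbb R+i(0,\pi)$ with uniformly bounded $L^2$-norms on the horizontal lines and $L^2$-boundary values $f^\alpha$ on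 $\mathbb R$ and $f^\alpha(q+i\pi)=\overline{f^{\bar\alpha}(q)}$. For every such $U$ and every bounded operator $R$ on $\mathcal H\otimes\mathcal H$, the following holds, where $U\otimes U$ is used to identify $\mathcal H\otimes\mathcal H$ with $L^2(\mathbb R^2,\mathbb C^I\otimes\mathbb C^I)$. One has $R\in\mathcal S(H,T)$ if and only if there is a measurable matrix-valued function $S=(S^{\alpha\beta}_{\gamma\delta})$ on $\mathbb R$ with $$(R\xi)^{\alpha\beta}(q_1,q_2)=\sum_{\gamma,\delta}S^{\beta\alpha}_{\gamma\delta}(q_1-q_2)\,\xi^{\gamma\delta}(q_1,q_2)\qquad(\xi\in\mathcal H\otimes\mathcal H,\ \text{a.e. }(q_1,q_2))$$ that satisfies: 1. (Unitarity) $S(q)$ is a unitary matrix for almost all $q\in\mathbb R$. 2. (Hermitian analyticity) $S(-q)=S(q)^*$ for almost all $q\in\mathbb R$. 3. (Yang–Baxter equation) $S(q)_{12}S(q+q')_{23}S(q')_{12}=S(q')_{23}S(q+q')_{12}S(q)_{23}$ for almost all $(q,q')\in\mathbb R^2$. 4. (TCP) $S^{\alpha\beta}_{\gamma\delta}(q)=S^{\bar\delta\bar\gamma}_{\bar\beta\bar\alpha}(q)$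 for almost all $q\in\mathbb R$. 5. (Analyticity) $S$ is the almost everywhere (vertical) boundary value on $\mathbb R$ of a bounded analytic matrix-valued function on $\mathbb R+i(0,\pi)$, again denoted $S$. 6. (Crossing symmetry) $S^{\alpha\beta}_{\gamma\delta}(i\pi-q)=S^{\bar\gamma\alpha}_{\delta\bar\beta}(q)$ for almost all $q\in\mathbb R$, where the left-hand side is the vertical boundary value at $\mathbb R+i\pi$ of the function in 5. -/

import Mathlib

open MeasureTheory Filter Topology
open scoped TensorProduct ComplexConjugate ENNReal InnerProductSpace

noncomputable section

namespace Scattering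

/-! ### Hilbert space tensor products -/

section Tensor

variable (E F : Type*) [NormedAddCommGroup E] [InnerProductSpace ℂ E]
  [NormedAddCommGroup F] [InnerProductSpace ℂ F]

/-- The Hilbert space tensor product: the completion of the algebraic tensor product for
`⟪a ⊗ b, c ⊗ d⟫ = ⟪a, c⟫ * ⟪b, d⟫`. -/
abbrev HTensor : Type _ := UniformSpace.Completion (E ⊗[ℂ] F)

variable {E F}

/-- The elementary tensor `x ⊗ y` in the Hilbert space tensor product. -/
def htmul (x : E) (y : F) : HTensor E F := ((x ⊗ₜ[ℂ] y : E ⊗[ℂ] F) : HTensor E F)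

theorem inner_htmul (x x' : E) (y y' : F) :
    ⟪htmul x y, htmul x' y'⟫_ℂ = ⟪x, x'⟫_ℂ * ⟪y, y'⟫_ℂ := by
  simp [htmul, UniformSpace.Completion.inner_coe]

theorem denseRange_toComplL {G : Type*} [NormedAddCommGroup G] [InnerProductSpace ℂ G] :
    DenseRange (UniformSpace.Completion.toComplL (𝕜 := ℂ) (E := G)) :=
  UniformSpace.Completion.denseRange_coe

theorem isUniformInducing_toComplL {G : Type*} [NormedAddCommGroup G] [InnerProductSpace ℂ G] :
    IsUniformInducing (UniformSpace.Completion.toComplL (𝕜 := ℂ) (E := G)) :=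
  UniformSpace.Completion.isUniformInducing_coe G

variable {E' F' : Type*} [NormedAddCommGroup E'] [InnerProductSpace ℂ E']
  [NormedAddCommGroup F'] [InnerProductSpace ℂ F']

/-- The tensor product `A ⊗ B` of bounded operators. -/
def hmap (A : E →L[ℂ] E') (B : F →L[ℂ] F') : HTensor E F →L[ℂ] HTensor E' F' :=
  (UniformSpace.Completion.toComplL ∘L TensorProduct.mapL A B).extend
    UniformSpace.Completion.toComplL

theorem hmap_htmul (A : E →L[ℂ] E') (B : F →L[ℂ] F') (x : E) (y : F) :
    hmap A B (htmul x y) = htmul (A x) (B y) :=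
  ContinuousLinearMap.extend_eq _ denseRange_toComplL isUniformInducing_toComplL (x ⊗ₜ[ℂ] y)

/-- The flip `x ⊗ y ↦ y ⊗ x`. -/
def hflip : HTensor E F →L[ℂ] HTensor F E :=
  (UniformSpace.Completion.toComplL ∘L
    ((TensorProduct.commIsometry ℂ E F : E ⊗[ℂ] F ≃ₗᵢ[ℂ] F ⊗[ℂ] E) :
      E ⊗[ℂ] F →L[ℂ] F ⊗[ℂ] E)).extend UniformSpace.Completion.toComplL

theorem hflip_htmul (x : E) (y : F) : hflip (htmul x y) = htmul y x :=
  ContinuousLinearMap.extend_eq _ denseRange_toComplL isUniformInducing_toComplL (x ⊗ₜ[ℂ] y)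

theorem inner_anti (J : E ≃ₗᵢ⋆[ℂ] E) (a b : E) : ⟪J a, J b⟫_ℂ = conj ⟪a, b⟫_ℂ := by
  have hre : ∀ a b : E, (⟪J a, J b⟫_ℂ).re = (⟪a, b⟫_ℂ).re := by
    intro a b
    have h1 := norm_add_sq (𝕜 := ℂ) (J a) (J b)
    have h2 := norm_add_sq (𝕜 := ℂ) a b
    rw [← map_add, J.norm_map, J.norm_map, J.norm_map] at h1
    simp only [RCLike.re_to_complex] at h1 h2
    linarith
  apply Complex.ext
  · rw [Complex.conj_re, hre]
  · have h := hre (Complex.I • a) b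
    rw [LinearIsometryEquiv.map_smulₛₗ, inner_smul_left, inner_smul_left] at h
    rw [Complex.conj_im]
    simp only [Complex.conj_I, map_neg, neg_neg, neg_mul, Complex.neg_re, Complex.mul_re,
      Complex.I_re, Complex.I_im, zero_mul, one_mul] at h
    linarith

theorem inner_map_anti (J : E ≃ₗᵢ⋆[ℂ] E) (K : F ≃ₗᵢ⋆[ℂ] F) (x y : E ⊗[ℂ] F) :
    ⟪TensorProduct.map J.toLinearEquiv.toLinearMap K.toLinearEquiv.toLinearMap x,
      TensorProduct.map J.toLinearEquiv.toLinearMap K.toLinearEquiv.toLinearMap y⟫_ℂ =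
      conj ⟪x, y⟫_ℂ := by
  induction x with
  | zero => simp
  | tmul a b =>
    induction y with
    | zero => simp
    | tmul c d =>
      rw [TensorProduct.map_tmul, TensorProduct.map_tmul, TensorProduct.inner_tmul,
        TensorProduct.inner_tmul, map_mul]
      exact congrArg₂ (· * ·) (inner_anti J a c) (inner_anti K b d)
    | add y₁ y₂ h₁ h₂ => simp only [map_add, inner_add_right, h₁, h₂]
  | add x₁ x₂ h₁ h₂ => simp only [map_add, inner_add_left, h₁, h₂]

/-- The tensor product `J ⊗ K` of antiunitary operators. -/
def hmapAnti (J : E ≃ₗᵢ⋆[ℂ] E) (K : F ≃ₗᵢ⋆[ℂ] F) : HTensor E F →L⋆[ℂ] HTensor E F :=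
  ((UniformSpace.Completion.toComplL (𝕜 := ℂ) (E := E ⊗[ℂ] F)).toLinearMap.comp
    (TensorProduct.map J.toLinearEquiv.toLinearMap K.toLinearEquiv.toLinearMap)).extendOfNorm
    (UniformSpace.Completion.toComplL (𝕜 := ℂ) (E := E ⊗[ℂ] F)).toLinearMap

theorem hmapAnti_htmul (J : E ≃ₗᵢ⋆[ℂ] E) (K : F ≃ₗᵢ⋆[ℂ] F) (x : E) (y : F) :
    hmapAnti J K (htmul x y) = htmul (J x) (K y) := by
  refine LinearMap.extendOfNorm_eq (denseRange_toComplL (G := E ⊗[ℂ] F)) ⟨1, fun z => ?_⟩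
    (x ⊗ₜ[ℂ] y)
  have h := congrArg Complex.re (inner_map_anti J K z z)
  rw [Complex.conj_re] at h
  have h1 := inner_self_eq_norm_sq (𝕜 := ℂ) z
  have h2 := inner_self_eq_norm_sq (𝕜 := ℂ)
    (TensorProduct.map J.toLinearEquiv.toLinearMap K.toLinearEquiv.toLinearMap z)
  simp only [RCLike.re_to_complex] at h1 h2
  have h3 : ‖TensorProduct.map J.toLinearEquiv.toLinearMap
      K.toLinearEquiv.toLinearMap z‖ = ‖z‖ :=
    (sq_eq_sq₀ (norm_nonneg _) (norm_nonneg _)).1 (by rw [← h1, ← h2, h])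
  simp [h3]

/-! ### Operators on the threefold tensor product `(E ⊗ E) ⊗ E` -/

/-- The embedding of the algebraic threefold tensor product into the Hilbert space one. -/
def tripleEmb : (E ⊗[ℂ] E) ⊗[ℂ] E →ₗᵢ[ℂ] HTensor (HTensor E E) E :=
  UniformSpace.Completion.toComplₗᵢ.comp
    (TensorProduct.mapIsometry UniformSpace.Completion.toComplₗᵢ LinearIsometry.id)

/-- The exchange of the last two factors on the algebraic threefold tensor product,
`(a ⊗ b) ⊗ c ↦ (a ⊗ c) ⊗ b`. -/
def algSwap : (E ⊗[ℂ] E) ⊗[ℂ] E ≃ₗᵢ[ℂ] (E ⊗[ℂ] E) ⊗[ℂ] E :=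
  ((TensorProduct.assocIsometry ℂ E E E).trans
    (LinearIsometryEquiv.lTensor E (TensorProduct.commIsometry ℂ E E))).trans
    (TensorProduct.assocIsometry ℂ E E E).symm

/-- The exchange `F₂₃` of the last two factors, `(a ⊗ b) ⊗ c ↦ (a ⊗ c) ⊗ b`. -/
def flip23 : HTensor (HTensor E E) E →L[ℂ] HTensor (HTensor E E) E :=
  (tripleEmb.toLinearMap.comp (algSwap (E := E)).toLinearEquiv.toLinearMap).extendOfNorm
    tripleEmb.toLinearMap

theorem denseRange_tripleEmb : DenseRange (tripleEmb (E := E)) := by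
  have h1 : DenseRange (TensorProduct.mapIsometry
      (UniformSpace.Completion.toComplₗᵢ (𝕜 := ℂ) (E := E ⊗[ℂ] E))
      (LinearIsometry.id (R := ℂ) (E := E))) := by
    intro z
    induction z with
    | zero => exact subset_closure ⟨0, map_zero _⟩
    | tmul a b =>
      have hc : Continuous fun a : HTensor E E => a ⊗ₜ[ℂ] b :=
        ((TensorProduct.mkL ℂ (HTensor E E) E).flip b).continuous
      have := (denseRange_toComplL (G := E ⊗[ℂ] E)) a
      have h2 := map_mem_closure hc this (t := Set.range (TensorProduct.mapIsometry
        (UniformSpace.Completion.toComplₗᵢ (𝕜 := ℂ) (E := E ⊗[ℂ] E))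
        (LinearIsometry.id (R := ℂ) (E := E)))) (by
          rintro _ ⟨x, rfl⟩
          exact ⟨x ⊗ₜ b, rfl⟩)
      exact h2
    | add x y hx hy =>
      exact map_mem_closure₂ continuous_add hx hy (by
        rintro _ ⟨x, rfl⟩ _ ⟨y, rfl⟩
        exact ⟨x + y, map_add _ _ _⟩)
  exact (UniformSpace.Completion.denseRange_coe).comp h1 (UniformSpace.Completion.continuous_coe _)

theorem flip23_htmul (a b c : E) :
    flip23 (htmul (htmul a b) c) = htmul (htmul a c) b :=
  LinearMap.extendOfNorm_eq (denseRange_tripleEmb (E := E))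
    ⟨1, fun z => by
      rw [one_mul]
      exact (((tripleEmb (E := E)).norm_map _).trans ((algSwap (E := E)).norm_map z)).trans
        ((tripleEmb (E := E)).norm_map z).symm |>.le⟩ ((a ⊗ₜ[ℂ] b) ⊗ₜ[ℂ] c)

/-- `R₁₂` on the threefold tensor product. -/
def op12 (R : HTensor E E →L[ℂ] HTensor E E) :
    HTensor (HTensor E E) E →L[ℂ] HTensor (HTensor E E) E :=
  hmap R (ContinuousLinearMap.id ℂ E)

/-- `R₁₃` on the threefold tensor product. -/
def op13 (R : HTensor E E →L[ℂ] HTensor E E) :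
    HTensor (HTensor E E) E →L[ℂ] HTensor (HTensor E E) E :=
  flip23 ∘L op12 R ∘L flip23

/-- `R₂₃` on the threefold tensor product. -/
def op23 (R : HTensor E E →L[ℂ] HTensor E E) :
    HTensor (HTensor E E) E →L[ℂ] HTensor (HTensor E E) E :=
  op12 hflip ∘L op13 R ∘L op12 hflip

end Tensor

/-! ### Standard pairs and two-particle scattering operators -/

section Abstract

variable {𝓗 : Type*} [NormedAddCommGroup 𝓗] [InnerProductSpace ℂ 𝓗] [CompleteSpace 𝓗]

/-- A strongly continuous one-parameter unitary group. -/
structure IsUnitaryGroup (T : ℝ → 𝓗 →L[ℂ] 𝓗) : Prop where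
  unitary : ∀ t, T t ∈ unitary (𝓗 →L[ℂ] 𝓗)
  add : ∀ s t, T (s + t) = T s * T t
  continuous : ∀ x, Continuous fun t => T t x

/-- `IsGenerator T x y` says that `x` lies in the domain of the self-adjoint generator `P` of
`T(t) = exp(i t P)` and that `P x = y`. -/
def IsGenerator (T : ℝ → 𝓗 →L[ℂ] 𝓗) (x y : 𝓗) : Prop :=
  HasDerivAt (fun t : ℝ => T t x) (Complex.I • y) 0

/-- A (non-degenerate) standard pair `(H, T)`: `T(t) H ⊆ H` for `t ≥ 0`, and the generator of `T`
is positive and has no point spectrum in `0`. -/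
structure IsStandardPair (H : StandardSubspace 𝓗) (T : ℝ → 𝓗 →L[ℂ] 𝓗) : Prop where
  group : IsUnitaryGroup T
  maps_to : ∀ t : ℝ, 0 ≤ t → ∀ f ∈ H.toClosedSubmodule, T t f ∈ H.toClosedSubmodule
  pos : ∀ x y, IsGenerator T x y → 0 ≤ (⟪x, y⟫_ℂ).re
  ker : ∀ x, IsGenerator T x 0 → x = 0

/-- For `D(t) = Δ^{it}`, `IsSqrtValue D x w` says that `x` lies in the domain of `Δ^{1/2}` and
`Δ^{1/2} x = w`: the orbit `t ↦ Δ^{it} x` extends to a continuous function on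
`-1/2 ≤ Im z ≤ 0`, analytic in the interior, with value `w` at `-i/2`. -/
def IsSqrtValue (D : ℝ → 𝓗 →L[ℂ] 𝓗) (x w : 𝓗) : Prop :=
  ∃ Φ : ℂ → 𝓗, ContinuousOn Φ {z | -(1 / 2) ≤ z.im ∧ z.im ≤ 0} ∧
    DifferentiableOn ℂ Φ {z | -(1 / 2) < z.im ∧ z.im < 0} ∧
    (∀ t : ℝ, Φ t = D t x) ∧ Φ (-(Complex.I / 2)) = w

/-- `D(t) = Δ_H^{it}` and `J = J_H` are the modular objects of `H`: `S_H = J Δ^{1/2}` (equality of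
graphs) is the polar decomposition of the antilinear involution `S_H : f + ig ↦ f - ig`,
`f, g ∈ H`. -/
structure IsModularPair (H : StandardSubspace 𝓗) (D : ℝ → 𝓗 →L[ℂ] 𝓗) (J : 𝓗 ≃ₗᵢ⋆[ℂ] 𝓗) :
    Prop where
  group : IsUnitaryGroup D
  involutive : ∀ x, J (J x) = x
  polar : ∀ x y : 𝓗,
    (∃ f ∈ H.toClosedSubmodule, ∃ g ∈ H.toClosedSubmodule,
        x = f + Complex.I • g ∧ y = f - Complex.I • g) ↔
      ∃ w, IsSqrtValue D x w ∧ J w = y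

/-- The set `𝒮(H, T)` of two-particle scattering operators of a standard pair. -/
structure IsScatteringOperator (H : StandardSubspace 𝓗) (T : ℝ → 𝓗 →L[ℂ] 𝓗)
    (R : HTensor 𝓗 𝓗 →L[ℂ] HTensor 𝓗 𝓗) : Prop where
  unitary : R ∈ unitary (HTensor 𝓗 𝓗 →L[ℂ] HTensor 𝓗 𝓗)
  reflection : hflip ∘L R ∘L hflip = ContinuousLinearMap.adjoint R
  yangBaxter : op12 R ∘L op13 R ∘L op23 R = op23 R ∘L op13 R ∘L op12 R
  translation : ∀ t₁ t₂ : ℝ, R ∘L hmap (T t₁) (T t₂) = hmap (T t₁) (T t₂) ∘L R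
  /-- Here `D t` and `J` are `Δ_H^{it}` and `J_H`, which `H` determines uniquely. -/
  dilationTCP : ∃ (D : ℝ → 𝓗 →L[ℂ] 𝓗) (J : 𝓗 ≃ₗᵢ⋆[ℂ] 𝓗), IsModularPair H D J ∧
    (∀ t : ℝ, R ∘L hmap (D t) (D t) = hmap (D t) (D t) ∘L R) ∧
    ∀ ξ, R (hmapAnti J J ξ) = hmapAnti J J (ContinuousLinearMap.adjoint R ξ)
  locality : ∀ f ∈ H.toClosedSubmodule, ∀ g ∈ H.symplComp.toClosedSubmodule, ∀ ξ η : 𝓗,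
    ⟪htmul g η, R (htmul f ξ)⟫_ℂ = ⟪htmul f η, ContinuousLinearMap.adjoint R (htmul g ξ)⟫_ℂ

end Abstract

/-! ### The Schrödinger representation -/

section Schrodinger

/-- `f` and `g` are the (L²-)boundary values, at `ℝ` and at `ℝ + iπ`, of one function of the Hardy
class of the strip `ℝ + i(0,π)`: analytic, with uniformly bounded `L²`-norms on the horizontal
lines. -/
def IsHardyPair (f g : ℝ → ℂ) : Prop :=
  ∃ Φ : ℂ → ℂ, DifferentiableOn ℂ Φ {z | 0 < z.im ∧ z.im < Real.pi} ∧
    (∃ C : ℝ, ∀ a ∈ Set.Ioo 0 Real.pi,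
      eLpNorm (fun q : ℝ => Φ (q + a * Complex.I)) 2 volume ≤ ENNReal.ofReal C) ∧
    Tendsto (fun a : ℝ => eLpNorm (fun q : ℝ => Φ (q + a * Complex.I) - f q) 2 volume)
      (𝓝[>] 0) (𝓝 0) ∧
    Tendsto (fun a : ℝ => eLpNorm (fun q : ℝ => Φ (q + a * Complex.I) - g q) 2 volume)
      (𝓝[<] Real.pi) (𝓝 0)

/-- The function by which `T₀(t) = exp(i t P₀)`, `P₀ = exp(Q₀)`, acts on `L²(ℝ)`. -/
def phase (t q : ℝ) : ℂ := Complex.exp (Complex.I * (t * Real.exp q : ℝ))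

/-- `(H, T)` has multiplicity `n`: it is unitarily equivalent to the direct sum of `n` copies of the
irreducible standard pair `(H₀, T₀)` on `L²(ℝ)`, where `T₀(t)` multiplies by `exp(i t e^q)` and
`H₀` consists of the functions `f` with an analytic continuation of Hardy class to `ℝ + i(0,π)`
such that `f(q + iπ) = conj (f q)`. -/
def HasMultiplicity {𝓗 : Type*} [NormedAddCommGroup 𝓗] [InnerProductSpace ℂ 𝓗]
    (H : StandardSubspace 𝓗) (T : ℝ → 𝓗 →L[ℂ] 𝓗) (n : ℕ) : Prop :=
  ∃ U : 𝓗 ≃ₗᵢ[ℂ] PiLp 2 (fun _ : Fin n => Lp ℂ 2 (volume : Measure ℝ)),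
    (∀ t x i, ∀ᵐ q : ℝ, (U (T t x) i : ℝ → ℂ) q = phase t q * (U x i : ℝ → ℂ) q) ∧
    ∀ x, x ∈ H.toClosedSubmodule ↔
      ∀ i, IsHardyPair (U x i : ℝ → ℂ) (fun q => conj ((U x i : ℝ → ℂ) q))

variable {ι : Type*} [Fintype ι]

/-- `L²(ℝ, ℂ^ι)`. -/
abbrev L2R (ι : Type*) [Fintype ι] : Type _ := Lp (EuclideanSpace ℂ ι) 2 (volume : Measure ℝ)

/-- `L²(ℝ², ℂ^ι ⊗ ℂ^ι)`. -/
abbrev L2RR (ι : Type*) [Fintype ι] : Type _ :=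
  Lp (EuclideanSpace ℂ (ι × ι)) 2 (volume : Measure (ℝ × ℝ))

/-- `U` realizes `(H, T)` on `L²(ℝ, ℂ^ι)`: `T(t)` multiplies by `exp(i t e^q)`, and
`H` consists of the functions `f` with an analytic continuation of Hardy class to `ℝ + i(0,π)`
such that `f^α(q + iπ) = conj (f^(bar α) (q))`. -/
structure IsSchrodingerRep {𝓗 : Type*} [NormedAddCommGroup 𝓗] [InnerProductSpace ℂ 𝓗]
    (H : StandardSubspace 𝓗) (T : ℝ → 𝓗 →L[ℂ] 𝓗) (bar : ι → ι) (U : 𝓗 ≃ₗᵢ[ℂ] L2R ι) :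
    Prop where
  translation : ∀ t x, ∀ᵐ q : ℝ, U (T t x) q = phase t q • U x q
  mem_iff : ∀ x, x ∈ H.toClosedSubmodule ↔
    ∀ α, IsHardyPair (fun q => U x q α) (fun q => conj (U x q (bar α)))

/-- The function `(q₁, q₂) ↦ (f^α(q₁) g^β(q₂))_{α β}`. -/
def prodFun (f g : ℝ → EuclideanSpace ℂ ι) (p : ℝ × ℝ) : EuclideanSpace ℂ (ι × ι) :=
  WithLp.toLp 2 fun ab => f p.1 ab.1 * g p.2 ab.2

theorem norm_prodFun (f g : ℝ → EuclideanSpace ℂ ι) (p : ℝ × ℝ) :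
    ‖prodFun f g p‖ = ‖f p.1‖ * ‖g p.2‖ := by
  have : ‖prodFun f g p‖ ^ 2 = (‖f p.1‖ * ‖g p.2‖) ^ 2 := by
    simp only [mul_pow, EuclideanSpace.norm_sq_eq, prodFun, norm_mul, Fintype.sum_prod_type,
      Finset.sum_mul_sum]
  exact (sq_eq_sq₀ (norm_nonneg _) (by positivity)).1 this

theorem prodFun_memLp (f g : L2R ι) : MemLp (prodFun f g) 2 (volume : Measure (ℝ × ℝ)) := by
  have hf := Lp.memLp f
  have hg := Lp.memLp g
  have hm : AEStronglyMeasurable (prodFun f g) (volume : Measure (ℝ × ℝ)) := by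
    have h1 : AEStronglyMeasurable (fun p : ℝ × ℝ => f p.1) (volume : Measure (ℝ × ℝ)) :=
      hf.1.comp_fst
    have h2 : AEStronglyMeasurable (fun p : ℝ × ℝ => g p.2) (volume : Measure (ℝ × ℝ)) :=
      hg.1.comp_snd
    have hc : Continuous fun v : EuclideanSpace ℂ ι × EuclideanSpace ℂ ι =>
        (WithLp.toLp 2 fun ab : ι × ι => v.1 ab.1 * v.2 ab.2 : EuclideanSpace ℂ (ι × ι)) := by
      fun_prop
    exact hc.comp_aestronglyMeasurable (h1.prodMk h2)
  rw [memLp_two_iff_integrable_sq_norm hm]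
  have := (hf.integrable_norm_pow (by norm_num)).mul_prod (hg.integrable_norm_pow (by norm_num))
  refine this.congr (Eventually.of_forall fun p => ?_)
  simp [norm_prodFun, mul_pow]

/-- The bilinear map `(f, g) ↦ ((q₁, q₂) ↦ f^α(q₁) g^β(q₂))`. -/
def prodBilin : L2R ι →ₗ[ℂ] L2R ι →ₗ[ℂ] L2RR ι :=
  LinearMap.mk₂ ℂ (fun f g => (prodFun_memLp f g).toLp (prodFun f g))
    (by
      intro f f' g
      rw [← MemLp.toLp_add, MemLp.toLp_eq_toLp_iff]
      have h := (Measure.quasiMeasurePreserving_fst (μ := (volume : Measure ℝ))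
        (ν := (volume : Measure ℝ))).ae (Lp.coeFn_add f f')
      filter_upwards [h] with p hp
      ext ab
      simp only [prodFun, PiLp.add_apply, Pi.add_apply]
      rw [hp]
      simp [add_mul])
    (by
      intro c f g
      rw [← MemLp.toLp_const_smul, MemLp.toLp_eq_toLp_iff]
      have h := (Measure.quasiMeasurePreserving_fst (μ := (volume : Measure ℝ))
        (ν := (volume : Measure ℝ))).ae (Lp.coeFn_smul c f)
      filter_upwards [h] with p hp
      ext ab
      simp [prodFun, hp, mul_assoc])
    (by
      intro f g g'
      rw [← MemLp.toLp_add, MemLp.toLp_eq_toLp_iff]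
      have h := (Measure.quasiMeasurePreserving_snd (μ := (volume : Measure ℝ))
        (ν := (volume : Measure ℝ))).ae (Lp.coeFn_add g g')
      filter_upwards [h] with p hp
      ext ab
      simp only [prodFun, PiLp.add_apply, Pi.add_apply]
      rw [hp]
      simp [mul_add])
    (by
      intro c f g
      rw [← MemLp.toLp_const_smul, MemLp.toLp_eq_toLp_iff]
      have h := (Measure.quasiMeasurePreserving_snd (μ := (volume : Measure ℝ))
        (ν := (volume : Measure ℝ))).ae (Lp.coeFn_smul c g)
      filter_upwards [h] with p hp
      ext ab
      simp [prodFun, hp, mul_left_comm])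

theorem inner_prodBilin (f g f' g' : L2R ι) :
    ⟪prodBilin f g, prodBilin f' g'⟫_ℂ = ⟪f, f'⟫_ℂ * ⟪g, g'⟫_ℂ := by
  rw [L2.inner_def, L2.inner_def, L2.inner_def, ← integral_prod_mul]
  refine integral_congr_ae ?_
  filter_upwards [(prodFun_memLp f g).coeFn_toLp, (prodFun_memLp f' g').coeFn_toLp] with p h1 h2
  simp only [prodBilin, LinearMap.mk₂_apply]
  rw [h1, h2]
  simp only [PiLp.inner_apply, prodFun, RCLike.inner_apply, map_mul, Fintype.sum_prod_type,
    Finset.sum_mul_sum]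
  refine Finset.sum_congr rfl fun a _ => Finset.sum_congr rfl fun b _ => ?_
  ring

theorem inner_lift_prodBilin (x y : L2R ι ⊗[ℂ] L2R ι) :
    ⟪TensorProduct.lift prodBilin x, TensorProduct.lift prodBilin y⟫_ℂ = ⟪x, y⟫_ℂ := by
  induction x with
  | zero => simp
  | tmul a b =>
    induction y with
    | zero => simp
    | tmul c d => simp [inner_prodBilin]
    | add y₁ y₂ h₁ h₂ => simp only [map_add, inner_add_right, h₁, h₂]
  | add x₁ x₂ h₁ h₂ => simp only [map_add, inner_add_left, h₁, h₂]

/-- The identification of `L²(ℝ, ℂ^ι) ⊗ L²(ℝ, ℂ^ι)` with `L²(ℝ², ℂ^ι ⊗ ℂ^ι)`. -/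
def twoParticle : HTensor (L2R ι) (L2R ι) →L[ℂ] L2RR ι :=
  (((TensorProduct.lift prodBilin).isometryOfInner
    inner_lift_prodBilin).toContinuousLinearMap).extend UniformSpace.Completion.toComplL

theorem twoParticle_htmul (f g : L2R ι) :
    twoParticle (htmul f g) = (prodFun_memLp f g).toLp (prodFun f g) :=
  ContinuousLinearMap.extend_eq _ denseRange_toComplL isUniformInducing_toComplL (f ⊗ₜ[ℂ] g)

/-- The two-particle wave function `ξ^{αβ}(q₁, q₂)` of `ξ ∈ 𝓗 ⊗ 𝓗`. -/
def wave {𝓗 : Type*} [NormedAddCommGroup 𝓗] [InnerProductSpace ℂ 𝓗] (U : 𝓗 ≃ₗᵢ[ℂ] L2R ι)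
    (ξ : HTensor 𝓗 𝓗) : L2RR ι :=
  twoParticle (hmap (U : 𝓗 →L[ℂ] L2R ι) (U : 𝓗 →L[ℂ] L2R ι) ξ)

/-- `R` comes from the matrix-valued function `S`:
`(R ξ)^{αβ}(q₁, q₂) = ∑_{γδ} S^{βα}_{γδ}(q₁ - q₂) ξ^{γδ}(q₁, q₂)`.
The entry `S^{αβ}_{γδ}` is written `S (α, β) (γ, δ)`. -/
def ComesFrom {𝓗 : Type*} [NormedAddCommGroup 𝓗] [InnerProductSpace ℂ 𝓗] (U : 𝓗 ≃ₗᵢ[ℂ] L2R ι)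
    (R : HTensor 𝓗 𝓗 →L[ℂ] HTensor 𝓗 𝓗) (S : ℝ → Matrix (ι × ι) (ι × ι) ℂ) : Prop :=
  ∀ ξ, ∀ᵐ p : ℝ × ℝ, ∀ α β : ι,
    wave U (R ξ) p (α, β) = ∑ γ, ∑ δ, S (p.1 - p.2) (β, α) (γ, δ) * wave U ξ p (γ, δ)

end Schrodinger

/-! ### Scattering matrices -/

section Matrices

variable {ι : Type*} [Fintype ι] [DecidableEq ι]

/-- `A₁₂` on `ℂ^ι ⊗ ℂ^ι ⊗ ℂ^ι`. -/
def leg12 (A : Matrix (ι × ι) (ι × ι) ℂ) : Matrix (ι × ι × ι) (ι × ι × ι) ℂ :=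
  Matrix.of fun a b => A (a.1, a.2.1) (b.1, b.2.1) * if a.2.2 = b.2.2 then 1 else 0

/-- `A₂₃` on `ℂ^ι ⊗ ℂ^ι ⊗ ℂ^ι`. -/
def leg23 (A : Matrix (ι × ι) (ι × ι) ℂ) : Matrix (ι × ι × ι) (ι × ι × ι) ℂ :=
  Matrix.of fun a b => (if a.1 = b.1 then 1 else 0) * A a.2 b.2

/-- The relations for a two-particle scattering matrix `q ↦ S(q)`, with respect to the involution
`bar` of the index set. -/
structure IsScatteringMatrix (bar : ι → ι) (S : ℝ → Matrix (ι × ι) (ι × ι) ℂ) : Prop where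
  measurable : ∀ a b, Measurable fun q => S q a b
  unitarity : ∀ᵐ q : ℝ, S q ∈ Matrix.unitaryGroup (ι × ι) ℂ
  hermitian : ∀ᵐ q : ℝ, S (-q) = (S q).conjTranspose
  yangBaxter : ∀ᵐ p : ℝ × ℝ,
    leg12 (S p.1) * leg23 (S (p.1 + p.2)) * leg12 (S p.2) =
      leg23 (S p.2) * leg12 (S (p.1 + p.2)) * leg23 (S p.1)
  tcp : ∀ᵐ q : ℝ, ∀ α β γ δ : ι,
    S q (α, β) (γ, δ) = S q (bar δ, bar γ) (bar β, bar α)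
  /-- `Φ` is the bounded analytic continuation of `S` to `ℝ + i(0,π)`; its boundary values at
  `ℝ + iπ` enter the crossing relation `S^{αβ}_{γδ}(iπ - q) = S^{(bar γ)α}_{δ(bar β)}(q)`. -/
  analytic_crossing : ∃ Φ : ℂ → Matrix (ι × ι) (ι × ι) ℂ,
    (∀ a b, DifferentiableOn ℂ (fun z => Φ z a b) {z | 0 < z.im ∧ z.im < Real.pi}) ∧
    (∃ C : ℝ, ∀ z : ℂ, 0 < z.im → z.im < Real.pi → ∀ a b, ‖Φ z a b‖ ≤ C) ∧
    (∀ᵐ q : ℝ, ∀ a b, Tendsto (fun y : ℝ => Φ (q + y * Complex.I) a b) (𝓝[>] 0) (𝓝 (S q a b))) ∧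
    ∀ᵐ q : ℝ, ∀ α β γ δ : ι,
      Tendsto (fun y : ℝ => Φ (y * Complex.I - q) (α, β) (γ, δ)) (𝓝[<] Real.pi)
        (𝓝 (S q (bar γ, α) (δ, bar β)))

end Matrices

end Scattering

end

/-! In the representation `U` the modular objects are explicit: Δ^{it} translates the rapidity by
2πt, and J is f^α ↦ conj f^(bar α) (`isModularPair_modGroup`). Imaginary translation is analytic
continuation, and the modular parameter -i/2 corresponds to the height π of the strip. The Hardy
condition that defines H therefore says Δ^{1/2} f = J f. A scattering operator is only required to
respect some modular pair, so uniqueness is needed too (`IsModularPair.group_unique`,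
`IsModularPair.conj_unique`): matrix elements between entire vectors of two candidate groups form an
entire function, which has period i because both pairs have the same S_H, is therefore bounded, and
is constant by Liouville.

An operator that commutes with all T(t₁) ⊗ T(t₂) is multiplication by a matrix M(q₁, q₂), because
the phases separate finite measures (`sum_conj_mul_eq`, `exists_acts_of_translation`). Commutation
with Δ^{it} ⊗ Δ^{it} makes M invariant under simultaneous translations, hence a function S of q₁ -
q₂ (`exists_eq_comp_sub`). Operator and multiplier determine each other, so unitarity, reflection,
Yang–Baxter and TCP become almost everywhere identities of matrices (`unitary_iff`,
`reflection_iff`, `yangBaxter_iff`, `tcp_iff`).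

Locality corresponds to analyticity together with crossing. If S is analytic, the integral over the
first rapidity contains two Hardy functions times S; moving the contour to ℝ + iπ conjugates the
Hardy functions and crosses S (`locality_of_analytic`). Conversely, locality extends by polarization
from H and H' to vectors in the domain of Δ^{1/2} (`extended_locality`). Tested on simple fractions
with poles off the closed strip, it says that S and its crossed partner have the same integrals
against products of two Cauchy kernels (`cauchyPair_eq_of_locality`). This is what makes the Cauchy
integral over both edges independent of the auxiliary pole. With the conjugate point as pole the
integral becomes a Poisson integral plus a small error, which gives boundedness and the boundary
values (`exists_bounded_analytic`).

The representation itself exists because a unitary mixing of the components α and bar α turns the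
twisted reality condition into the componentwise one (`exists_isSchrodingerRep`). -/

noncomputable section

namespace Scattering

/-! ### Complex analysis on the strip -/

section Strip

variable {E : Type*} [NormedAddCommGroup E] [NormedSpace ℂ E]

/-- A function that is continuous on `-1/2 ≤ Im z ≤ 0`, analytic in the interior, and vanishes on
the real line, vanishes. -/
theorem eq_zero_of_eq_zero_on_real {f : ℂ → E}
    (hc : ContinuousOn f {z | -(1 / 2) ≤ z.im ∧ z.im ≤ 0})
    (hd : DifferentiableOn ℂ f {z | -(1 / 2) < z.im ∧ z.im < 0})
    (h0 : ∀ t : ℝ, f t = 0) (z : ℂ) (hz : -(1 / 2) ≤ z.im ∧ z.im ≤ 0) : f z = 0 := by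
  have key : ∀ z : ℂ, -(1 / 2) < z.im → z.im < 0 → f z = 0 := by
    intro z hz1 hz2
    -- The map `m` carries the lower unit half disc into the strip and its diameter to the real
    -- line, where f vanishes. The weight exp(-k(w + i)²) has modulus at most 1 on the arc, since
    -- there (Im w + 1)² - (Re w)² = 2 Im w (Im w + 1) ≤ 0, but it grows with k on the open segment
    -- from -i to 0. The maximum principle then forces f to vanish at the image of that segment, and
    -- k → ∞ concludes.
    set U : Set ℂ := Metric.ball 0 1 ∩ {w : ℂ | w.im < 0} with hU
    have hUb : Bornology.IsBounded U := Metric.isBounded_ball.subset Set.inter_subset_left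
    have hcl : closure U ⊆ Metric.closedBall 0 1 ∩ {w : ℂ | w.im ≤ 0} := by
      refine (closure_inter_subset_inter_closure _ _).trans (Set.inter_subset_inter
        Metric.closure_ball_subset_closedBall ?_)
      rw [Complex.closure_setOfPred_im_lt]
    set m : ℂ → ℂ := fun w => z.re + w / 2 with hm
    have mim : ∀ w : ℂ, (m w).im = w.im / 2 := by
      intro w
      simp [hm]
    have hmm : ∀ w ∈ closure U, -(1 / 2) ≤ (m w).im ∧ (m w).im ≤ 0 := by
      intro w hw
      have h1 := hcl hw
      have h2 : ‖w‖ ≤ 1 := by simpa using h1.1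
      have h3 : w.im ≤ 0 := h1.2
      have h4 := (abs_le.1 ((Complex.abs_im_le_norm w).trans h2)).1
      rw [mim]
      constructor <;> linarith
    have hmo : ∀ w ∈ U, -(1 / 2) < (m w).im ∧ (m w).im < 0 := by
      intro w hw
      have h2 : ‖w‖ < 1 := by simpa using hw.1
      have h3 : w.im < 0 := hw.2
      have h4 := (abs_lt.1 ((Complex.abs_im_le_norm w).trans_lt h2)).1
      rw [mim]
      constructor <;> linarith
    have hmc : Continuous m := by fun_prop
    have hmd : Differentiable ℂ m := by fun_prop
    have hfc : ContinuousOn (fun w => f (m w)) (closure U) :=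
      hc.comp hmc.continuousOn hmm
    obtain ⟨M, hM⟩ := (hUb.isCompact_closure.image_of_continuousOn hfc).isBounded.exists_norm_le
    have hM' : ∀ w ∈ closure U, ‖f (m w)‖ ≤ M := fun w hw => hM _ ⟨w, hw, rfl⟩
    have hbd : ∀ k : ℕ, ∀ w ∈ closure U,
        ‖Complex.exp (-(k * (w + Complex.I) ^ 2)) • f (m w)‖ ≤ M := by
      intro k w hw
      have hdc : DiffContOnCl ℂ
          (fun w => Complex.exp (-(k * (w + Complex.I) ^ 2)) • f (m w)) U := by
        refine DiffContOnCl.smul ?_ ⟨hd.comp hmd.differentiableOn hmo, hfc⟩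
        exact Differentiable.diffContOnCl (by fun_prop)
      refine Complex.norm_le_of_forall_mem_frontier_norm_le hUb hdc ?_ hw
      intro v hv
      have hvU : v ∈ closure U := frontier_subset_closure hv
      have hvc := hcl hvU
      have hM0 : 0 ≤ M := (norm_nonneg _).trans (hM' v hvU)
      rcases frontier_inter_subset _ _ hv with h | h
      · have hn : ‖v‖ = 1 := by
          have := h.1
          rw [frontier_ball _ one_ne_zero] at this
          simpa using this
        have him : v.im ≤ 0 := hvc.2
        have hsq : v.re ^ 2 + v.im ^ 2 = 1 := by
          have := Complex.sq_norm v
          rw [hn, Complex.normSq_apply] at this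
          nlinarith
        have h1 : ‖Complex.exp (-(k * (v + Complex.I) ^ 2))‖ ≤ 1 := by
          rw [Complex.norm_exp, Real.exp_le_one_iff]
          have : (-(k * (v + Complex.I) ^ 2) : ℂ).re = k * ((v.im + 1) ^ 2 - v.re ^ 2) := by
            simp [pow_two]
            ring
          rw [this]
          have h5 : (v.im + 1) ^ 2 - v.re ^ 2 ≤ 0 := by
            have : -1 ≤ v.im := (abs_le.1 ((Complex.abs_im_le_norm v).trans hn.le)).1
            nlinarith
          exact mul_nonpos_of_nonneg_of_nonpos (Nat.cast_nonneg k) h5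
        rw [norm_smul]
        exact (mul_le_mul h1 (hM' v hvU) (norm_nonneg _) zero_le_one).trans (one_mul M).le
      · have him : v.im = 0 := by
          have := h.2
          rwa [Complex.frontier_setOfPred_im_lt] at this
        have : m v = ((z.re + v.re / 2 : ℝ) : ℂ) := by
          apply Complex.ext
          · simp [hm]
          · rw [mim]; simp [him]
        rw [this, h0, smul_zero, norm_zero]
        exact hM0
    set w0 : ℂ := ⟨0, 2 * z.im⟩ with hw0
    have hw0U : w0 ∈ U := by
      refine ⟨?_, ?_⟩
      · have : w0 = ((2 * z.im : ℝ) : ℂ) * Complex.I := by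
          apply Complex.ext <;> simp [hw0]
        rw [mem_ball_zero_iff, this, norm_mul, Complex.norm_I, Complex.norm_real, mul_one,
          Real.norm_eq_abs, abs_lt]
        constructor <;> linarith
      · simp only [hw0, Set.mem_ofPred_eq]; linarith
    have hmw0 : m w0 = z := by
      apply Complex.ext
      · simp [hm, hw0]
      · rw [mim]; simp [hw0]
    have h6 : ∀ k : ℕ, (k : ℝ) * ((2 * z.im + 1) ^ 2 * ‖f z‖) ≤ M := by
      intro k
      have h := hbd k w0 (subset_closure hw0U)
      rw [hmw0, norm_smul, Complex.norm_exp] at h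
      have h7 : (-(k * (w0 + Complex.I) ^ 2) : ℂ).re = k * (2 * z.im + 1) ^ 2 := by
        simp [pow_two, hw0]
      rw [h7] at h
      refine le_trans ?_ h
      rw [← mul_assoc]
      refine mul_le_mul_of_nonneg_right ?_ (norm_nonneg _)
      linarith [Real.add_one_le_exp ((k : ℝ) * (2 * z.im + 1) ^ 2)]
    by_contra hne
    have hpos : 0 < (2 * z.im + 1) ^ 2 * ‖f z‖ := by
      have : 0 < 2 * z.im + 1 := by linarith
      have : 0 < ‖f z‖ := norm_pos_iff.2 hne
      positivity
    obtain ⟨k, hk⟩ := exists_nat_gt (M / ((2 * z.im + 1) ^ 2 * ‖f z‖))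
    rw [div_lt_iff₀ hpos] at hk
    linarith [h6 k]
  have hEq : Set.EqOn f 0 {z : ℂ | -(1 / 2) ≤ z.im ∧ z.im ≤ 0} := by
    refine Set.EqOn.of_subset_closure (s := {z : ℂ | -(1 / 2) < z.im ∧ z.im < 0})
      (fun w hw => key w hw.1 hw.2) hc continuousOn_const
      (fun w hw => ⟨hw.1.le, hw.2.le⟩) ?_
    have := Complex.closure_preimage_im (Set.Ioo (-(1 / 2 : ℝ)) 0)
    rw [closure_Ioo (by norm_num)] at this
    exact this.ge
  exact hEq hz

/-- Integrals of locally dominated families of holomorphic functions are holomorphic. -/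
theorem differentiableAt_integral_of_dominated {α : Type*} [MeasurableSpace α] {μ : Measure α}
    {F : ℂ → α → E} {z₀ : ℂ} {r : ℝ} (hr : 0 < r) {bound : α → ℝ}
    (hm : ∀ z ∈ Metric.ball z₀ r, AEStronglyMeasurable (F z) μ)
    (hd : ∀ a, DifferentiableOn ℂ (fun z => F z a) (Metric.ball z₀ r))
    (hb : ∀ᵐ a ∂μ, ∀ z ∈ Metric.ball z₀ r, ‖F z a‖ ≤ bound a) (hi : Integrable bound μ) :
    DifferentiableAt ℂ (fun z => ∫ a, F z a ∂μ) z₀ := by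
  have hball : ∀ z ∈ Metric.ball z₀ (r / 2), Metric.closedBall z (r / 4) ⊆ Metric.ball z₀ r := by
    intro z hz w hw
    rw [Metric.mem_ball] at *
    rw [Metric.mem_closedBall] at hw
    linarith [dist_triangle w z z₀]
  have hz₀ : z₀ ∈ Metric.ball z₀ (r / 2) := Metric.mem_ball_self (by linarith)
  have hda : ∀ a, ∀ z ∈ Metric.ball z₀ (r / 2), HasDerivAt (fun z => F z a)
      (deriv (fun z => F z a) z) z := by
    intro a z hz
    refine ((hd a).differentiableAt (Metric.isOpen_ball.mem_nhds ?_)).hasDerivAt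
    exact hball z hz (Metric.mem_closedBall_self (by linarith))
  refine (hasDerivAt_integral_of_dominated_loc_of_deriv_le (𝕜 := ℂ) (F := F) (x₀ := z₀)
    (s := Metric.ball z₀ (r / 2)) (F' := fun z a => deriv (fun z => F z a) z)
    (bound := fun a => bound a / (r / 4)) (Metric.ball_mem_nhds _ (by linarith)) ?_ ?_ ?_ ?_
    (hi.div_const _) ?_).2.differentiableAt
  · filter_upwards [Metric.ball_mem_nhds z₀ hr] with z hz using hm z hz
  · refine Integrable.mono' hi (hm _ (Metric.mem_ball_self hr)) ?_
    filter_upwards [hb] with a ha using ha _ (Metric.mem_ball_self hr)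
  -- Measurability of the derivative in the parameter: it is a pointwise limit of difference
  -- quotients.
  · obtain ⟨u, -, hu⟩ : ∃ u : ℕ → ℝ, StrictAnti u ∧ (∀ n, 0 < u n) ∧ Tendsto u atTop (𝓝 0) :=
      exists_seq_strictAnti_tendsto 0
    have hu2 : ∀ᶠ n in atTop, u n < r := hu.2.eventually (gt_mem_nhds hr)
    obtain ⟨N, hN⟩ := eventually_atTop.1 hu2
    refine aestronglyMeasurable_of_tendsto_ae atTop
      (f := fun n a => ((u (n + N) : ℂ)⁻¹ • (F (z₀ + (u (n + N) : ℂ)) a - F z₀ a))) ?_ ?_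
    · intro n
      refine AEStronglyMeasurable.const_smul (AEStronglyMeasurable.sub ?_
        (hm _ (Metric.mem_ball_self hr))) _
      refine hm _ ?_
      simp only [Metric.mem_ball, dist_self_add_left, Complex.norm_real, Real.norm_eq_abs,
        abs_of_pos (hu.1 (n + N))]
      exact hN _ (by lia)
    · refine Eventually.of_forall fun a => ?_
      have h := (hda a z₀ hz₀).tendsto_slope_zero
      refine h.comp (tendsto_nhdsWithin_iff.2 ⟨?_, Eventually.of_forall fun n => ?_⟩)
      · have := (Complex.continuous_ofReal.tendsto 0).comp
          (hu.2.comp (tendsto_add_atTop_nat N))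
        simpa using! this
      · simpa using (hu.1 (n + N)).ne'
  · filter_upwards [hb] with a ha z hz
    -- Cauchy's estimate on circles of radius r/4 turns the bound on F into a bound on its
    -- derivative.
    refine Complex.norm_deriv_le_of_forall_mem_sphere_norm_le (by linarith) ?_ ?_
    · exact ((hd a).mono (hball z hz)).diffContOnCl_ball (subset_refl _)
    · intro w hw
      exact ha w (hball z hz (Metric.sphere_subset_closedBall hw))
  · exact Eventually.of_forall fun a z hz => hda a z hz

end Strip

/-! ### Gaussian kernels -/

section GaussianKernel

/-- The Gaussian kernel `√(c/π) exp(-c z²)`. -/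
def gker (c : ℝ) (z : ℂ) : ℂ := (√(c / Real.pi) : ℝ) * Complex.exp (-(c * z ^ 2))

theorem differentiable_gker (c : ℝ) : Differentiable ℂ (gker c) := by
  unfold gker
  fun_prop

theorem gker_neg (c : ℝ) (z : ℂ) : gker c (-z) = gker c z := by
  simp [gker]

theorem conj_gker (c : ℝ) (z : ℂ) : conj (gker c z) = gker c (conj z) := by
  simp [gker, ← Complex.exp_conj]

theorem norm_gker (c : ℝ) (t : ℝ) (z : ℂ) : ‖gker c (t - z)‖ =
    Real.exp (c * z.im ^ 2) * (√(c / Real.pi) * Real.exp (-c * (t - z.re) ^ 2)) := by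
  rw [gker, norm_mul, Complex.norm_exp, Complex.norm_real, Real.norm_eq_abs,
    abs_of_nonneg (Real.sqrt_nonneg _), mul_left_comm, ← Real.exp_add]
  congr 2
  simp [pow_two]
  ring

/-- A majorant centred at 0 is needed for domination locally uniform in z. Halving the rate leaves
the square (c/2)(t - 2 Re z)² as the slack. -/
theorem norm_gker_le {c : ℝ} (hc : 0 < c) (t : ℝ) (z : ℂ) : ‖gker c (t - z)‖ ≤
    Real.exp (c * ‖z‖ ^ 2) * (√(c / Real.pi) * Real.exp (-(c / 2) * t ^ 2)) := by
  rw [norm_gker, mul_left_comm, mul_left_comm (Real.exp (c * ‖z‖ ^ 2)), ← Real.exp_add,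
    ← Real.exp_add, Complex.sq_norm, Complex.normSq_apply]
  refine mul_le_mul_of_nonneg_left (Real.exp_le_exp.2 ?_) (Real.sqrt_nonneg _)
  nlinarith [mul_nonneg hc.le (sq_nonneg (t - 2 * z.re))]

theorem integrable_norm_gker {c : ℝ} (hc : 0 < c) (z : ℂ) :
    Integrable fun t : ℝ => ‖gker c (t - z)‖ := by
  simp only [norm_gker]
  exact (((integrable_exp_neg_mul_sq hc).comp_sub_right z.re).const_mul _).const_mul _

theorem integral_norm_gker {c : ℝ} (hc : 0 < c) (z : ℂ) :
    ∫ t : ℝ, ‖gker c (t - z)‖ = Real.exp (c * z.im ^ 2) := by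
  simp only [norm_gker, integral_const_mul]
  rw [integral_sub_right_eq_self (fun t : ℝ => Real.exp (-c * t ^ 2)), integral_gaussian,
    ← Real.sqrt_mul (by positivity), div_mul_div_cancel₀ Real.pi_ne_zero, div_self hc.ne',
    Real.sqrt_one, mul_one]

theorem gker_ofReal (c t : ℝ) :
    gker c t = ((√(c / Real.pi) * Real.exp (-c * t ^ 2) : ℝ) : ℂ) := by
  simp [gker]

theorem integral_gker {c : ℝ} (hc : 0 < c) : ∫ t : ℝ, gker c t = 1 := by
  simp only [gker_ofReal]
  rw [integral_complex_ofReal, integral_const_mul, integral_gaussian,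
    ← Real.sqrt_mul (by positivity), div_mul_div_cancel₀ Real.pi_ne_zero, div_self hc.ne',
    Real.sqrt_one, Complex.ofReal_one]

end GaussianKernel

/-! ### Unitary groups and their entire vectors -/

section UnitaryGroup

variable {𝓗 : Type*} [NormedAddCommGroup 𝓗] [InnerProductSpace ℂ 𝓗] [CompleteSpace 𝓗]

theorem inner_map_map_of_unitary {A : 𝓗 →L[ℂ] 𝓗} (hA : A ∈ unitary (𝓗 →L[ℂ] 𝓗)) (x y : 𝓗) :
    ⟪A x, A y⟫_ℂ = ⟪x, y⟫_ℂ := by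
  rw [← ContinuousLinearMap.adjoint_inner_right, ← mul_apply_eq_comp,
    ← ContinuousLinearMap.star_eq_adjoint, (Unitary.mem_iff.1 hA).1,
    one_apply_eq_self]

theorem norm_map_of_unitary {A : 𝓗 →L[ℂ] 𝓗} (hA : A ∈ unitary (𝓗 →L[ℂ] 𝓗)) (x : 𝓗) :
    ‖A x‖ = ‖x‖ := by
  rw [@norm_eq_sqrt_re_inner ℂ, inner_map_map_of_unitary hA, ← @norm_eq_sqrt_re_inner ℂ]

namespace IsUnitaryGroup

variable {D : ℝ → 𝓗 →L[ℂ] 𝓗} (hD : IsUnitaryGroup D)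

include hD

theorem norm_apply (t : ℝ) (x : 𝓗) : ‖D t x‖ = ‖x‖ := norm_map_of_unitary (hD.unitary t) x

theorem inner_apply (t : ℝ) (x y : 𝓗) : ⟪D t x, D t y⟫_ℂ = ⟪x, y⟫_ℂ :=
  inner_map_map_of_unitary (hD.unitary t) x y

theorem zero_apply (x : 𝓗) : D 0 x = x := by
  have h1 : D 0 (D 0 x) = D 0 x := by
    rw [← mul_apply_eq_comp, ← hD.add, add_zero]
  have h2 : ‖D 0 (D 0 x - x)‖ = 0 := by rw [map_sub, h1, sub_self, norm_zero]
  rw [hD.norm_apply, norm_eq_zero, sub_eq_zero] at h2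
  exact h2

theorem add_apply (s t : ℝ) (x : 𝓗) : D (s + t) x = D s (D t x) := by
  rw [hD.add, mul_apply_eq_comp]

theorem inner_left (t : ℝ) (x y : 𝓗) : ⟪D t x, y⟫_ℂ = ⟪x, D (-t) y⟫_ℂ := by
  rw [← hD.inner_apply (-t), ← hD.add_apply, neg_add_cancel, hD.zero_apply]

end IsUnitaryGroup

/-- The orbit, continued to the complex plane, of the Gaussian average of `x`. -/
def smear (D : ℝ → 𝓗 →L[ℂ] 𝓗) (c : ℝ) (x : 𝓗) (z : ℂ) : 𝓗 := ∫ t : ℝ, gker c (t - z) • D t x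

variable {D : ℝ → 𝓗 →L[ℂ] 𝓗} (hD : IsUnitaryGroup D) {c : ℝ} (hc : 0 < c)

include hD

theorem aestronglyMeasurable_gker_smul (c : ℝ) (x : 𝓗) (z : ℂ) :
    AEStronglyMeasurable (fun t : ℝ => gker c (t - z) • D t x) :=
  (((differentiable_gker c).continuous.comp (by fun_prop)).smul
    (hD.continuous x)).aestronglyMeasurable

include hc

theorem integrable_gker_smul (x : 𝓗) (z : ℂ) :
    Integrable fun t : ℝ => gker c (t - z) • D t x := by
  refine Integrable.mono' ((integrable_norm_gker hc z).mul_const ‖x‖)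
    (aestronglyMeasurable_gker_smul hD c x z) (Eventually.of_forall fun t => ?_)
  rw [norm_smul, hD.norm_apply]

/-- The bound does not depend on Re z, so smeared orbits are bounded on horizontal strips. Both
Phragmén–Lindelöf and Liouville are applied through this. -/
theorem norm_smear_le (x : 𝓗) (z : ℂ) : ‖smear D c x z‖ ≤ Real.exp (c * z.im ^ 2) * ‖x‖ := by
  refine (norm_integral_le_integral_norm _).trans ?_
  simp only [norm_smul, hD.norm_apply]
  rw [integral_mul_const, integral_norm_gker hc]

theorem differentiable_smear (x : 𝓗) : Differentiable ℂ (smear D c x) := by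
  intro z₀
  refine differentiableAt_integral_of_dominated (r := 1) one_pos
    (bound := fun t => Real.exp (c * (‖z₀‖ + 1) ^ 2) *
      (√(c / Real.pi) * Real.exp (-(c / 2) * t ^ 2)) * ‖x‖)
    (fun z _ => aestronglyMeasurable_gker_smul hD c x z) ?_ ?_ ?_
  · intro t
    refine Differentiable.differentiableOn ?_
    exact ((differentiable_gker c).comp (by fun_prop)).smul_const _
  · refine Eventually.of_forall fun t z hz => ?_
    rw [norm_smul, hD.norm_apply]
    refine mul_le_mul_of_nonneg_right ((norm_gker_le hc t z).trans ?_) (norm_nonneg _)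
    refine mul_le_mul_of_nonneg_right (Real.exp_le_exp.2 ?_) (by positivity)
    have : ‖z‖ ≤ ‖z₀‖ + 1 := by
      have h1 : ‖z - z₀‖ < 1 := by simpa [dist_eq_norm] using hz
      linarith [norm_sub_norm_le z z₀]
    gcongr
  · exact ((((integrable_exp_neg_mul_sq (half_pos hc)).const_mul _).const_mul _).mul_const _)

/-- The group acts by real translation of the parameter, so the smeared orbit is the entire
continuation of a genuine orbit. -/
theorem apply_smear (s : ℝ) (x : 𝓗) (z : ℂ) : D s (smear D c x z) = smear D c x (z + s) := by
  rw [smear, smear, ← ContinuousLinearMap.integral_comp_comm _ (integrable_gker_smul hD hc x z),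
    ← integral_add_right_eq_self (fun t : ℝ => gker c (t - (z + s)) • D t x) s]
  refine integral_congr_ae (Eventually.of_forall fun t => ?_)
  simp only [map_smul]
  rw [add_comm t s, hD.add_apply]
  congr 2
  push_cast
  ring

theorem inner_smear_right (x y : 𝓗) (z : ℂ) :
    ⟪y, smear D c x z⟫_ℂ = ∫ t : ℝ, gker c (t - z) * ⟪y, D t x⟫_ℂ := by
  rw [smear, ← integral_inner (integrable_gker_smul hD hc x z)]
  simp only [inner_smul_right]

/-- Averaging against a Gaussian passes to the other side of the inner product: t ↦ -t replaces D(t)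
by its adjoint, and conjugating the even kernel replaces z by -conj z. -/
theorem inner_smear_left (x y : 𝓗) (z : ℂ) :
    ⟪smear D c x z, y⟫_ℂ = ⟪x, smear D c y (-conj z)⟫_ℂ := by
  rw [← inner_conj_symm, inner_smear_right hD hc, inner_smear_right hD hc, ← integral_conj,
    ← integral_neg_eq_self]
  refine integral_congr_ae (Eventually.of_forall fun t => ?_)
  simp only [map_mul, conj_gker, inner_conj_symm]
  rw [hD.inner_left, neg_neg, ← gker_neg]
  congr 2
  simp
  ring

omit hc in
-- The kernels with c = n + 1 form an approximate identity. Rescaling t by √(n + 1) moves the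
-- dependence on n from the kernel into the group, so that a single majorant serves all n.
theorem tendsto_smear (x : 𝓗) :
    Tendsto (fun n : ℕ => smear D (n + 1) x 0) atTop (𝓝 x) := by
  have h1 : ∀ n : ℕ, smear D (n + 1) x 0 = ∫ t : ℝ, gker 1 t • D ((√(n + 1))⁻¹ * t) x := by
    intro n
    have hpos : (0 : ℝ) < n + 1 := by positivity
    have hs : 0 < √((n : ℝ) + 1) := Real.sqrt_pos.2 hpos
    have := Measure.integral_comp_mul_left
      (fun t : ℝ => gker 1 t • D ((√((n : ℝ) + 1))⁻¹ * t) x) (√((n : ℝ) + 1))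
    rw [abs_of_pos (inv_pos.2 hs)] at this
    have h2 : ∫ t : ℝ, gker 1 t • D ((√((n : ℝ) + 1))⁻¹ * t) x = √((n : ℝ) + 1) •
        ∫ t : ℝ, gker 1 ((√((n : ℝ) + 1) * t : ℝ) : ℂ) •
          D ((√((n : ℝ) + 1))⁻¹ * (√((n : ℝ) + 1) * t)) x := by
      rw [this, smul_smul, mul_inv_cancel₀ hs.ne', one_smul]
    rw [h2, ← integral_smul, smear]
    refine integral_congr_ae (Eventually.of_forall fun t => ?_)
    simp only [sub_zero]
    rw [← mul_assoc, inv_mul_cancel₀ hs.ne', one_mul, gker_ofReal, gker_ofReal,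
      ← Complex.coe_smul, smul_smul, ← Complex.ofReal_mul]
    congr 2
    rw [mul_pow, Real.sq_sqrt hpos.le, div_eq_mul_one_div, Real.sqrt_mul hpos.le]
    ring_nf
  simp only [h1]
  have h3 : x = ∫ t : ℝ, gker 1 t • x := by
    rw [integral_smul_const, integral_gker one_pos, one_smul]
  nth_rw 2 [h3]
  refine tendsto_integral_of_dominated_convergence (fun t => ‖gker 1 t‖ * ‖x‖) ?_ ?_ ?_ ?_
  · intro n
    refine Continuous.aestronglyMeasurable ?_
    exact ((differentiable_gker 1).continuous.comp (by fun_prop)).smul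
      ((hD.continuous x).comp (by fun_prop))
  · have := integrable_norm_gker one_pos 0
    simp only [sub_zero] at this
    exact this.mul_const _
  · intro n
    refine Eventually.of_forall fun t => ?_
    rw [norm_smul, hD.norm_apply]
  · refine Eventually.of_forall fun t => ?_
    refine Tendsto.const_smul ?_ _
    have h4 : Tendsto (fun n : ℕ => (√((n : ℝ) + 1))⁻¹ * t) atTop (𝓝 0) := by
      rw [← zero_mul t]
      refine Tendsto.mul_const _ (tendsto_inv_atTop_zero.comp (Real.tendsto_sqrt_atTop.comp ?_))
      exact tendsto_atTop_add_const_right _ _ tendsto_natCast_atTop_atTop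
    have h5 := ((hD.continuous x).tendsto 0).comp h4
    rwa [hD.zero_apply] at h5

end UnitaryGroup

/-! ### The square root of the modular operator -/

section SqrtValue

variable {𝓗 : Type*} [NormedAddCommGroup 𝓗] [InnerProductSpace ℂ 𝓗] [CompleteSpace 𝓗]

/-- The inner product is antilinear in its first slot; conjugating the argument there restores
holomorphy. -/
theorem differentiableAt_inner_conj {Ψ Φ : ℂ → 𝓗} {z : ℂ}
    (hΨ : DifferentiableAt ℂ Ψ (conj z)) (hΦ : DifferentiableAt ℂ Φ z) :
    DifferentiableAt ℂ (fun w => ⟪Ψ (conj w), Φ w⟫_ℂ) z := by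
  have h1 : HasDerivAt (fun w => InnerProductSpace.toDual ℂ 𝓗 (Ψ (conj w)))
      (InnerProductSpace.toDual ℂ 𝓗 (deriv Ψ (conj z))) z := by
    rw [hasDerivAt_iff_isLittleO]
    have h2 := (hasDerivAt_iff_isLittleO.1 hΨ.hasDerivAt).comp_tendsto
      (Complex.continuous_conj.tendsto z)
    refine Asymptotics.IsLittleO.of_norm_norm ?_
    refine (h2.norm_norm).congr (fun w => ?_) (fun w => ?_)
    · simp only [Function.comp_apply]
      rw [← (InnerProductSpace.toDual ℂ 𝓗).norm_map]
      simp only [map_sub, LinearIsometryEquiv.map_smulₛₗ, Complex.conj_conj]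
    · simp only [Function.comp_apply]
      rw [← map_sub, Complex.norm_conj]
  exact h1.differentiableAt.clm_apply hΦ

theorem neg_conj_neg_half_I : -conj (-(Complex.I / 2)) = -(Complex.I / 2) := by
  simp [neg_div, map_ofNat (starRingEnd ℂ) 2]

variable {D : ℝ → 𝓗 →L[ℂ] 𝓗} (hD : IsUnitaryGroup D) {c : ℝ} (hc : 0 < c)

include hD hc

/-- On entire vectors Δ^{1/2} is translation of the parameter by -i/2. -/
theorem isSqrtValue_smear (x : 𝓗) (z : ℂ) :
    IsSqrtValue D (smear D c x z) (smear D c x (z - Complex.I / 2)) := by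
  have hd : Differentiable ℂ fun w => smear D c x (z + w) :=
    (differentiable_smear hD hc x).comp (by fun_prop)
  refine ⟨fun w => smear D c x (z + w), hd.continuous.continuousOn, hd.differentiableOn, ?_, ?_⟩
  · intro t
    rw [apply_smear hD hc]
  · simp only [sub_eq_add_neg]

/-- Symmetry of Δ^{1/2}. Continue one factor along its orbit and the other backwards: the inner
product is constant for real parameters by unitarity, hence constant on the closed strip. The two
sides are its values at -i/2 and at 0; note that ζ ↦ conj(-ζ) preserves the imaginary part, so the
domain of Φ is respected. -/
theorem IsSqrtValue.inner_smear {v w : 𝓗} (h : IsSqrtValue D v w) (x : 𝓗) (z : ℂ) :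
    ⟪w, smear D c x z⟫_ℂ = ⟪v, smear D c x (z - Complex.I / 2)⟫_ℂ := by
  obtain ⟨Φ, h1, h2, h3, h4⟩ := h
  have him : ∀ ζ : ℂ, (conj (-ζ)).im = ζ.im := fun ζ => by simp
  have hX := differentiable_smear hD hc x
  have key := eq_zero_of_eq_zero_on_real
    (f := fun ζ => ⟪Φ (conj (-ζ)), smear D c x (z - Complex.I / 2 - ζ)⟫_ℂ -
      ⟪v, smear D c x (z - Complex.I / 2)⟫_ℂ) ?_ ?_ ?_ (-(Complex.I / 2)) (by norm_num)
  · have h5 : conj (-(-(Complex.I / 2))) = -(Complex.I / 2) := by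
      rw [map_neg, neg_conj_neg_half_I]
    rw [h5, h4, sub_eq_zero] at key
    simpa using key
  · refine ContinuousOn.sub (ContinuousOn.inner ?_ ?_) continuousOn_const
    · refine h1.comp (by fun_prop) fun ζ hζ => ?_
      simp only [Set.mem_ofPred_eq, him]
      exact hζ
    · exact (hX.continuous.comp (by fun_prop)).continuousOn
  · refine DifferentiableOn.sub ?_ (differentiableOn_const _)
    intro ζ hζ
    have hopen : IsOpen {z : ℂ | -(1 / 2) < z.im ∧ z.im < 0} :=
      (isOpen_lt continuous_const Complex.continuous_im).inter
        (isOpen_lt Complex.continuous_im continuous_const)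
    refine (differentiableAt_inner_conj (Ψ := fun ζ => Φ (-ζ))
      (Φ := fun ζ => smear D c x (z - Complex.I / 2 - ζ)) ?_ ?_).congr_of_eventuallyEq
      (Eventually.of_forall fun w => ?_) |>.differentiableWithinAt
      (f := fun ζ => ⟪Φ (conj (-ζ)), smear D c x (z - Complex.I / 2 - ζ)⟫_ℂ)
    · have h6 : DifferentiableAt ℂ Φ (-(conj ζ)) := by
        refine h2.differentiableAt (hopen.mem_nhds ?_)
        have := him ζ
        rw [map_neg] at this
        simp only [Set.mem_ofPred_eq, this]
        exact hζ
      exact h6.comp _ (by fun_prop)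
    · exact (hX _).comp _ (by fun_prop)
    · simp only [map_neg]
  · intro t
    have h7 : conj (-(t : ℂ)) = ((-t : ℝ) : ℂ) := by simp
    rw [h7, h3]
    have h8 : smear D c x (z - Complex.I / 2 - t) = D (-t) (smear D c x (z - Complex.I / 2)) := by
      rw [apply_smear hD hc]
      congr 1
      push_cast
      ring
    rw [h8, hD.inner_apply, sub_self]

omit hc in
-- Closedness of Δ^{1/2}. Unitarity reduces the norms of the differences on each edge to their
-- values at 0 and -i/2. By the three lines bound the smeared orbits are uniformly Cauchy on the
-- closed strip, and their limit is the required continuation of the orbit of v.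
theorem isSqrtValue_of_tendsto {v w : 𝓗}
    (h : Tendsto (fun n : ℕ => smear D (n + 1) v (-(Complex.I / 2))) atTop (𝓝 w)) :
    IsSqrtValue D v w := by
  have hn : ∀ n : ℕ, (0 : ℝ) < n + 1 := fun n => by positivity
  set X : ℕ → ℂ → 𝓗 := fun n => smear D (n + 1) v with hX
  have hXd : ∀ n, Differentiable ℂ (X n) := fun n => differentiable_smear hD (hn n) v
  have hv : Tendsto (fun n => X n 0) atTop (𝓝 v) := tendsto_smear hD v
  have hshift : ∀ n (z : ℂ), z.im = 0 → X n z = D z.re (X n 0) := by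
    intro n z hz
    rw [hX, apply_smear hD (hn n), zero_add]
    congr 1
    apply Complex.ext <;> simp [hz]
  have hshift2 : ∀ n (z : ℂ), z.im = -(1 / 2) → X n z = D z.re (X n (-(Complex.I / 2))) := by
    intro n z hz
    rw [hX, apply_smear hD (hn n)]
    congr 1
    apply Complex.ext <;> simp [hz]
  have hbound : ∀ n m (z : ℂ), -(1 / 2) ≤ z.im → z.im ≤ 0 → ‖X n z - X m z‖ ≤
      max ‖X n 0 - X m 0‖ ‖X n (-(Complex.I / 2)) - X m (-(Complex.I / 2))‖ := by
    intro n m z h1 h2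
    refine PhragmenLindelof.horizontal_strip (a := -(1 / 2)) (b := 0)
      (f := fun z => X n z - X m z)
      ((hXd n).sub (hXd m)).diffContOnCl ⟨0, by norm_num; positivity, 0, ?_⟩ ?_ ?_ h1 h2
    · refine Asymptotics.IsBigO.of_bound
        (Real.exp ((n + 1) * 1) * ‖v‖ + Real.exp ((m + 1) * 1) * ‖v‖) ?_
      refine Filter.eventually_inf_principal.2 (Eventually.of_forall fun z hz => ?_)
      simp only [zero_mul, Real.exp_zero, norm_one, mul_one]
      have hz2 : z.im ^ 2 ≤ 1 := by
        have : -(1 / 2) < z.im ∧ z.im < 0 := hz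
        nlinarith [this.1, this.2]
      refine (norm_sub_le _ _).trans (add_le_add ?_ ?_)
      · refine (norm_smear_le hD (hn n) v z).trans ?_
        gcongr
        nlinarith [hn n]
      · refine (norm_smear_le hD (hn m) v z).trans ?_
        gcongr
        nlinarith [hn m]
    · intro z hz
      rw [hshift2 n z hz, hshift2 m z hz, ← map_sub, hD.norm_apply]
      exact le_max_right _ _
    · intro z hz
      rw [hshift n z hz, hshift m z hz, ← map_sub, hD.norm_apply]
      exact le_max_left _ _
  set K : Set ℂ := {z : ℂ | -(1 / 2) ≤ z.im ∧ z.im ≤ 0} with hK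
  have hcau : UniformCauchySeqOn X atTop K := by
    rw [Metric.uniformCauchySeqOn_iff]
    intro ε hε
    obtain ⟨N1, h1⟩ := Metric.cauchySeq_iff.1 hv.cauchySeq ε hε
    obtain ⟨N2, h2⟩ := Metric.cauchySeq_iff.1 h.cauchySeq ε hε
    refine ⟨max N1 N2, fun m hm n hn' z hz => ?_⟩
    rw [dist_eq_norm]
    refine (hbound m n z hz.1 hz.2).trans_lt (max_lt ?_ ?_)
    · rw [← dist_eq_norm]
      exact h1 m (le_of_max_le_left hm) n (le_of_max_le_left hn')
    · rw [← dist_eq_norm]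
      exact h2 m (le_of_max_le_right hm) n (le_of_max_le_right hn')
  have hlim : ∀ z, ∃ y, z ∈ K → Tendsto (fun n => X n z) atTop (𝓝 y) := by
    intro z
    by_cases hz : z ∈ K
    · obtain ⟨y, hy⟩ := cauchySeq_tendsto_of_complete (hcau.cauchySeq hz)
      exact ⟨y, fun _ => hy⟩
    · exact ⟨0, fun h => absurd h hz⟩
  choose Φ hΦ using hlim
  have hunif : TendstoUniformlyOn X Φ atTop K :=
    hcau.tendstoUniformlyOn_of_tendsto fun z hz => hΦ z hz
  refine ⟨Φ, ?_, ?_, ?_, ?_⟩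
  · exact hunif.continuousOn (Frequently.of_forall fun n => (hXd n).continuous.continuousOn)
  · have hopen : IsOpen {z : ℂ | -(1 / 2) < z.im ∧ z.im < 0} :=
      (isOpen_lt continuous_const Complex.continuous_im).inter
        (isOpen_lt Complex.continuous_im continuous_const)
    exact ((hunif.mono fun z hz => ⟨hz.1.le, hz.2.le⟩).tendstoLocallyUniformlyOn).differentiableOn
      (Eventually.of_forall fun n => (hXd n).differentiableOn) hopen
  · intro t
    have h1 : Tendsto (fun n => X n t) atTop (𝓝 (D t v)) := by
      refine (((D t).continuous.tendsto v).comp hv).congr fun n => ?_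
      rw [hshift n t (by simp)]
      simp
    exact tendsto_nhds_unique (hΦ t (by simp [hK])) h1
  · exact tendsto_nhds_unique (hΦ _ (by norm_num [hK])) h

omit hc in
/-- The operator `Δ^{1/2}` is self-adjoint. -/
theorem isSqrtValue_iff {v w : 𝓗} : IsSqrtValue D v w ↔
    ∀ (c : ℝ) (x : 𝓗), 0 < c →
      ⟪w, smear D c x 0⟫_ℂ = ⟪v, smear D c x (-(Complex.I / 2))⟫_ℂ := by
  constructor
  · intro h c x hc
    rw [h.inner_smear hD hc x 0, zero_sub]
  · intro h
    refine isSqrtValue_of_tendsto hD ((tendsto_smear hD w).congr fun n => ?_)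
    have hn : (0 : ℝ) < n + 1 := by positivity
    refine ext_inner_right ℂ fun x => ?_
    rw [inner_smear_left hD hn, inner_smear_left hD hn, neg_conj_neg_half_I, map_zero, neg_zero]
    exact h _ x hn

omit hc in
-- Δ^{1/2} commutes with Gaussian averages. Since tending c to infinity recovers the vectors, this
-- also gives uniqueness of the value.
theorem IsSqrtValue.smear_eq {v w : 𝓗} (h : IsSqrtValue D v w) (n : ℕ) :
    smear D (n + 1) v (-(Complex.I / 2)) = smear D (n + 1) w 0 := by
  have hn : (0 : ℝ) < n + 1 := by positivity
  refine ext_inner_right ℂ fun x => ?_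
  rw [inner_smear_left hD hn, inner_smear_left hD hn, neg_conj_neg_half_I, map_zero, neg_zero]
  exact ((isSqrtValue_iff hD).1 h _ x hn).symm

omit hc in
theorem IsSqrtValue.unique {v w w' : 𝓗} (h : IsSqrtValue D v w) (h' : IsSqrtValue D v w') :
    w = w' := by
  refine tendsto_nhds_unique (tendsto_smear hD w) ((tendsto_smear hD w').congr fun n => ?_)
  rw [← h.smear_eq hD, ← h'.smear_eq hD]

end SqrtValue

/-! ### Modular objects -/

section Modular

variable {𝓗 : Type*} [NormedAddCommGroup 𝓗] [InnerProductSpace ℂ 𝓗] [CompleteSpace 𝓗]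
  {H : StandardSubspace 𝓗} {D D' : ℝ → 𝓗 →L[ℂ] 𝓗} {J J' : 𝓗 ≃ₗᵢ⋆[ℂ] 𝓗}

/-- The whole uniqueness argument. As functions of z these inner products are entire. They have
period i because J Δ^{1/2} and J' Δ'^{1/2} are the same operator S_H, and they are bounded on one
period strip, so Liouville applies. -/
theorem IsModularPair.inner_smear_smear (h : IsModularPair H D J) (h' : IsModularPair H D' J')
    {c : ℝ} (hc : 0 < c) (x y : 𝓗) (z : ℂ) :
    ⟪smear D' c y (conj z), smear D c x z⟫_ℂ = ⟪smear D' c y 0, smear D c x 0⟫_ℂ := by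
  set g : ℂ → ℂ := fun z => ⟪smear D' c y (conj z), smear D c x z⟫_ℂ with hg
  have hdiff : Differentiable ℂ g := fun z =>
    differentiableAt_inner_conj (differentiable_smear h'.group hc y _)
      (differentiable_smear h.group hc x _)
  have hper : ∀ z, g (z - Complex.I) = g z := by
    intro z
    have h1 : IsSqrtValue D' (smear D' c y (conj z + Complex.I))
        (smear D' c y (conj z + Complex.I / 2)) := by
      convert isSqrtValue_smear h'.group hc y (conj z + Complex.I) using 2
      ring
    -- Passing through the common graph of S_H: a vector in the domain of the root of one group lies
    -- in the domain of the other. Each half period is moved across by the symmetry of one of the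
    -- roots, and the conjugations match the two results.
    obtain ⟨w, hw, hJw⟩ := (h.polar _ _).1 ((h'.polar _ _).2 ⟨_, h1, rfl⟩)
    have h2 := isSqrtValue_smear h.group hc x z
    obtain ⟨u, hu, hJu⟩ := (h'.polar _ _).1 ((h.polar _ _).2 ⟨_, h2, rfl⟩)
    have h3 := hw.inner_smear h.group hc x (z - Complex.I / 2)
    have h4 := hu.inner_smear h'.group hc y (conj z + Complex.I / 2)
    have e1 : conj (z - Complex.I) = conj z + Complex.I := by simp
    have e2 : z - Complex.I / 2 - Complex.I / 2 = z - Complex.I := by ring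
    have e3 : conj z + Complex.I / 2 - Complex.I / 2 = conj z := by ring
    rw [e2] at h3
    rw [e3] at h4
    have h5 := inner_anti J w (smear D c x (z - Complex.I / 2))
    rw [hJw, ← hJu, inner_anti J', (starRingEnd ℂ).injective.eq_iff] at h5
    simp only [hg]
    rw [e1, ← h3, ← h5, ← inner_conj_symm, h4, inner_conj_symm]
  have hbd : Bornology.IsBounded (Set.range g) := by
    refine isBounded_iff_forall_norm_le.2
      ⟨Real.exp (c * 1) * ‖y‖ * (Real.exp (c * 1) * ‖x‖), ?_⟩
    rintro _ ⟨z, rfl⟩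
    have hpern : ∀ (n : ℤ) z, g (z - n * Complex.I) = g z := by
      intro n
      induction n with
      | zero => simp
      | succ n ih =>
        intro z
        rw [← ih z, ← hper (z - (n : ℤ) * Complex.I)]
        congr 1
        push_cast
        ring
      | pred n ih =>
        intro z
        rw [← ih z, ← hper]
        congr 1
        push_cast
        ring
    rw [← hpern ⌊z.im⌋ z]
    set ζ := z - (⌊z.im⌋ : ℤ) * Complex.I with hζ
    have him : ζ.im = Int.fract z.im := by
      rw [← Int.self_sub_floor]
      simp [hζ]
    have hsq : ζ.im ^ 2 ≤ 1 := by
      rw [him]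
      nlinarith [Int.fract_nonneg z.im, Int.fract_lt_one z.im]
    refine (norm_inner_le_norm _ _).trans ?_
    refine mul_le_mul ?_ ?_ (norm_nonneg _) (by positivity)
    · refine (norm_smear_le h'.group hc y _).trans ?_
      rw [Complex.conj_im, neg_sq]
      gcongr
    · refine (norm_smear_le h.group hc x _).trans ?_
      gcongr
  have := hdiff.apply_eq_apply_of_bounded hbd z 0
  simpa [hg] using this

/-- The modular group is determined by the standard subspace. -/
theorem IsModularPair.group_unique (h : IsModularPair H D J) (h' : IsModularPair H D' J') :
    D = D' := by
  funext t
  ext x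
  have key : ∀ y : 𝓗, ⟪D' t y, D t x⟫_ℂ = ⟪y, x⟫_ℂ := by
    intro y
    have h1 : ∀ n : ℕ, ⟪D' t (smear D' (n + 1) y 0), D t (smear D (n + 1) x 0)⟫_ℂ =
        ⟪smear D' (n + 1) y 0, smear D (n + 1) x 0⟫_ℂ := by
      intro n
      have hn : (0 : ℝ) < n + 1 := by positivity
      -- Only real parameters z = t are needed here; they say that D'(t)* D(t) is the identity.
      rw [apply_smear h'.group hn, apply_smear h.group hn, zero_add]
      simpa using h.inner_smear_smear h' hn x y t
    have h2 := (((D' t).continuous.tendsto y).comp (tendsto_smear h'.group y)).inner (𝕜 := ℂ)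
      (((D t).continuous.tendsto x).comp (tendsto_smear h.group x))
    have h3 := (tendsto_smear h'.group y).inner (𝕜 := ℂ) (tendsto_smear h.group x)
    refine tendsto_nhds_unique h2 (h3.congr fun n => (h1 n).symm)
  refine ext_inner_left ℂ fun y => ?_
  have h1 := key (D' (-t) y)
  rw [← h'.group.add_apply, add_neg_cancel, h'.group.zero_apply, h'.group.inner_left,
    neg_neg] at h1
  exact h1

/-- The modular conjugation is determined by the standard subspace. -/
theorem IsModularPair.conj_unique (h : IsModularPair H D J) (h' : IsModularPair H D' J') :
    J = J' := by
  obtain rfl := h.group_unique h'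
  ext x
  have h1 : ∀ n : ℕ, J (smear D (n + 1) x 0) = J' (smear D (n + 1) x 0) := by
    intro n
    have hn : (0 : ℝ) < n + 1 := by positivity
    -- Start the orbit at i/2, so that Δ^{1/2} of the vector is the smeared x and J of it equals S_H
    -- of the starting vector.
    have h2 := isSqrtValue_smear h.group hn x (Complex.I / 2)
    rw [sub_self] at h2
    obtain ⟨w, hw, hJw⟩ := (h'.polar _ _).1 ((h.polar _ _).2 ⟨_, h2, rfl⟩)
    rw [← hJw, hw.unique h.group h2]
  exact tendsto_nhds_unique ((J.continuous.tendsto x).comp (tendsto_smear h.group x))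
    (((J'.continuous.tendsto x).comp (tendsto_smear h.group x)).congr fun n => (h1 n).symm)

/-- The modular conjugation maps the symplectic complement of `H` into `H`. -/
theorem IsModularPair.conj_mem (h : IsModularPair H D J) {g : 𝓗}
    (hg : g ∈ H.symplComp.toClosedSubmodule) : J g ∈ H.toClosedSubmodule := by
  have hg' : ∀ f ∈ H.toClosedSubmodule, (⟪f, g⟫_ℂ).im = 0 :=
    ClosedSubmodule.mem_symplComp_iff.1 hg
  have hreal : ∀ f ∈ H.toClosedSubmodule, ⟪g, f⟫_ℂ = ⟪f, g⟫_ℂ := by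
    intro f hf
    rw [← inner_conj_symm, Complex.conj_eq_iff_im]
    exact hg' f hf
  -- It suffices that Δ^{1/2} J g = g, for then J g is fixed by S_H. By self-adjointness this is
  -- tested on smeared vectors, written as f + ik with f, k in H, on which g has real inner
  -- products.
  have h1 : IsSqrtValue D (J g) g := by
    refine (isSqrtValue_iff h.group).2 fun c x hc => ?_
    have h2 := isSqrtValue_smear h.group hc x 0
    rw [zero_sub] at h2
    obtain ⟨f, hf, k, hk, e1, e2⟩ := (h.polar _ _).2 ⟨_, h2, rfl⟩
    have h3 := inner_anti J (smear D c x (-(Complex.I / 2))) (J g)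
    rw [h.involutive, inner_conj_symm, e2] at h3
    rw [← h3, e1, inner_add_right, inner_sub_left, inner_smul_left, inner_smul_right, hreal f hf,
      hreal k hk]
    simp
  obtain ⟨f, hf, k, hk, e1, e2⟩ := (h.polar (J g) (J g)).2 ⟨g, h1, rfl⟩
  have h3 : Complex.I • k = 0 := by
    have : (2 : ℂ) • (Complex.I • k) = 0 := by
      rw [two_smul]
      calc Complex.I • k + Complex.I • k = (f + Complex.I • k) - (f - Complex.I • k) := by abel
        _ = 0 := by rw [← e1, ← e2, sub_self]
    simpa using this
  rw [e1, h3, add_zero]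
  exact hf

end Modular

/-! ### Shifting contours in the strip -/

section ContourShift

open Set in
theorem isOpen_strip : IsOpen {z : ℂ | 0 < z.im ∧ z.im < Real.pi} :=
  (isOpen_lt continuous_const Complex.continuous_im).inter
    (isOpen_lt Complex.continuous_im continuous_const)

theorem line_mem_strip {a : ℝ} (ha : a ∈ Set.Ioo 0 Real.pi) (q : ℝ) :
    (q + a * Complex.I : ℂ) ∈ {z : ℂ | 0 < z.im ∧ z.im < Real.pi} := by
  simpa using ha

theorem continuous_line {F : ℂ → ℂ}
    (hF : DifferentiableOn ℂ F {z | 0 < z.im ∧ z.im < Real.pi}) {a : ℝ}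
    (ha : a ∈ Set.Ioo 0 Real.pi) : Continuous fun q : ℝ => F (q + a * Complex.I) := by
  rw [← continuousOn_univ]
  exact hF.continuousOn.comp (by fun_prop) fun q _ => line_mem_strip ha q

/-- Cauchy's theorem on rectangles. No decay at infinity is assumed: by Fubini the contribution of
the vertical side at abscissa x is integrable in x, so it cannot stay away from zero for all large
|x|. -/
theorem integral_line_eq {F : ℂ → ℂ}
    (hF : DifferentiableOn ℂ F {z | 0 < z.im ∧ z.im < Real.pi}) {C : ℝ}
    (hC : ∀ a ∈ Set.Ioo 0 Real.pi,
      eLpNorm (fun q : ℝ => F (q + a * Complex.I)) 1 volume ≤ ENNReal.ofReal C)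
    {a b : ℝ} (ha : 0 < a) (hab : a ≤ b) (hb : b < Real.pi) :
    ∫ q : ℝ, F (q + a * Complex.I) = ∫ q : ℝ, F (q + b * Complex.I) := by
  have hint : ∀ y ∈ Set.Ioo 0 Real.pi, Integrable fun q : ℝ => F (q + y * Complex.I) :=
    fun y hy => memLp_one_iff_integrable.1 ⟨(continuous_line hF hy).aestronglyMeasurable,
      (hC y hy).trans_lt ENNReal.ofReal_lt_top⟩
  have hmem : ∀ y ∈ Set.Ioc a b, y ∈ Set.Ioo 0 Real.pi :=
    fun y hy => ⟨ha.trans hy.1, hy.2.trans_lt hb⟩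
  have hprod : Integrable (fun p : ℝ × ℝ => F (p.1 + p.2 * Complex.I))
      (volume.prod (volume.restrict (Set.Ioc a b))) := by
    have hm : AEStronglyMeasurable (fun p : ℝ × ℝ => F (p.1 + p.2 * Complex.I))
        (volume.prod (volume.restrict (Set.Ioc a b))) := by
      rw [← Measure.restrict_univ (μ := (volume : Measure ℝ)), Measure.prod_restrict,
        Measure.restrict_univ]
      refine ContinuousOn.aestronglyMeasurable ?_ (MeasurableSet.univ.prod measurableSet_Ioc)
      exact hF.continuousOn.comp (by fun_prop) fun p hp => line_mem_strip (hmem _ hp.2) p.1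
    rw [integrable_prod_iff' hm]
    refine ⟨?_, ?_⟩
    · filter_upwards [ae_restrict_mem measurableSet_Ioc] with y hy using hint y (hmem y hy)
    · refine Integrable.of_bound ?_ (max C 0) ?_
      · exact (AEStronglyMeasurable.norm hm).prod_swap.integral_prod_right'
      · filter_upwards [ae_restrict_mem measurableSet_Ioc] with y hy
        rw [Real.norm_of_nonneg (by positivity), integral_norm_eq_lintegral_enorm
          (hint y (hmem y hy)).1, ← eLpNorm_one_eq_lintegral_enorm]
        exact ENNReal.toReal_le_of_le_ofReal (le_max_right _ _)
          ((hC y (hmem y hy)).trans (ENNReal.ofReal_le_ofReal (le_max_left _ _)))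
  have hu : Integrable fun x : ℝ => ∫ y in a..b, F (x + y * Complex.I) := by
    simp only [intervalIntegral.integral_of_le hab]
    exact hprod.integral_prod_left
  set u : ℝ → ℂ := fun x => ∫ y in a..b, F (x + y * Complex.I) with hu_def
  have hrect : ∀ L : ℝ, ‖(∫ x in -L..L, F (x + a * Complex.I)) -
      ∫ x in -L..L, F (x + b * Complex.I)‖ ≤ ‖u L‖ + ‖u (-L)‖ := by
    intro L
    have h := Complex.integral_boundary_rect_eq_zero_of_differentiableOn F ⟨-L, a⟩ ⟨L, b⟩
      (hF.mono fun z hz => ?_)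
    · simp only [] at h
      have h2 : (∫ x in -L..L, F (x + a * Complex.I)) - ∫ x in -L..L, F (x + b * Complex.I) =
          Complex.I • u (-L) - Complex.I • u L := by
        simp only [hu_def]
        linear_combination h
      rw [h2, add_comm]
      refine (norm_sub_le _ _).trans ?_
      simp
    · have := hz.2
      rw [Set.mem_preimage, Set.uIcc_of_le hab] at this
      exact ⟨ha.trans_le this.1, this.2.trans_lt hb⟩
  -- If the two line integrals differed, the vertical sides would be bounded below on a whole half
  -- line, which has infinite measure.
  by_contra hne
  have hc := sub_ne_zero.2 hne
  have hlim : Tendsto (fun L : ℝ => ‖(∫ x in -L..L, F (x + a * Complex.I)) -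
      ∫ x in -L..L, F (x + b * Complex.I)‖) atTop
      (𝓝 ‖(∫ q : ℝ, F (q + a * Complex.I)) - ∫ q : ℝ, F (q + b * Complex.I)‖) := by
    refine (Tendsto.sub ?_ ?_).norm
    · exact intervalIntegral_tendsto_integral (hint a ⟨ha, hab.trans_lt hb⟩)
        tendsto_neg_atTop_atBot tendsto_id
    · exact intervalIntegral_tendsto_integral (hint b ⟨ha.trans_le hab, hb⟩)
        tendsto_neg_atTop_atBot tendsto_id
  set c := ‖(∫ q : ℝ, F (q + a * Complex.I)) - ∫ q : ℝ, F (q + b * Complex.I)‖ with hcdef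
  have hcpos : 0 < c := norm_pos_iff.2 hc
  obtain ⟨L0, hL0⟩ := eventually_atTop.1 (hlim.eventually (lt_mem_nhds (half_lt_self hcpos)))
  have hw : Integrable fun x : ℝ => ‖u x‖ + ‖u (-x)‖ := hu.norm.add hu.comp_neg.norm
  have h1 := hw.measure_norm_ge_lt_top (half_pos hcpos)
  have h2 : Set.Ici L0 ⊆ {x : ℝ | c / 2 ≤ ‖‖u x‖ + ‖u (-x)‖‖} := by
    intro L hL
    simp only [Set.mem_ofPred_eq]
    rw [Real.norm_of_nonneg (by positivity)]
    exact (hL0 L hL).le.trans (hrect L)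
  have h3 := (measure_mono h2).trans_lt h1
  simp at h3

theorem integral_eq_of_boundary {F : ℂ → ℂ} {F₀ F₁ : ℝ → ℂ}
    (hF : DifferentiableOn ℂ F {z | 0 < z.im ∧ z.im < Real.pi}) {C : ℝ}
    (hC : ∀ a ∈ Set.Ioo 0 Real.pi,
      eLpNorm (fun q : ℝ => F (q + a * Complex.I)) 1 volume ≤ ENNReal.ofReal C)
    (h₀ : Tendsto (fun a : ℝ => eLpNorm (fun q : ℝ => F (q + a * Complex.I) - F₀ q) 1 volume)
      (𝓝[>] 0) (𝓝 0))
    (h₁ : Tendsto (fun a : ℝ => eLpNorm (fun q : ℝ => F (q + a * Complex.I) - F₁ q) 1 volume)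
      (𝓝[<] Real.pi) (𝓝 0)) (hi₀ : Integrable F₀) (hi₁ : Integrable F₁) :
    ∫ q, F₀ q = ∫ q, F₁ q := by
  have hint : ∀ y ∈ Set.Ioo 0 Real.pi, Integrable fun q : ℝ => F (q + y * Complex.I) :=
    fun y hy => memLp_one_iff_integrable.1 ⟨(continuous_line hF hy).aestronglyMeasurable,
      (hC y hy).trans_lt ENNReal.ofReal_lt_top⟩
  have e0 : ∀ᶠ a : ℝ in 𝓝[>] 0, a ∈ Set.Ioo 0 Real.pi := Ioo_mem_nhdsGT Real.pi_pos
  have e1 : ∀ᶠ a : ℝ in 𝓝[<] Real.pi, a ∈ Set.Ioo 0 Real.pi := Ioo_mem_nhdsLT Real.pi_pos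
  have t0 := tendsto_integral_of_L1' F₀ hi₀.1 (e0.mono hint) h₀
  have t1 := tendsto_integral_of_L1' F₁ hi₁.1 (e1.mono hint) h₁
  have hconst : ∀ a ∈ Set.Ioo 0 Real.pi, ∫ q : ℝ, F (q + a * Complex.I) =
      ∫ q : ℝ, F (q + ((Real.pi / 2 : ℝ) : ℂ) * Complex.I) := by
    intro a ha
    rcases le_total a (Real.pi / 2) with h | h
    · exact integral_line_eq hF hC ha.1 h (by linarith [Real.pi_pos])
    · exact (integral_line_eq hF hC (by linarith [Real.pi_pos]) h ha.2).symm
  have s0 := tendsto_nhds_unique t0 (tendsto_const_nhds.congr' (e0.mono fun a ha =>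
    (hconst a ha).symm))
  have s1 := tendsto_nhds_unique t1 (tendsto_const_nhds.congr' (e1.mono fun a ha =>
    (hconst a ha).symm))
  rw [s0, s1]

end ContourShift

/-! ### Hardy pairs -/

section HardyPair

theorem IsHardyPair.congr {f f' g g' : ℝ → ℂ} (h : IsHardyPair f g) (hf : f =ᵐ[volume] f')
    (hg : g =ᵐ[volume] g') : IsHardyPair f' g' := by
  obtain ⟨Φ, h1, h2, h3, h4⟩ := h
  refine ⟨Φ, h1, h2, h3.congr fun a => eLpNorm_congr_ae ?_, h4.congr fun a => eLpNorm_congr_ae ?_⟩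
  · filter_upwards [hf] with q hq
    rw [hq]
  · filter_upwards [hg] with q hq
    rw [hq]

theorem IsHardyPair.smul {f g : ℝ → ℂ} (h : IsHardyPair f g) (c : ℂ) :
    IsHardyPair (fun q => c * f q) (fun q => c * g q) := by
  obtain ⟨Φ, h1, ⟨C, h2⟩, h3, h4⟩ := h
  have key : ∀ u : ℝ → ℂ, eLpNorm (fun q => c * u q) 2 volume = ‖c‖ₑ * eLpNorm u 2 volume :=
    fun u => eLpNorm_const_smul c u 2 volume
  refine ⟨fun z => c * Φ z, h1.const_mul c, ⟨‖c‖ * C, fun a ha => ?_⟩, ?_, ?_⟩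
  · rw [key, ENNReal.ofReal_mul (norm_nonneg _), ofReal_norm]
    exact mul_le_mul_right (h2 a ha) _
  · simp only [← mul_sub, key]
    simpa using ENNReal.Tendsto.const_mul h3 (Or.inr enorm_ne_top)
  · simp only [← mul_sub, key]
    simpa using ENNReal.Tendsto.const_mul h4 (Or.inr enorm_ne_top)

/-- Reflection at the middle of the strip. -/
theorem IsHardyPair.reflect {f g : ℝ → ℂ} (h : IsHardyPair f g) :
    IsHardyPair (fun q => conj (g q)) (fun q => conj (f q)) := by
  obtain ⟨Φ, h1, ⟨C, h2⟩, h3, h4⟩ := h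
  have hr : ∀ (q a : ℝ), conj (q + a * Complex.I : ℂ) + Real.pi * Complex.I =
      q + (Real.pi - a : ℝ) * Complex.I := by
    intro q a
    simp
    ring
  have key : ∀ u : ℝ → ℂ, eLpNorm (fun q => conj (u q)) 2 volume = eLpNorm u 2 volume :=
    fun u => eLpNorm_congr_norm_ae (Eventually.of_forall fun q => by simp)
  have hflip : ∀ a ∈ Set.Ioo 0 Real.pi, Real.pi - a ∈ Set.Ioo 0 Real.pi := fun a ha =>
    ⟨by linarith [ha.2], by linarith [ha.1]⟩
  refine ⟨fun z => conj (Φ (conj z + Real.pi * Complex.I)), ?_, ⟨C, fun a ha => ?_⟩, ?_, ?_⟩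
  · intro z hz
    have hz' : conj z + Real.pi * Complex.I ∈ {z : ℂ | 0 < z.im ∧ z.im < Real.pi} := by
      simp only [Set.mem_ofPred_eq, Complex.add_im, Complex.conj_im, Complex.mul_im,
        Complex.ofReal_re, Complex.I_im, Complex.ofReal_im, Complex.I_re] at hz ⊢
      constructor <;> linarith [hz.1, hz.2]
    have hd := (h1.differentiableAt (isOpen_strip.mem_nhds hz')).comp (conj z)
      (f := fun w => w + Real.pi * Complex.I) (by fun_prop)
    have := hd.conj_conj
    rw [Complex.conj_conj] at this
    exact this.differentiableWithinAt
  · simp only [hr]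
    rw [key (fun q => Φ (q + (Real.pi - a : ℝ) * Complex.I))]
    exact h2 _ (hflip a ha)
  · simp only [hr, ← map_sub]
    refine Tendsto.congr (fun a => (key (fun q => Φ (q + (Real.pi - a : ℝ) * Complex.I) -
      g q)).symm) ?_
    refine h4.comp (tendsto_nhdsWithin_iff.2 ⟨?_, ?_⟩)
    · have : Tendsto (fun a : ℝ => Real.pi - a) (𝓝 0) (𝓝 (Real.pi - 0)) :=
        (continuous_const.sub continuous_id).tendsto 0
      rw [sub_zero] at this
      exact this.mono_left nhdsWithin_le_nhds
    · filter_upwards [self_mem_nhdsWithin] with a ha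
      have : 0 < a := ha
      simpa using this
  · simp only [hr, ← map_sub]
    refine Tendsto.congr (fun a => (key (fun q => Φ (q + (Real.pi - a : ℝ) * Complex.I) -
      f q)).symm) ?_
    refine h3.comp (tendsto_nhdsWithin_iff.2 ⟨?_, ?_⟩)
    · have : Tendsto (fun a : ℝ => Real.pi - a) (𝓝 Real.pi) (𝓝 (Real.pi - Real.pi)) :=
        (continuous_const.sub continuous_id).tendsto Real.pi
      rw [sub_self] at this
      exact this.mono_left nhdsWithin_le_nhds
    · filter_upwards [self_mem_nhdsWithin] with a ha
      have : a < Real.pi := ha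
      simpa using this

theorem IsHardyPair.add {f g f' g' : ℝ → ℂ} (h : IsHardyPair f g) (h' : IsHardyPair f' g')
    (hf : AEStronglyMeasurable f) (hg : AEStronglyMeasurable g) (hf' : AEStronglyMeasurable f')
    (hg' : AEStronglyMeasurable g') :
    IsHardyPair (fun q => f q + f' q) (fun q => g q + g' q) := by
  obtain ⟨Φ, h1, ⟨C, h2⟩, h3, h4⟩ := h
  obtain ⟨Φ', h1', ⟨C', h2'⟩, h3', h4'⟩ := h'
  have hm : ∀ a ∈ Set.Ioo 0 Real.pi, AEStronglyMeasurable (fun q : ℝ => Φ (q + a * Complex.I)) :=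
    fun a ha => (continuous_line h1 ha).aestronglyMeasurable
  have hm' : ∀ a ∈ Set.Ioo 0 Real.pi,
      AEStronglyMeasurable (fun q : ℝ => Φ' (q + a * Complex.I)) :=
    fun a ha => (continuous_line h1' ha).aestronglyMeasurable
  have e0 : ∀ᶠ a : ℝ in 𝓝[>] 0, a ∈ Set.Ioo 0 Real.pi := Ioo_mem_nhdsGT Real.pi_pos
  have e1 : ∀ᶠ a : ℝ in 𝓝[<] Real.pi, a ∈ Set.Ioo 0 Real.pi := Ioo_mem_nhdsLT Real.pi_pos
  refine ⟨fun z => Φ z + Φ' z, h1.add h1', ⟨max C 0 + max C' 0, fun a ha => ?_⟩, ?_, ?_⟩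
  · rw [ENNReal.ofReal_add (le_max_right _ _) (le_max_right _ _)]
    refine (eLpNorm_add_le (hm a ha) (hm' a ha) one_le_two).trans (add_le_add ?_ ?_)
    · exact (h2 a ha).trans (ENNReal.ofReal_le_ofReal (le_max_left _ _))
    · exact (h2' a ha).trans (ENNReal.ofReal_le_ofReal (le_max_left _ _))
  · refine tendsto_of_tendsto_of_tendsto_of_le_of_le' tendsto_const_nhds
      (by simpa using h3.add h3') (Eventually.of_forall fun a => zero_le) (e0.mono fun a ha => ?_)
    refine le_trans (le_of_eq ?_) (eLpNorm_add_le ((hm a ha).sub hf) ((hm' a ha).sub hf')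
      one_le_two)
    congr 1
    funext q
    simp only [Pi.add_apply]
    ring
  · refine tendsto_of_tendsto_of_tendsto_of_le_of_le' tendsto_const_nhds
      (by simpa using h4.add h4') (Eventually.of_forall fun a => zero_le) (e1.mono fun a ha => ?_)
    refine le_trans (le_of_eq ?_) (eLpNorm_add_le ((hm a ha).sub hg) ((hm' a ha).sub hg')
      one_le_two)
    congr 1
    funext q
    simp only [Pi.add_apply]
    ring

theorem tendsto_eLpNorm_of_dominated {p : ℝ≥0∞} (hp0 : p ≠ 0) (hp : p ≠ ∞) {l : Filter ℝ}
    [l.IsCountablyGenerated] {F : ℝ → ℝ → ℂ} {g : ℝ → ℝ} (hg : MemLp g p volume)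
    (hm : ∀ᶠ a in l, AEStronglyMeasurable (F a) volume)
    (hb : ∀ᶠ a in l, ∀ᵐ q, ‖F a q‖ ≤ g q)
    (hlim : ∀ᵐ q, Tendsto (fun a => F a q) l (𝓝 0)) :
    Tendsto (fun a => eLpNorm (F a) p volume) l (𝓝 0) := by
  have hpt : 0 < p.toReal := ENNReal.toReal_pos hp0 hp
  simp only [eLpNorm_eq_lintegral_rpow_enorm_toReal hp0 hp]
  have h : Tendsto (fun a => ∫⁻ q, ‖F a q‖ₑ ^ p.toReal) l (𝓝 (∫⁻ _ : ℝ, 0)) := by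
    refine tendsto_lintegral_filter_of_dominated_convergence' (fun q => ‖g q‖ₑ ^ p.toReal) ?_ ?_ ?_ ?_
    · filter_upwards [hm] with a ha
      exact ha.enorm.pow_const _
    · filter_upwards [hb] with a ha
      filter_upwards [ha] with q hq
      refine ENNReal.rpow_le_rpow ?_ hpt.le
      rw [enorm_le_iff_norm_le]
      exact hq.trans (le_abs_self _)
    · exact (lintegral_rpow_enorm_lt_top_of_eLpNorm_lt_top hp0 hp hg.2).ne
    · filter_upwards [hlim] with q hq
      have h1 : Tendsto (fun a => ‖F a q‖ₑ) l (𝓝 0) := by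
        have := (continuous_enorm.tendsto _).comp hq
        rwa [enorm_zero] at this
      have h2 := (ENNReal.continuous_rpow_const (y := p.toReal)).tendsto 0 |>.comp h1
      rwa [ENNReal.zero_rpow_of_pos hpt] at h2
  rw [lintegral_zero] at h
  have h2 := (ENNReal.continuous_rpow_const (y := 1 / p.toReal)).tendsto 0 |>.comp h
  rw [ENNReal.zero_rpow_of_pos (by positivity)] at h2
  exact h2

/-- Criterion for the explicit test functions, simple fractions and Gaussians: continuity up to the
edges and an L² majorant independent of the height. -/
theorem isHardyPair_of_dominated {Φ : ℂ → ℂ}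
    (hd : DifferentiableOn ℂ Φ {z | 0 < z.im ∧ z.im < Real.pi})
    (hc : ContinuousOn Φ {z | 0 ≤ z.im ∧ z.im ≤ Real.pi}) {g : ℝ → ℝ} (hg : MemLp g 2 volume)
    (hb : ∀ z : ℂ, 0 ≤ z.im → z.im ≤ Real.pi → ‖Φ z‖ ≤ g z.re) :
    IsHardyPair (fun q => Φ q) (fun q => Φ (q + Real.pi * Complex.I)) := by
  have him : ∀ q a : ℝ, (q + a * Complex.I : ℂ).im = a := by simp
  have hre : ∀ q a : ℝ, (q + a * Complex.I : ℂ).re = q := by simp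
  have hbl : ∀ a ∈ Set.Icc 0 Real.pi, ∀ q : ℝ, ‖Φ (q + a * Complex.I)‖ ≤ g q := by
    intro a ha q
    have := hb (q + a * Complex.I) (by rw [him]; exact ha.1) (by rw [him]; exact ha.2)
    rwa [hre] at this
  have hlc : ∀ q : ℝ, ContinuousOn (fun a : ℝ => Φ (q + a * Complex.I)) (Set.Icc 0 Real.pi) :=
    fun q => hc.comp (by fun_prop) fun a ha => by simpa using ha
  have hlm : ∀ a ∈ Set.Icc 0 Real.pi, Continuous fun q : ℝ => Φ (q + a * Complex.I) := by
    intro a ha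
    rw [← continuousOn_univ]
    exact hc.comp (by fun_prop) fun q _ => by simpa using ha
  have hgen : ∀ b ∈ Set.Icc 0 Real.pi, ∀ l : Filter ℝ, l.IsCountablyGenerated →
      l ≤ 𝓝[Set.Icc 0 Real.pi] b →
      Tendsto (fun a : ℝ => eLpNorm (fun q : ℝ => Φ (q + a * Complex.I) -
        Φ (q + b * Complex.I)) 2 volume) l (𝓝 0) := by
    intro b hb l _ hl
    have hev : ∀ᶠ a in l, a ∈ Set.Icc 0 Real.pi := hl self_mem_nhdsWithin
    refine tendsto_eLpNorm_of_dominated (by norm_num) (by norm_num) (hg.add hg) ?_ ?_ ?_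
    · exact hev.mono fun a ha => ((hlm a ha).sub (hlm b hb)).aestronglyMeasurable
    · exact hev.mono fun a ha => Eventually.of_forall fun q =>
        (norm_sub_le _ _).trans (add_le_add (hbl a ha q) (hbl b hb q))
    · refine Eventually.of_forall fun q => ?_
      have := ((hlc q) b hb).tendsto.mono_left hl
      simpa using this.sub_const (Φ (q + b * Complex.I))
  refine ⟨Φ, hd, ⟨(eLpNorm g 2 volume).toReal, fun a ha => ?_⟩, ?_, ?_⟩
  · rw [ENNReal.ofReal_toReal hg.2.ne]
    exact eLpNorm_mono_real fun q => hbl a (Set.Ioo_subset_Icc_self ha) q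
  · have := hgen 0 ⟨le_rfl, Real.pi_pos.le⟩ (𝓝[>] 0) inferInstance
      ((nhdsWithin_mono _ Set.Ioo_subset_Icc_self).trans' (nhdsWithin_Ioo_eq_nhdsGT Real.pi_pos).ge)
    simpa using this
  · exact hgen Real.pi ⟨Real.pi_pos.le, le_rfl⟩ (𝓝[<] Real.pi) inferInstance
      ((nhdsWithin_mono _ Set.Ioo_subset_Icc_self).trans' (nhdsWithin_Ioo_eq_nhdsLT Real.pi_pos).ge)

theorem integrable_inv_sq_add_sq (x : ℝ) {d : ℝ} (hd : 0 < d) :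
    Integrable fun q : ℝ => ((q - x) ^ 2 + d ^ 2)⁻¹ := by
  have h := ((integrable_inv_one_add_sq.comp_div hd.ne').const_mul (d ^ 2)⁻¹).comp_sub_right x
  refine h.congr (Eventually.of_forall fun q => ?_)
  simp only []
  rw [← mul_inv]
  congr 1
  field_simp
  ring

theorem memLp_inv_sqrt (x : ℝ) {d : ℝ} (hd : 0 < d) :
    MemLp (fun q : ℝ => (√((q - x) ^ 2 + d ^ 2))⁻¹) 2 volume := by
  have hc : Continuous fun q : ℝ => (√((q - x) ^ 2 + d ^ 2))⁻¹ :=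
    Continuous.inv₀ (by fun_prop) fun q => (Real.sqrt_pos.2 (by positivity)).ne'
  rw [memLp_two_iff_integrable_sq hc.aestronglyMeasurable]
  refine (integrable_inv_sq_add_sq x hd).congr (Eventually.of_forall fun q => ?_)
  simp only [inv_pow]
  rw [Real.sq_sqrt (by positivity)]

theorem norm_inv_sub_le {p : ℂ} {d : ℝ} (hd : 0 < d) {z : ℂ} (h : d ≤ |z.im - p.im|) :
    ‖(z - p)⁻¹‖ ≤ (√((z.re - p.re) ^ 2 + d ^ 2))⁻¹ := by
  rw [norm_inv]
  refine inv_anti₀ (Real.sqrt_pos.2 (by positivity)) ?_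
  rw [Complex.norm_eq_sqrt_sq_add_sq, Complex.sub_re, Complex.sub_im]
  refine Real.sqrt_le_sqrt (add_le_add le_rfl ?_)
  rw [← sq_abs (z.im - p.im)]
  gcongr

theorem exists_strip_dist {p : ℂ} (hp : p.im < 0 ∨ Real.pi < p.im) :
    ∃ d : ℝ, 0 < d ∧ ∀ z : ℂ, 0 ≤ z.im → z.im ≤ Real.pi → d ≤ |z.im - p.im| := by
  rcases hp with hp | hp
  · refine ⟨-p.im, by linarith, fun z h1 h2 => ?_⟩
    rw [abs_of_pos (by linarith)]
    linarith
  · refine ⟨p.im - Real.pi, by linarith, fun z h1 h2 => ?_⟩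
    rw [abs_of_neg (by linarith)]
    linarith

theorem isHardyPair_inv_sub {p : ℂ} (hp : p.im < 0 ∨ Real.pi < p.im) :
    IsHardyPair (fun q => ((q : ℂ) - p)⁻¹) (fun q => (q + Real.pi * Complex.I - p)⁻¹) := by
  obtain ⟨d, hd, hdist⟩ := exists_strip_dist hp
  have hne : ∀ z : ℂ, 0 ≤ z.im → z.im ≤ Real.pi → z - p ≠ 0 := by
    intro z h1 h2 h
    have := hdist z h1 h2
    rw [sub_eq_zero.1 h, sub_self, abs_zero] at this
    linarith
  have hD : DifferentiableOn ℂ (fun z : ℂ => (z - p)⁻¹) {z | 0 ≤ z.im ∧ z.im ≤ Real.pi} :=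
    DifferentiableOn.inv (by fun_prop) fun z hz => hne z hz.1 hz.2
  exact isHardyPair_of_dominated (Φ := fun z => (z - p)⁻¹)
    (hD.mono fun z hz => ⟨hz.1.le, hz.2.le⟩) hD.continuousOn (memLp_inv_sqrt p.re hd)
    fun z h1 h2 => norm_inv_sub_le hd (hdist z h1 h2)

theorem memLp_inv_sub {p : ℂ} (hp : p.im ≠ 0) :
    MemLp (fun q : ℝ => ((q : ℂ) - p)⁻¹) 2 volume := by
  have hne : ∀ q : ℝ, (q : ℂ) - p ≠ 0 := by
    intro q h
    have := congrArg Complex.im h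
    simp at this
    exact hp this
  have hc : Continuous fun q : ℝ => ((q : ℂ) - p)⁻¹ := Continuous.inv₀ (by fun_prop) hne
  refine (memLp_inv_sqrt p.re (abs_pos.2 hp)).mono' hc.aestronglyMeasurable
    (Eventually.of_forall fun q => ?_)
  have := norm_inv_sub_le (p := p) (z := q) (abs_pos.2 hp) (by simp)
  simpa using this

end HardyPair

/-! ### Contour shift for products of Hardy functions -/

section HardyProduct

theorem eLpNorm_one_mul_le {f g : ℝ → ℂ} (hf : AEStronglyMeasurable f)
    (hg : AEStronglyMeasurable g) :
    eLpNorm (fun q => f q * g q) 1 volume ≤ eLpNorm f 2 volume * eLpNorm g 2 volume :=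
  (congrArg (fun u : ℝ → ℂ => eLpNorm u 1 volume) (funext fun _ => rfl)).trans_le
    (eLpNorm_smul_le_mul_eLpNorm (p := 2) (q := 2) (r := 1) (φ := f) (f := g) hg hf)

theorem eLpNorm_one_mul_bounded_le {f g : ℝ → ℂ} {C : ℝ} (hg : ∀ᵐ q, ‖g q‖ ≤ C) :
    eLpNorm (fun q => f q * g q) 1 volume ≤ ENNReal.ofReal C * eLpNorm f 1 volume := by
  refine eLpNorm_le_mul_eLpNorm_of_ae_le_mul ?_ 1
  filter_upwards [hg] with q hq
  rw [norm_mul, mul_comm]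
  exact mul_le_mul_of_nonneg_right hq (norm_nonneg _)

theorem integrable_mul_mul {f g S : ℝ → ℂ} (hf : MemLp f 2 volume) (hg : MemLp g 2 volume)
    (hS : AEStronglyMeasurable S) {C : ℝ} (hC : ∀ᵐ q, ‖S q‖ ≤ C) :
    Integrable fun q => f q * g q * S q :=
  (hf.integrable_mul hg).mul_bdd hS hC

/-- Telescope into (F - f)GS + f(G - g)S + fg(S - s). Hölder handles the first two terms. The last
one uses dominated convergence, since S converges boundedly and pointwise almost everywhere but in
no norm. -/
theorem tendsto_eLpNorm_mul_mul {l : Filter ℝ} [l.IsCountablyGenerated]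
    {F G S : ℝ → ℝ → ℂ} {f g s : ℝ → ℂ} {C B : ℝ}
    (hF : ∀ᶠ a in l, AEStronglyMeasurable (F a) volume)
    (hG : ∀ᶠ a in l, AEStronglyMeasurable (G a) volume)
    (hS : ∀ᶠ a in l, AEStronglyMeasurable (S a) volume)
    (hf : MemLp f 2 volume) (hg : MemLp g 2 volume) (hs : AEStronglyMeasurable s)
    (hGb : ∀ᶠ a in l, eLpNorm (G a) 2 volume ≤ ENNReal.ofReal B)
    (hSb : ∀ᶠ a in l, ∀ q, ‖S a q‖ ≤ C) (hsb : ∀ᵐ q, ‖s q‖ ≤ C)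
    (hFf : Tendsto (fun a => eLpNorm (fun q => F a q - f q) 2 volume) l (𝓝 0))
    (hGg : Tendsto (fun a => eLpNorm (fun q => G a q - g q) 2 volume) l (𝓝 0))
    (hSs : ∀ᵐ q, Tendsto (fun a => S a q) l (𝓝 (s q))) :
    Tendsto (fun a => eLpNorm (fun q => F a q * G a q * S a q - f q * g q * s q) 1 volume) l
      (𝓝 0) := by
  have t3 : Tendsto (fun a => eLpNorm (fun q => f q * g q * (S a q - s q)) 1 volume) l (𝓝 0) := by
    have hint : Integrable (fun q => ‖f q * g q‖ * (2 * C)) :=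
      (hf.integrable_mul hg).norm.mul_const _
    refine tendsto_eLpNorm_of_dominated one_ne_zero ENNReal.one_ne_top
      (memLp_one_iff_integrable.2 hint) ?_ ?_ ?_
    · filter_upwards [hS] with a ha
      exact (hf.1.mul hg.1).mul (ha.sub hs)
    · filter_upwards [hSb] with a ha
      filter_upwards [hsb] with q hq
      rw [norm_mul]
      refine mul_le_mul_of_nonneg_left ?_ (norm_nonneg _)
      refine (norm_sub_le _ _).trans ?_
      linarith [ha q]
    · filter_upwards [hSs] with q hq
      simpa using (hq.sub_const (s q)).const_mul (f q * g q)
  have hup : Tendsto (fun a => ENNReal.ofReal C *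
        (eLpNorm (fun q => F a q - f q) 2 volume * ENNReal.ofReal B) +
      ENNReal.ofReal C * (eLpNorm f 2 volume * eLpNorm (fun q => G a q - g q) 2 volume) +
      eLpNorm (fun q => f q * g q * (S a q - s q)) 1 volume) l (𝓝 0) := by
    have h1 := ENNReal.Tendsto.const_mul (a := ENNReal.ofReal C)
      (ENNReal.Tendsto.mul_const (b := ENNReal.ofReal B) hFf (Or.inr ENNReal.ofReal_ne_top))
      (Or.inr ENNReal.ofReal_ne_top)
    have h2 := ENNReal.Tendsto.const_mul (a := ENNReal.ofReal C)
      (ENNReal.Tendsto.const_mul (a := eLpNorm f 2 volume) hGg (Or.inr hf.2.ne))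
      (Or.inr ENNReal.ofReal_ne_top)
    simpa using (h1.add h2).add t3
  refine tendsto_of_tendsto_of_tendsto_of_le_of_le' tendsto_const_nhds hup
    (Eventually.of_forall fun a => zero_le) ?_
  filter_upwards [hF, hG, hS, hGb, hSb] with a h1 h2 h3 h4 h5
  have m1 : AEStronglyMeasurable (fun q => (F a q - f q) * G a q * S a q) :=
    ((h1.sub hf.1).mul h2).mul h3
  have m2 : AEStronglyMeasurable (fun q => f q * (G a q - g q) * S a q) :=
    (hf.1.mul (h2.sub hg.1)).mul h3
  have m3 : AEStronglyMeasurable (fun q => f q * g q * (S a q - s q)) :=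
    (hf.1.mul hg.1).mul (h3.sub hs)
  have heq : (fun q => F a q * G a q * S a q - f q * g q * s q) =
      (fun q => (F a q - f q) * G a q * S a q) + (fun q => f q * (G a q - g q) * S a q) +
        fun q => f q * g q * (S a q - s q) := by
    funext q
    simp only [Pi.add_apply]
    ring
  rw [heq]
  refine (eLpNorm_add_le (m1.add m2) m3 le_rfl).trans (add_le_add
    ((eLpNorm_add_le m1 m2 le_rfl).trans (add_le_add ?_ ?_)) le_rfl)
  · refine (eLpNorm_one_mul_bounded_le (Eventually.of_forall h5)).trans
      (mul_le_mul_right ((eLpNorm_one_mul_le (h1.sub hf.1) h2).trans ?_) _)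
    exact mul_le_mul_right h4 _
  · exact (eLpNorm_one_mul_bounded_le (Eventually.of_forall h5)).trans
      (mul_le_mul_right (eLpNorm_one_mul_le hf.1 (h2.sub hg.1)) _)

/-- A product of two Hardy functions and a bounded analytic function has bounded L¹ norms on
horizontal lines, so the contour may be moved from one edge of the strip to the other. -/
theorem IsHardyPair.integral_mul_eq {φ φ₁ ψ ψ₁ s s₁ : ℝ → ℂ} (h : IsHardyPair φ φ₁)
    (h' : IsHardyPair ψ ψ₁) (hφ : MemLp φ 2 volume) (hφ₁ : MemLp φ₁ 2 volume)
    (hψ : MemLp ψ 2 volume) (hψ₁ : MemLp ψ₁ 2 volume) {S : ℂ → ℂ} {C : ℝ}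
    (hS : DifferentiableOn ℂ S {z | 0 < z.im ∧ z.im < Real.pi})
    (hC : ∀ z : ℂ, 0 < z.im → z.im < Real.pi → ‖S z‖ ≤ C)
    (hs : AEStronglyMeasurable s) (hs₁ : AEStronglyMeasurable s₁)
    (hl : ∀ᵐ q : ℝ, Tendsto (fun a : ℝ => S (q + a * Complex.I)) (𝓝[>] 0) (𝓝 (s q)))
    (hl₁ : ∀ᵐ q : ℝ,
      Tendsto (fun a : ℝ => S (q + a * Complex.I)) (𝓝[<] Real.pi) (𝓝 (s₁ q))) :
    ∫ q, φ q * ψ q * s q = ∫ q, φ₁ q * ψ₁ q * s₁ q := by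
  obtain ⟨Φ, h1, ⟨A, h2⟩, h3, h4⟩ := h
  obtain ⟨Ψ, h1', ⟨B, h2'⟩, h3', h4'⟩ := h'
  have e0 : ∀ᶠ a : ℝ in 𝓝[>] 0, a ∈ Set.Ioo 0 Real.pi := Ioo_mem_nhdsGT Real.pi_pos
  have e1 : ∀ᶠ a : ℝ in 𝓝[<] Real.pi, a ∈ Set.Ioo 0 Real.pi := Ioo_mem_nhdsLT Real.pi_pos
  have hSb : ∀ a ∈ Set.Ioo 0 Real.pi, ∀ q : ℝ, ‖S (q + a * Complex.I)‖ ≤ C := fun a ha q =>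
    hC _ (line_mem_strip ha q).1 (line_mem_strip ha q).2
  have hsb : ∀ᵐ q, ‖s q‖ ≤ C := by
    filter_upwards [hl] with q hq
    exact le_of_tendsto hq.norm (e0.mono fun a ha => hSb a ha q)
  have hsb₁ : ∀ᵐ q, ‖s₁ q‖ ≤ C := by
    filter_upwards [hl₁] with q hq
    exact le_of_tendsto hq.norm (e1.mono fun a ha => hSb a ha q)
  have m1 : ∀ a ∈ Set.Ioo 0 Real.pi, AEStronglyMeasurable fun q : ℝ => Φ (q + a * Complex.I) :=
    fun a ha => (continuous_line h1 ha).aestronglyMeasurable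
  have m2 : ∀ a ∈ Set.Ioo 0 Real.pi, AEStronglyMeasurable fun q : ℝ => Ψ (q + a * Complex.I) :=
    fun a ha => (continuous_line h1' ha).aestronglyMeasurable
  have m3 : ∀ a ∈ Set.Ioo 0 Real.pi, AEStronglyMeasurable fun q : ℝ => S (q + a * Complex.I) :=
    fun a ha => (continuous_line hS ha).aestronglyMeasurable
  refine integral_eq_of_boundary (F := fun z => Φ z * Ψ z * S z) ((h1.mul h1').mul hS)
    (C := (max C 0) * ((max A 0) * (max B 0))) ?_ ?_ ?_ (integrable_mul_mul hφ hψ hs hsb)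
    (integrable_mul_mul hφ₁ hψ₁ hs₁ hsb₁)
  · intro a ha
    rw [ENNReal.ofReal_mul (le_max_right _ _), ENNReal.ofReal_mul (le_max_right _ _)]
    refine (eLpNorm_one_mul_bounded_le (Eventually.of_forall (hSb a ha))).trans
      (mul_le_mul' (ENNReal.ofReal_le_ofReal (le_max_left _ _))
        ((eLpNorm_one_mul_le (m1 a ha) (m2 a ha)).trans (mul_le_mul' ?_ ?_)))
    · exact (h2 a ha).trans (ENNReal.ofReal_le_ofReal (le_max_left _ _))
    · exact (h2' a ha).trans (ENNReal.ofReal_le_ofReal (le_max_left _ _))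
  · exact tendsto_eLpNorm_mul_mul (e0.mono m1) (e0.mono m2) (e0.mono m3) hφ hψ hs (e0.mono h2')
      (e0.mono hSb) hsb h3 h3' hl
  · exact tendsto_eLpNorm_mul_mul (e1.mono m1) (e1.mono m2) (e1.mono m3) hφ₁ hψ₁ hs₁
      (e1.mono h2') (e1.mono hSb) hsb₁ h4 h4' hl₁

theorem IsHardyPair.integral_mul_eq' {φ φ₁ ψ ψ₁ : ℝ → ℂ} (h : IsHardyPair φ φ₁)
    (h' : IsHardyPair ψ ψ₁) (hφ : MemLp φ 2 volume) (hφ₁ : MemLp φ₁ 2 volume)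
    (hψ : MemLp ψ 2 volume) (hψ₁ : MemLp ψ₁ 2 volume) :
    ∫ q, φ q * ψ q = ∫ q, φ₁ q * ψ₁ q := by
  have := h.integral_mul_eq h' hφ hφ₁ hψ hψ₁ (S := fun _ => 1) (C := 1) (s := fun _ => 1)
    (s₁ := fun _ => 1) (differentiableOn_const _) (by simp) aestronglyMeasurable_const
    aestronglyMeasurable_const (by simp) (by simp)
  simpa using this

theorem memLp_exp_neg_sq (x : ℝ) {b : ℝ} (hb : 0 < b) (K : ℝ) :
    MemLp (fun s : ℝ => K * Real.exp (-b * (s - x) ^ 2)) 2 volume := by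
  rw [memLp_two_iff_integrable_sq (by fun_prop)]
  have := ((integrable_exp_neg_mul_sq (b := 2 * b) (by linarith)).comp_sub_right x).const_mul
    (K ^ 2)
  refine this.congr (Eventually.of_forall fun s => ?_)
  simp only [mul_pow]
  rw [← Real.exp_nat_mul]
  congr 2
  push_cast
  ring

/-- The Gaussian kernel in the rapidity variable, with the normalization of the modular group. -/
def rapidityGker (c : ℝ) (w : ℂ) : ℂ := (2 * Real.pi : ℂ)⁻¹ * gker c ((2 * Real.pi : ℂ)⁻¹ * w)

theorem differentiable_rapidityGker (c : ℝ) : Differentiable ℂ (rapidityGker c) :=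
  ((differentiable_gker c).comp (by fun_prop)).const_mul _

theorem norm_rapidityGker (c : ℝ) (w : ℂ) : ‖rapidityGker c w‖ = (2 * Real.pi)⁻¹ *
    (Real.exp (c * (2 * Real.pi)⁻¹ ^ 2 * w.im ^ 2) * (√(c / Real.pi) *
      Real.exp (-(c * (2 * Real.pi)⁻¹ ^ 2) * w.re ^ 2))) := by
  have h := norm_gker c 0 (-((2 * Real.pi : ℂ)⁻¹ * w))
  have e1 : ((2 * Real.pi : ℂ)⁻¹ * w) = (((2 * Real.pi)⁻¹ : ℝ) : ℂ) * w := by push_cast; ring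
  have e2 : ((0 : ℝ) : ℂ) - -((2 * Real.pi : ℂ)⁻¹ * w) = (2 * Real.pi : ℂ)⁻¹ * w := by simp
  rw [e2, e1, Complex.neg_im, Complex.neg_re, Complex.re_ofReal_mul, Complex.im_ofReal_mul] at h
  have e3 : ‖(2 * Real.pi : ℂ)⁻¹‖ = (2 * Real.pi)⁻¹ := by
    simp [abs_of_pos Real.pi_pos]
  rw [rapidityGker, norm_mul, e1, h, e3]
  ring_nf

theorem norm_rapidityGker_sub_le (c : ℝ) (w : ℂ) (s : ℝ) :
    ‖rapidityGker c (w - s)‖ ≤ (2 * Real.pi)⁻¹ *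
    (Real.exp (c * (2 * Real.pi)⁻¹ ^ 2 * w.im ^ 2) * √(c / Real.pi)) *
      Real.exp (-(c * (2 * Real.pi)⁻¹ ^ 2) * (s - w.re) ^ 2) := by
  rw [norm_rapidityGker, Complex.sub_im, Complex.sub_re, Complex.ofReal_im, Complex.ofReal_re,
    sub_zero]
  apply le_of_eq
  ring_nf

/-- The kernel as a function of the integration variable: raising s by iπ cancels the shift of q.
This is the partner of a Hardy function when the contour of a smeared vector is moved. -/
theorem isHardyPair_rapidityGker {c : ℝ} (hc : 0 < c) (q : ℝ) :
    IsHardyPair (fun s => rapidityGker c (q + Real.pi * Complex.I - s))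
      (fun s => rapidityGker c (q - s)) := by
  have hd : Differentiable ℂ fun z : ℂ => rapidityGker c (q + Real.pi * Complex.I - z) :=
    (differentiable_rapidityGker c).comp (by fun_prop)
  have hb : 0 < c * (2 * Real.pi)⁻¹ ^ 2 := by positivity
  have h := isHardyPair_of_dominated (Φ := fun z => rapidityGker c (q + Real.pi * Complex.I - z))
    hd.differentiableOn hd.continuous.continuousOn
    (memLp_exp_neg_sq q hb ((2 * Real.pi)⁻¹ *
    (Real.exp (c * (2 * Real.pi)⁻¹ ^ 2 * Real.pi ^ 2) * √(c / Real.pi)))) ?_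
  · refine h.congr (Eventually.of_forall fun s => rfl) (Eventually.of_forall fun s => ?_)
    simp only []
    congr 1
    ring
  · intro z h1 h2
    have e : (q + Real.pi * Complex.I - z : ℂ) =
        (q + Real.pi * Complex.I - z.im * Complex.I) - (z.re : ℝ) := by
      apply Complex.ext <;> simp
    rw [e]
    refine (norm_rapidityGker_sub_le c _ _).trans ?_
    have e2 : (q + Real.pi * Complex.I - z.im * Complex.I : ℂ).im = Real.pi - z.im := by simp
    have e3 : (q + Real.pi * Complex.I - z.im * Complex.I : ℂ).re = q := by simp
    rw [e2, e3]
    gcongr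
    linarith

theorem memLp_rapidityGker {c : ℝ} (hc : 0 < c) (w : ℂ) :
    MemLp (fun s : ℝ => rapidityGker c (w - s)) 2 volume := by
  have hb : 0 < c * (2 * Real.pi)⁻¹ ^ 2 := by positivity
  refine (memLp_exp_neg_sq w.re hb ((2 * Real.pi)⁻¹ *
    (Real.exp (c * (2 * Real.pi)⁻¹ ^ 2 * w.im ^ 2) * √(c / Real.pi)))).mono' ?_
    (Eventually.of_forall fun s => norm_rapidityGker_sub_le c w s)
  exact ((differentiable_rapidityGker c).continuous.comp (by fun_prop)).aestronglyMeasurable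

theorem differentiable_integral_rapidityGker {c : ℝ} (hc : 0 < c) {f : ℝ → ℂ}
    (hf : MemLp f 2 volume) :
    Differentiable ℂ fun w : ℂ => ∫ s : ℝ, rapidityGker c (w - s) * f s := by
  intro w₀
  set b := c * (2 * Real.pi)⁻¹ ^ 2 with hb_def
  have hb : 0 < b := by positivity
  -- The last exponential pays for recentring the Gaussian from Re w to 0 at half its rate,
  -- uniformly for w in the unit ball around w₀.
  set K := (2 * Real.pi)⁻¹ * (Real.exp (b * (|w₀.im| + 1) ^ 2) * √(c / Real.pi)) *
    Real.exp (b * (|w₀.re| + 1) ^ 2) with hK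
  refine differentiableAt_integral_of_dominated (r := 1) one_pos
    (bound := fun s => ‖K * Real.exp (-(b / 2) * (s - 0) ^ 2)‖ * ‖f s‖) ?_ ?_ ?_ ?_
  · intro w _
    exact ((differentiable_rapidityGker c).continuous.comp
      (by fun_prop)).aestronglyMeasurable.mul hf.1
  · intro s
    exact (((differentiable_rapidityGker c).comp (by fun_prop)).mul_const _).differentiableOn
  · refine Eventually.of_forall fun s w hw => ?_
    have hw1 : ‖w - w₀‖ < 1 := by simpa [dist_eq_norm] using hw
    have h1 : |w.im| ≤ |w₀.im| + 1 := by
      have := (Complex.abs_im_le_norm (w - w₀)).trans hw1.le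
      rw [Complex.sub_im] at this
      have h3 := abs_sub_abs_le_abs_sub w.im w₀.im
      linarith
    have h2 : |w.re| ≤ |w₀.re| + 1 := by
      have := (Complex.abs_re_le_norm (w - w₀)).trans hw1.le
      rw [Complex.sub_re] at this
      have h3 := abs_sub_abs_le_abs_sub w.re w₀.re
      linarith
    rw [norm_mul]
    refine mul_le_mul_of_nonneg_right ?_ (norm_nonneg _)
    refine (norm_rapidityGker_sub_le c w s).trans ?_
    rw [Real.norm_of_nonneg (by positivity), hK, mul_assoc _ (Real.exp _) (Real.exp _),
      ← Real.exp_add]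
    rw [← sq_abs w.im]
    have h4 : w.re ^ 2 ≤ (|w₀.re| + 1) ^ 2 := by
      rw [← sq_abs w.re]
      gcongr
    gcongr
    nlinarith [mul_nonneg hb.le (sq_nonneg (s - 2 * w.re)), mul_le_mul_of_nonneg_left h4 hb.le]
  · exact (memLp_exp_neg_sq 0 (half_pos hb) K).norm.integrable_mul hf.norm

end HardyProduct

/-! ### The modular objects in the Schrödinger representation -/

section SchrodingerModular

variable {ι : Type*} [Fintype ι]

theorem memLp_coord {X κ : Type*} [Fintype κ] [MeasurableSpace X] {μ : Measure X}
    (f : Lp (EuclideanSpace ℂ κ) 2 μ) (α : κ) : MemLp (fun q => f q α) 2 μ :=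
  (EuclideanSpace.proj α : EuclideanSpace ℂ κ →L[ℂ] ℂ).comp_memLp' (Lp.memLp f)

theorem stronglyMeasurable_coord {X κ : Type*} [Fintype κ] [MeasurableSpace X] {μ : Measure X}
    (f : Lp (EuclideanSpace ℂ κ) 2 μ) (α : κ) : StronglyMeasurable (fun q => f q α) :=
  (EuclideanSpace.proj α : EuclideanSpace ℂ κ →L[ℂ] ℂ).continuous.comp_stronglyMeasurable
    (Lp.stronglyMeasurable f)

theorem eLpNorm_coord_le {X κ : Type*} [Fintype κ] [MeasurableSpace X] {μ : Measure X}
    (f : Lp (EuclideanSpace ℂ κ) 2 μ) (α : κ) :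
    eLpNorm (fun q => f q α) 2 μ ≤ ENNReal.ofReal ‖f‖ := by
  rw [Lp.norm_def, ENNReal.ofReal_toReal (Lp.memLp f).2.ne]
  exact eLpNorm_mono fun q => PiLp.norm_apply_le (f q) α

/-- Translation of the rapidity by `2πs`. -/
def translateL2 (ι : Type*) [Fintype ι] (s : ℝ) : L2R ι →ₗᵢ[ℂ] L2R ι :=
  Lp.compMeasurePreservingₗᵢ ℂ (fun q : ℝ => q - 2 * Real.pi * s)
    (measurePreserving_sub_right volume _)

theorem translateL2_coe (s : ℝ) (f : L2R ι) :
    translateL2 ι s f =ᵐ[volume] fun q => f (q - 2 * Real.pi * s) :=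
  Lp.coeFn_compMeasurePreserving f (measurePreserving_sub_right volume _)

theorem translateL2_zero (f : L2R ι) : translateL2 ι 0 f = f := by
  refine Lp.ext ((translateL2_coe 0 f).trans (Eventually.of_forall fun q => ?_))
  simp

theorem translateL2_add (s t : ℝ) (f : L2R ι) :
    translateL2 ι (s + t) f = translateL2 ι s (translateL2 ι t f) := by
  refine Lp.ext ?_
  have h := (measurePreserving_sub_right (volume : Measure ℝ)
    (2 * Real.pi * s)).quasiMeasurePreserving.ae (translateL2_coe t f)
  filter_upwards [translateL2_coe (s + t) f, translateL2_coe s (translateL2 ι t f), h]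
    with q h1 h2 h3
  rw [h1, h2, h3]
  congr 1
  ring

theorem continuous_translateL2 (f : L2R ι) : Continuous fun s => translateL2 ι s f := by
  have hg : Continuous fun s : ℝ => (⟨fun q : ℝ => q - 2 * Real.pi * s, by fun_prop⟩ : C(ℝ, ℝ)) :=
    ContinuousMap.continuous_of_continuous_uncurry _ (by
      simp only [Function.uncurry_def, ContinuousMap.coe_mk]
      fun_prop)
  exact Continuous.compMeasurePreservingLp (f := fun _ : ℝ => f) continuous_const hg
    (fun s => measurePreserving_sub_right volume _) (by norm_num)

/-- `(v^α) ↦ (conj v^(bar α))`. -/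
def conjBar (bar : ι → ι) (v : EuclideanSpace ℂ ι) : EuclideanSpace ℂ ι :=
  WithLp.toLp 2 fun α => conj (v (bar α))

theorem norm_conjBar {bar : ι → ι} (hbar : Function.Involutive bar) (v : EuclideanSpace ℂ ι) :
    ‖conjBar bar v‖ = ‖v‖ := by
  simp only [conjBar, EuclideanSpace.norm_eq, RCLike.norm_conj]
  congr 1
  exact (Equiv.sum_comp (Function.Involutive.toPerm bar hbar) fun α => ‖v α‖ ^ 2)

theorem lipschitz_conjBar {bar : ι → ι} (hbar : Function.Involutive bar) :
    LipschitzWith 1 (conjBar (ι := ι) bar) := by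
  refine LipschitzWith.of_dist_le_mul fun v w => ?_
  rw [dist_eq_norm, dist_eq_norm, ← norm_conjBar hbar (v - w), NNReal.coe_one, one_mul]
  apply le_of_eq
  congr 1
  ext α
  simp [conjBar]

omit [Fintype ι] in
theorem conjBar_zero (bar : ι → ι) : conjBar (ι := ι) bar 0 = 0 := by
  ext α
  simp [conjBar]

/-- The antiunitary involution `f^α ↦ conj f^(bar α)` of `L²(ℝ, ℂ^ι)`. -/
def conjL2 {bar : ι → ι} (hbar : Function.Involutive bar) : L2R ι ≃ₗᵢ⋆[ℂ] L2R ι := by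
  let j : L2R ι → L2R ι := (lipschitz_conjBar hbar).compLp (conjBar_zero bar)
  have hj : ∀ f, j f =ᵐ[volume] conjBar bar ∘ f := fun f =>
    (lipschitz_conjBar hbar).coeFn_compLp (conjBar_zero bar) f
  have hinv : ∀ f, j (j f) = f := by
    intro f
    refine Lp.ext ?_
    filter_upwards [hj f, hj (j f)] with q h1 h2
    rw [h2, Function.comp_apply, h1]
    ext α
    simp [conjBar, hbar α]
  exact
    { toFun := j
      invFun := j
      left_inv := hinv
      right_inv := hinv
      map_add' := by
        intro f g
        refine Lp.ext ?_
        filter_upwards [hj (f + g), hj f, hj g, Lp.coeFn_add f g, Lp.coeFn_add (j f) (j g)]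
          with q h1 h2 h3 h4 h5
        rw [h1, h5, Pi.add_apply, h2, h3, Function.comp_apply, h4]
        ext α
        simp [conjBar]
      map_smul' := by
        intro c f
        refine Lp.ext ?_
        filter_upwards [hj (c • f), hj f, Lp.coeFn_smul c f, Lp.coeFn_smul (conj c) (j f)]
          with q h1 h2 h3 h4
        rw [h1, h4, Pi.smul_apply, h2, Function.comp_apply, h3]
        ext α
        simp [conjBar]
      norm_map' := by
        intro f
        change ‖j f‖ = ‖f‖
        rw [Lp.norm_def, Lp.norm_def]
        congr 1
        refine eLpNorm_congr_norm_ae ?_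
        filter_upwards [hj f] with q h1
        rw [h1, Function.comp_apply, norm_conjBar hbar] }

theorem conjL2_coe {bar : ι → ι} (hbar : Function.Involutive bar) (f : L2R ι) :
    conjL2 hbar f =ᵐ[volume] fun q => conjBar bar (f q) :=
  (lipschitz_conjBar hbar).coeFn_compLp (conjBar_zero bar) f

theorem conjL2_conjL2 {bar : ι → ι} (hbar : Function.Involutive bar) (f : L2R ι) :
    conjL2 hbar (conjL2 hbar f) = f := by
  refine Lp.ext ?_
  filter_upwards [conjL2_coe hbar f, conjL2_coe hbar (conjL2 hbar f)] with q h1 h2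
  rw [h2, h1]
  ext α
  simp [conjBar, hbar α]

variable {𝓗 : Type*} [NormedAddCommGroup 𝓗] [InnerProductSpace ℂ 𝓗]
  (U : 𝓗 ≃ₗᵢ[ℂ] L2R ι)

/-- The modular group in the representation `U`. -/
def modGroup (t : ℝ) : 𝓗 →L[ℂ] 𝓗 :=
  (U.symm : L2R ι →L[ℂ] 𝓗) ∘L (translateL2 ι t).toContinuousLinearMap ∘L (U : 𝓗 →L[ℂ] L2R ι)

/-- The modular conjugation in the representation `U`. -/
def modConj {bar : ι → ι} (hbar : Function.Involutive bar) : 𝓗 ≃ₗᵢ⋆[ℂ] 𝓗 :=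
  (U.trans (conjL2 hbar)).trans U.symm

theorem apply_modGroup (t : ℝ) (x : 𝓗) : U (modGroup U t x) = translateL2 ι t (U x) := by
  simp [modGroup]

theorem apply_modConj {bar : ι → ι} (hbar : Function.Involutive bar) (x : 𝓗) :
    U (modConj U hbar x) = conjL2 hbar (U x) := by
  simp [modConj]

theorem modConj_coe {bar : ι → ι} (hbar : Function.Involutive bar) (x : 𝓗) :
    ∀ᵐ q : ℝ, ∀ α, U (modConj U hbar x) q α = conj (U x q (bar α)) := by
  rw [apply_modConj]
  filter_upwards [conjL2_coe hbar (U x)] with q hq α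
  rw [hq]
  rfl

variable [CompleteSpace 𝓗]

theorem isUnitaryGroup_modGroup : IsUnitaryGroup (modGroup U) := by
  have hadd : ∀ s t x, modGroup U (s + t) x = modGroup U s (modGroup U t x) := by
    intro s t x
    apply U.injective
    simp only [apply_modGroup, translateL2_add]
  have h0 : ∀ x, modGroup U 0 x = x := by
    intro x
    apply U.injective
    simp only [apply_modGroup, translateL2_zero]
  have hinner : ∀ t x y, ⟪modGroup U t x, modGroup U t y⟫_ℂ = ⟪x, y⟫_ℂ := by
    intro t x y
    rw [← U.inner_map_map, apply_modGroup, apply_modGroup, LinearIsometry.inner_map_map,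
      U.inner_map_map]
  have hadj : ∀ t, modGroup U (-t) = ContinuousLinearMap.adjoint (modGroup U t) := by
    intro t
    rw [ContinuousLinearMap.eq_adjoint_iff]
    intro x y
    rw [← hinner t, ← hadd, add_neg_cancel, h0]
  refine ⟨fun t => ?_, fun s t => ?_, fun x => ?_⟩
  · rw [Unitary.mem_iff, ContinuousLinearMap.star_eq_adjoint, ← hadj]
    constructor
    · ext x
      rw [mul_apply_eq_comp, ← hadd, neg_add_cancel, h0, one_apply_eq_self]
    · ext x
      rw [mul_apply_eq_comp, ← hadd, add_neg_cancel, h0, one_apply_eq_self]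
  · ext x
    rw [mul_apply_eq_comp, hadd]
  · exact U.symm.continuous.comp (continuous_translateL2 (U x))

/-- A vector-valued integral in L² is only an equivalence class. Its pointwise form is obtained by
pairing with indicators of sets of finite measure and exchanging the integrals. -/
theorem smear_coe {c : ℝ} (hc : 0 < c) (x : 𝓗) (z : ℂ) (α : ι) :
    (fun q => U (smear (modGroup U) c x z) q α) =ᵐ[volume]
      fun q : ℝ => ∫ t : ℝ, gker c (t - z) * U x (q - 2 * Real.pi * t) α := by
  classical
  set f : ℝ → ℂ := fun q => U x q α with hf
  have hfm : StronglyMeasurable f := stronglyMeasurable_coord (U x) α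
  have hfL : MemLp f 2 volume := memLp_coord (U x) α
  -- Fubini is justified on sets of finite measure: since |f| ≤ 1 + |f|², the integral of |f(q -
  -- 2πt)| over s is bounded by |s| + ‖f‖² uniformly in t.
  have hint : ∀ s : Set ℝ, MeasurableSet s → volume s < ∞ →
      Integrable (fun p : ℝ × ℝ => gker c (p.1 - z) * f (p.2 - 2 * Real.pi * p.1))
        (volume.prod (volume.restrict s)) := by
    intro s hs hμ
    have hfin : IsFiniteMeasure (volume.restrict s) := ⟨by simpa using hμ⟩
    have hm : AEStronglyMeasurable
        (fun p : ℝ × ℝ => gker c (p.1 - z) * f (p.2 - 2 * Real.pi * p.1))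
        (volume.prod (volume.restrict s)) := by
      refine StronglyMeasurable.aestronglyMeasurable ?_
      exact ((differentiable_gker c).continuous.comp (by fun_prop)).stronglyMeasurable.mul
        (hfm.comp_measurable (by fun_prop))
    have hsq : ∀ t : ℝ, MemLp (fun q => f (q - 2 * Real.pi * t)) 2 volume := fun t =>
      hfL.comp_measurePreserving (measurePreserving_sub_right volume _)
    rw [integrable_prod_iff hm]
    refine ⟨Eventually.of_forall fun t => ?_, ?_⟩
    · exact (((hsq t).restrict s).integrable one_le_two).const_mul (gker c (t - z))
    · refine Integrable.mono' ((integrable_norm_gker hc z).mul_const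
        (volume.real s + ∫ q, ‖f q‖ ^ 2)) hm.norm.integral_prod_right'
        (Eventually.of_forall fun t => ?_)
      rw [Real.norm_of_nonneg (by positivity)]
      simp only [norm_mul, integral_const_mul]
      refine mul_le_mul_of_nonneg_left ?_ (norm_nonneg _)
      have hi : Integrable (fun q => ‖f (q - 2 * Real.pi * t)‖ ^ 2) :=
        (memLp_two_iff_integrable_sq_norm (hsq t).1).1 (hsq t)
      calc ∫ q in s, ‖f (q - 2 * Real.pi * t)‖
          ≤ ∫ q in s, (1 + ‖f (q - 2 * Real.pi * t)‖ ^ 2) := by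
            refine integral_mono (((hsq t).restrict s).integrable one_le_two).norm
              ((integrable_const _).add hi.integrableOn) fun q => ?_
            simp only []
            nlinarith [sq_nonneg (‖f (q - 2 * Real.pi * t)‖ - 1 / 2)]
        _ = volume.real s + ∫ q in s, ‖f (q - 2 * Real.pi * t)‖ ^ 2 := by
            rw [integral_add (integrable_const _) hi.integrableOn]
            simp
        _ ≤ volume.real s + ∫ q, ‖f q‖ ^ 2 := by
            refine add_le_add le_rfl ?_
            rw [← integral_sub_right_eq_self (fun q => ‖f q‖ ^ 2) (2 * Real.pi * t)]
            exact setIntegral_le_integral hi (Eventually.of_forall fun q => by positivity)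
  refine ae_eq_of_forall_setIntegral_eq_of_sigmaFinite ?_ ?_ ?_
  · intro s hs hμ
    have hfin : IsFiniteMeasure (volume.restrict s) := ⟨by simpa using hμ⟩
    exact ((memLp_coord _ α).restrict s).integrable one_le_two
  · intro s hs hμ
    exact (hint s hs hμ).integral_prod_right
  · intro s hs hμ
    have hfin : IsFiniteMeasure (volume.restrict s) := ⟨by simpa using hμ⟩
    have hfun : ∀ u : L2R ι, ⟪indicatorConstLp 2 hs hμ.ne (EuclideanSpace.single α (1 : ℂ)), u⟫_ℂ =
        ∫ q in s, u q α := by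
      intro u
      rw [L2.inner_indicatorConstLp_eq_inner_setIntegral, EuclideanSpace.inner_single_left,
        map_one, one_mul]
      have hi : Integrable u (volume.restrict s) :=
        ((Lp.memLp u).restrict s).integrable one_le_two
      exact ((EuclideanSpace.proj α : EuclideanSpace ℂ ι →L[ℂ] ℂ).integral_comp_comm hi).symm
    have h1 : ∀ y : 𝓗, ∫ q in s, U y q α = ⟪U.symm (indicatorConstLp 2 hs hμ.ne
        (EuclideanSpace.single α (1 : ℂ))), y⟫_ℂ := by
      intro y
      rw [← hfun, ← U.inner_map_map, U.apply_symm_apply]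
    rw [h1, inner_smear_right (isUnitaryGroup_modGroup U) hc]
    simp only [← h1]
    rw [← integral_integral_swap (hint s hs hμ)]
    refine integral_congr_ae (Eventually.of_forall fun t => ?_)
    simp only []
    rw [integral_const_mul]
    congr 1
    refine integral_congr_ae (ae_restrict_of_ae ?_)
    rw [apply_modGroup]
    filter_upwards [translateL2_coe t (U x)] with q hq
    rw [hq]

/-- Substituting s = q - 2πt turns the modular average at parameter -ia/(2π) into a convolution
evaluated at q + ia. Thus a = π corresponds to Δ^{1/2}. -/
theorem smear_coe' {c : ℝ} (hc : 0 < c) (x : 𝓗) (a : ℝ) (α : ι) :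
    (fun q => U (smear (modGroup U) c x (-(a / (2 * Real.pi) : ℝ) * Complex.I)) q α) =ᵐ[volume]
      fun q : ℝ => ∫ s : ℝ, rapidityGker c (q + a * Complex.I - s) * U x s α := by
  refine (smear_coe U hc x _ α).trans (Eventually.of_forall fun q => ?_)
  simp only []
  have h2 := Measure.integral_comp_mul_left
    (fun t : ℝ => gker c (((2 * Real.pi)⁻¹ * t : ℝ) -
      -(a / (2 * Real.pi) : ℝ) * Complex.I) * U x (q - t) α) (2 * Real.pi)
  have hpi : (0 : ℝ) < 2 * Real.pi := by positivity
  rw [abs_of_pos (inv_pos.2 hpi)] at h2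
  have e : ∀ t : ℝ, (2 * Real.pi)⁻¹ * (2 * Real.pi * t) = t := fun t => by
    rw [← mul_assoc, inv_mul_cancel₀ hpi.ne', one_mul]
  simp only [e] at h2
  rw [h2, ← integral_sub_left_eq_self _ volume q, ← integral_smul]
  refine integral_congr_ae (Eventually.of_forall fun s => ?_)
  simp only [sub_sub_cancel, rapidityGker]
  rw [Complex.real_smul, ← mul_assoc]
  congr 2
  · push_cast
    ring
  · congr 1
    push_cast
    field_simp
    ring

end SchrodingerModular

/-! ### The polar decomposition of S_H in rapidity space -/

section SchrodingerModularPair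

variable {ι : Type*} [Fintype ι] {𝓗 : Type*} [NormedAddCommGroup 𝓗] [InnerProductSpace ℂ 𝓗]
  [CompleteSpace 𝓗] (U : 𝓗 ≃ₗᵢ[ℂ] L2R ι)

omit [CompleteSpace 𝓗] in
theorem eLpNorm_coord_sub_le (x y : 𝓗) (α : ι) :
    eLpNorm (fun q => U x q α - U y q α) 2 volume ≤ ENNReal.ofReal ‖x - y‖ := by
  rw [← U.norm_map (x - y), map_sub]
  refine le_trans (le_of_eq (eLpNorm_congr_ae ?_)) (eLpNorm_coord_le _ α)
  filter_upwards [Lp.coeFn_sub (U x) (U y)] with q hq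
  rw [hq]
  rfl

/-- The convolution with the Gaussian is entire in the rapidity, and its restriction to height a is
the smeared orbit at -ia/(2π). The L² limits at the edges follow from norm continuity of that orbit.
-/
theorem isHardyPair_smear {c : ℝ} (hc : 0 < c) (x : 𝓗) (α : ι) :
    IsHardyPair (fun q => U (smear (modGroup U) c x 0) q α)
      (fun q => U (smear (modGroup U) c x (-(Complex.I / 2))) q α) := by
  set Z : ℝ → ℂ := fun a => -(a / (2 * Real.pi) : ℝ) * Complex.I with hZ
  have hG := isUnitaryGroup_modGroup U
  have hZc : Continuous Z := by fun_prop
  have hsm : Continuous fun a => smear (modGroup U) c x (Z a) :=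
    (differentiable_smear hG hc x).continuous.comp hZc
  set Φ : ℂ → ℂ := fun w => ∫ s : ℝ, rapidityGker c (w - s) * U x s α with hΦ
  have hcoe : ∀ a : ℝ, (fun q : ℝ => Φ (q + a * Complex.I)) =ᵐ[volume]
      fun q => U (smear (modGroup U) c x (Z a)) q α := fun a => (smear_coe' U hc x a α).symm
  have hlim : ∀ b : ℝ, Tendsto (fun a : ℝ => eLpNorm (fun q : ℝ => Φ (q + a * Complex.I) -
      U (smear (modGroup U) c x (Z b)) q α) 2 volume) (𝓝 b) (𝓝 0) := by
    intro b
    have h1 : Tendsto (fun a : ℝ => ENNReal.ofReal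
        ‖smear (modGroup U) c x (Z a) - smear (modGroup U) c x (Z b)‖) (𝓝 b) (𝓝 0) := by
      have := ((hsm.tendsto b).sub_const (smear (modGroup U) c x (Z b))).norm
      rw [sub_self, norm_zero] at this
      simpa using ENNReal.tendsto_ofReal this
    refine tendsto_of_tendsto_of_tendsto_of_le_of_le tendsto_const_nhds h1 (fun a => zero_le)
      fun a => ?_
    refine le_trans (le_of_eq (eLpNorm_congr_ae ?_)) (eLpNorm_coord_sub_le U _ _ α)
    filter_upwards [hcoe a] with q hq
    rw [hq]
  have hZ0 : Z 0 = 0 := by simp [hZ]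
  have hZpi : Z Real.pi = -(Complex.I / 2) := by
    simp only [hZ]
    push_cast
    have : (Real.pi : ℂ) ≠ 0 := by exact_mod_cast Real.pi_ne_zero
    field_simp
  refine ⟨Φ, (differentiable_integral_rapidityGker hc (memLp_coord (U x) α)).differentiableOn,
    ⟨Real.exp (c * 1) * ‖x‖, fun a ha => ?_⟩, ?_, ?_⟩
  · rw [eLpNorm_congr_ae (hcoe a)]
    refine (eLpNorm_coord_le _ α).trans (ENNReal.ofReal_le_ofReal ?_)
    rw [U.norm_map]
    refine (norm_smear_le hG hc x _).trans ?_
    have h1 : (Z a).im = -(a / (2 * Real.pi)) := by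
      simp only [hZ, Complex.mul_I_im, ← Complex.ofReal_neg, Complex.ofReal_re]
    have h2 : (Z a).im ^ 2 ≤ 1 := by
      rw [h1, neg_sq]
      refine pow_le_one₀ (div_nonneg ha.1.le (by positivity)) ?_
      rw [div_le_one (by positivity)]
      linarith [ha.2, Real.pi_pos]
    gcongr
  · have := (hlim 0).mono_left (nhdsWithin_le_nhds (s := Set.Ioi 0))
    rwa [hZ0] at this
  · have := (hlim Real.pi).mono_left (nhdsWithin_le_nhds (s := Set.Iio Real.pi))
    rwa [hZpi] at this

/-- By closedness of the root it is enough to compare smeared vectors. There, the contour shift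
against the Gaussian trades the upper boundary value v at kernel height 0 for the lower boundary
value x at kernel height π. -/
theorem isSqrtValue_of_isHardyPair {x v : 𝓗}
    (h : ∀ α, IsHardyPair (fun q => U x q α) (fun q => U v q α)) :
    IsSqrtValue (modGroup U) x v := by
  have hG := isUnitaryGroup_modGroup U
  refine isSqrtValue_of_tendsto hG ((tendsto_smear hG v).congr fun n => ?_)
  have hn : (0 : ℝ) < n + 1 := by positivity
  apply U.injective
  refine Lp.ext ?_
  have h1 : ∀ α, ∀ᵐ q : ℝ, U (smear (modGroup U) (n + 1) v 0) q α =
      U (smear (modGroup U) (n + 1) x (-(Complex.I / 2))) q α := by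
    intro α
    have e0 := smear_coe' U hn v 0 α
    have e1 := smear_coe' U hn x Real.pi α
    have z0 : (-((0 : ℝ) / (2 * Real.pi) : ℝ) * Complex.I : ℂ) = 0 := by simp
    have z1 : (-(Real.pi / (2 * Real.pi) : ℝ) * Complex.I : ℂ) = -(Complex.I / 2) := by
      have : (Real.pi : ℂ) ≠ 0 := by exact_mod_cast Real.pi_ne_zero
      push_cast
      field_simp
    rw [z0] at e0
    rw [z1] at e1
    filter_upwards [e0, e1] with q h0 h1
    rw [h0, h1]
    have := (isHardyPair_rapidityGker hn q).integral_mul_eq' (h α)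
      (memLp_rapidityGker hn _) (memLp_rapidityGker hn _) (memLp_coord _ α) (memLp_coord _ α)
    simpa using this.symm
  filter_upwards [ae_all_iff.2 h1] with q hq
  ext α
  exact hq α

variable {U} {H : StandardSubspace 𝓗} {bar : ι → ι}

/-- The vector is y + S_H y with y = cx, hence fixed by S_H. Membership is verified on smeared
vectors, where both boundary values are at hand, and H is closed. Keeping c arbitrary serves both
the decomposition into real and imaginary parts and the polarization of locality. -/
theorem mem_of_isSqrtValue (hbar : Function.Involutive bar)
    (hH : ∀ x, x ∈ H.toClosedSubmodule ↔
      ∀ α, IsHardyPair (fun q => U x q α) (fun q => conj (U x q (bar α))))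
    {x w : 𝓗} (h : IsSqrtValue (modGroup U) x w) (c : ℂ) :
    c • x + conj c • modConj U hbar w ∈ H.toClosedSubmodule := by
  have hG := isUnitaryGroup_modGroup U
  set J := modConj U hbar with hJ
  have h1 : ∀ n : ℕ, c • smear (modGroup U) (n + 1) x 0 +
      conj c • J (smear (modGroup U) (n + 1) w 0) ∈ H.toClosedSubmodule := by
    intro n
    have hn : (0 : ℝ) < n + 1 := by positivity
    rw [hH]
    intro α
    set X := smear (modGroup U) (n + 1) x 0
    set W := smear (modGroup U) (n + 1) w 0 with hW
    have p1 : ∀ α, IsHardyPair (fun q => U X q α) (fun q => U W q α) := by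
      intro α
      rw [hW, ← h.smear_eq hG n]
      exact isHardyPair_smear U hn x α
    have p2 := (p1 (bar α)).reflect
    have m : ∀ (y : 𝓗) β, AEStronglyMeasurable (fun q => U y q β) := fun y β =>
      (memLp_coord (U y) β).1
    have mc : ∀ (y : 𝓗) β, AEStronglyMeasurable (fun q => conj (U y q β)) := fun y β =>
      Complex.continuous_conj.comp_aestronglyMeasurable (m y β)
    refine (((p1 α).smul c).add (p2.smul (conj c)) ((m _ _).const_mul _) ((m _ _).const_mul _)
      ((mc _ _).const_mul _) ((mc _ _).const_mul _)).congr ?_ ?_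
    · rw [map_add, map_smul, map_smul]
      filter_upwards [modConj_coe U hbar W, Lp.coeFn_add (c • U X) (conj c • U (J W)),
        Lp.coeFn_smul c (U X), Lp.coeFn_smul (conj c) (U (J W))] with q a1 a2 a3 a4
      rw [a2, Pi.add_apply, a3, a4]
      simp only [PiLp.add_apply, Pi.smul_apply, PiLp.smul_apply, smul_eq_mul]
      rw [a1 α]
    · rw [map_add, map_smul, map_smul]
      filter_upwards [modConj_coe U hbar W, Lp.coeFn_add (c • U X) (conj c • U (J W)),
        Lp.coeFn_smul c (U X), Lp.coeFn_smul (conj c) (U (J W))] with q a1 a2 a3 a4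
      rw [a2, Pi.add_apply, a3, a4]
      simp only [PiLp.add_apply, Pi.smul_apply, PiLp.smul_apply, smul_eq_mul]
      rw [a1 (bar α), hbar α]
      simp only [map_add, map_mul, Complex.conj_conj]
      ring
  have h2 : Tendsto (fun n : ℕ => c • smear (modGroup U) (n + 1) x 0 +
      conj c • J (smear (modGroup U) (n + 1) w 0)) atTop (𝓝 (c • x + conj c • J w)) :=
    ((tendsto_smear hG x).const_smul c).add
      (((J.continuous.tendsto w).comp (tendsto_smear hG w)).const_smul _)
  exact H.toClosedSubmodule.isClosed.mem_of_tendsto h2 (Eventually.of_forall h1)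

theorem isSqrtValue_modConj (hbar : Function.Involutive bar)
    (hH : ∀ x, x ∈ H.toClosedSubmodule ↔
      ∀ α, IsHardyPair (fun q => U x q α) (fun q => conj (U x q (bar α))))
    {f : 𝓗} (hf : f ∈ H.toClosedSubmodule) : IsSqrtValue (modGroup U) f (modConj U hbar f) := by
  refine isSqrtValue_of_isHardyPair U fun α => ?_
  refine ((hH f).1 hf α).congr (Eventually.of_forall fun q => rfl) ?_
  filter_upwards [modConj_coe U hbar f] with q hq
  rw [hq]

omit [CompleteSpace 𝓗] in
theorem modConj_modConj (hbar : Function.Involutive bar) (x : 𝓗) :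
    modConj U hbar (modConj U hbar x) = x := by
  apply U.injective
  rw [apply_modConj, apply_modConj, conjL2_conjL2]

theorem isModularPair_modGroup (hbar : Function.Involutive bar)
    (hH : ∀ x, x ∈ H.toClosedSubmodule ↔
      ∀ α, IsHardyPair (fun q => U x q α) (fun q => conj (U x q (bar α)))) :
    IsModularPair H (modGroup U) (modConj U hbar) := by
  have hG := isUnitaryGroup_modGroup U
  refine ⟨hG, modConj_modConj hbar, fun x y => ⟨?_, ?_⟩⟩
  · rintro ⟨f, hf, g, hg, rfl, rfl⟩
    refine ⟨modConj U hbar f + Complex.I • modConj U hbar g, ?_, ?_⟩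
    · rw [isSqrtValue_iff hG]
      intro c x hc
      have h1 := (isSqrtValue_iff hG).1 (isSqrtValue_modConj hbar hH hf) c x hc
      have h2 := (isSqrtValue_iff hG).1 (isSqrtValue_modConj hbar hH hg) c x hc
      rw [inner_add_left, inner_add_left, inner_smul_left, inner_smul_left, h1, h2]
    · rw [map_add, LinearIsometryEquiv.map_smulₛₗ, modConj_modConj, modConj_modConj,
        Complex.conj_I, neg_smul, sub_eq_add_neg]
  · rintro ⟨w, hw, rfl⟩
    -- The constants give f = (x + y)/2 and g = (x - y)/(2i), where y = J w.
    refine ⟨_, mem_of_isSqrtValue hbar hH hw (1 / 2), _,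
      mem_of_isSqrtValue hbar hH hw (-(Complex.I / 2)), ?_, ?_⟩
    all_goals
      have c1 : conj (1 / 2 : ℂ) = 1 / 2 := by simp [map_ofNat (starRingEnd ℂ) 2]
      have c2 : conj (-(Complex.I / 2)) = Complex.I / 2 := by
        rw [← neg_neg (conj (-(Complex.I / 2))), neg_conj_neg_half_I, neg_neg]
      have i2 : Complex.I * Complex.I = -1 := Complex.I_mul_I
      rw [c1, c2]
      simp only [smul_add, smul_smul]
      match_scalars <;>
        first
        | linear_combination (-1 / 2 : ℂ) * i2
        | linear_combination (1 / 2 : ℂ) * i2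

end SchrodingerModularPair

/-! ### Operators acting as weighted compositions -/

section Weighted

variable {E F G : Type*} [NormedAddCommGroup E] [InnerProductSpace ℂ E]
  [NormedAddCommGroup F] [InnerProductSpace ℂ F] [NormedAddCommGroup G] [InnerProductSpace ℂ G]

theorem htensor_induction {P : HTensor E F → Prop} (hc : IsClosed {ξ | P ξ})
    (hm : ∀ x y, P (htmul x y)) (ha : ∀ ξ η, P ξ → P η → P (ξ + η)) (ξ : HTensor E F) : P ξ := by
  refine UniformSpace.Completion.induction_on ξ hc fun a => ?_
  induction a with
  | zero =>
    have := hm 0 0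
    rwa [htmul, TensorProduct.zero_tmul] at this
  | tmul x y => exact hm x y
  | add a b ha' hb' =>
    rw [UniformSpace.Completion.coe_add]
    exact ha _ _ ha' hb'

theorem htensor_ext {A B : HTensor E F →L[ℂ] G} (h : ∀ x y, A (htmul x y) = B (htmul x y)) :
    A = B := by
  ext ξ
  refine htensor_induction (P := fun ξ => A ξ = B ξ) (isClosed_eq A.continuous B.continuous) h
    (fun ξ η h1 h2 => ?_) ξ
  rw [map_add, map_add, h1, h2]

theorem htensor_inner_ext {a b : HTensor E F} (h : ∀ x y, ⟪htmul x y, a⟫_ℂ = ⟪htmul x y, b⟫_ℂ) :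
    a = b := by
  have : innerSL ℂ a = innerSL ℂ b := htensor_ext fun x y => by
    rw [innerSL_apply_apply, innerSL_apply_apply, ← inner_conj_symm, h, inner_conj_symm]
  refine ext_inner_right ℂ fun ξ => ?_
  rw [← innerSL_apply_apply, this, innerSL_apply_apply]

theorem htmul_add_left (x x' : E) (y : F) : htmul (x + x') y = htmul x y + htmul x' y := by
  rw [htmul, htmul, htmul, TensorProduct.add_tmul, UniformSpace.Completion.coe_add]

theorem continuous_htmul_left (y : F) : Continuous fun x : E => htmul x y :=
  (UniformSpace.Completion.continuous_coe _).comp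
    ((TensorProduct.mkL ℂ E F).flip y).continuous

/-- L² convergence yields almost everywhere convergence along a subsequence, so pointwise relations
survive limits. Each L p must be continuous, but no bound uniform in p is needed; multipliers need
not be known to be bounded. -/
theorem isClosed_setOf_ae_eq {K X Y E F : Type*} [TopologicalSpace K] [SequentialSpace K]
    [MeasurableSpace X] [MeasurableSpace Y] [NormedAddCommGroup E] [NormedAddCommGroup F]
    {μ : Measure X} {ν : Measure Y} {A : K → Lp E 2 μ} {B : K → Lp F 2 ν} (hA : Continuous A)
    (hB : Continuous B) {σ : Y → X} (hσ : Measure.QuasiMeasurePreserving σ ν μ) {L : Y → E → F}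
    (hL : ∀ p, Continuous (L p)) : IsClosed {ξ | ∀ᵐ p ∂ν, B ξ p = L p (A ξ (σ p))} := by
  refine IsSeqClosed.isClosed fun ξ ξ₀ hξ hlim => ?_
  obtain ⟨n₁, hn₁, h₁⟩ := (tendstoInMeasure_of_tendsto_Lp
    ((hA.tendsto ξ₀).comp hlim)).exists_seq_tendsto_ae
  obtain ⟨n₂, hn₂, h₂⟩ := (tendstoInMeasure_of_tendsto_Lp
    ((hB.tendsto ξ₀).comp (hlim.comp hn₁.tendsto_atTop))).exists_seq_tendsto_ae
  filter_upwards [hσ.ae h₁, h₂, ae_all_iff.2 fun n => hξ n] with p a1 a2 a3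
  have a4 := ((hL p).tendsto _).comp (a1.comp hn₂.tendsto_atTop)
  refine tendsto_nhds_unique a2 (a4.congr fun n => ?_)
  exact (a3 _).symm

variable {X Y κ κ' : Type*} [Fintype κ] [Fintype κ'] [MeasurableSpace X] [MeasurableSpace Y]
  {μ : Measure X} {ν : Measure Y}

/-- `R` acts, in the representation `V`, by `(R ξ)(p) = M(p) ξ(σ p)`. -/
def Acts {K : Type*} (V : K → Lp (EuclideanSpace ℂ κ) 2 μ) (R : K → K)
    (M : X → Matrix κ κ ℂ) (σ : X → X) : Prop :=
  ∀ ξ, ∀ᵐ p ∂μ, (V (R ξ) p).ofLp = (M p).mulVec (V ξ (σ p)).ofLp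

/-- For every index there is a vector supported in this component, and nonzero almost
everywhere. -/
def Separates {K : Type*} [DecidableEq κ] (V : K → Lp (EuclideanSpace ℂ κ) 2 μ) : Prop :=
  ∀ b, ∃ ξ, ∀ᵐ p ∂μ, ∃ g : ℂ, g ≠ 0 ∧ (V ξ p).ofLp = Pi.single b g

theorem Acts.comp {K : Type*} {V : K → Lp (EuclideanSpace ℂ κ) 2 μ} {R R' : K → K}
    {M M' : X → Matrix κ κ ℂ} {σ σ' : X → X} (h : Acts V R M σ) (h' : Acts V R' M' σ')
    (hσ : Measure.QuasiMeasurePreserving σ μ μ) :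
    Acts V (R ∘ R') (fun p => M p * M' (σ p)) (σ' ∘ σ) := by
  intro ξ
  filter_upwards [h (R' ξ), hσ.ae (h' ξ)] with p h1 h2
  rw [Function.comp_apply, h1, h2, Matrix.mulVec_mulVec]
  rfl

theorem Acts.congr {K : Type*} {V : K → Lp (EuclideanSpace ℂ κ) 2 μ} {R : K → K}
    {M M' : X → Matrix κ κ ℂ} {σ : X → X} (h : Acts V R M σ) (hM : ∀ᵐ p ∂μ, M p = M' p) :
    Acts V R M' σ := by
  intro ξ
  filter_upwards [h ξ, hM] with p h1 h2
  rw [h1, h2]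

/-- A vector living in one component and vanishing almost nowhere reads off one column of the
multiplier. -/
theorem Acts.matrix_ae_eq {K : Type*} [DecidableEq κ] {V : K → Lp (EuclideanSpace ℂ κ) 2 μ}
    (hV : Separates V) {R : K → K} {M M' : X → Matrix κ κ ℂ} {σ : X → X}
    (hσ : Measure.QuasiMeasurePreserving σ μ μ) (h : Acts V R M σ) (h' : Acts V R M' σ) :
    ∀ᵐ p ∂μ, M p = M' p := by
  have key : ∀ b, ∀ᵐ p ∂μ, (M p).col b = (M' p).col b := by
    intro b
    obtain ⟨ξ, hξ⟩ := hV b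
    filter_upwards [h ξ, h' ξ, hσ.ae hξ] with p h1 h2 ⟨g, hg, h3⟩
    rw [h1, h3, Matrix.mulVec_single, Matrix.mulVec_single] at h2
    funext a
    have := congrFun h2 a
    simpa [hg] using this
  filter_upwards [ae_all_iff.2 key] with p hp
  ext a b
  exact congrFun (hp b) a

theorem Acts.eq {K : Type*} {V : K → Lp (EuclideanSpace ℂ κ) 2 μ} (hV : Function.Injective V)
    {R R' : K → K} {M M' : X → Matrix κ κ ℂ} {σ : X → X} (h : Acts V R M σ) (h' : Acts V R' M' σ)
    (hM : ∀ᵐ p ∂μ, M p = M' p) : R = R' := by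
  funext ξ
  apply hV
  refine Lp.ext ?_
  filter_upwards [h ξ, h' ξ, hM] with p h1 h2 h3
  apply WithLp.ofLp_injective
  rw [h1, h2, h3]

theorem continuous_mulVec_ofLp (M : Matrix κ κ ℂ) :
    Continuous fun v : EuclideanSpace ℂ κ => (WithLp.toLp 2 (M.mulVec v.ofLp) :
      EuclideanSpace ℂ κ) := by
  fun_prop

theorem acts_of_htmul {V : HTensor E F →L[ℂ] Lp (EuclideanSpace ℂ κ) 2 μ}
    {R : HTensor E F →L[ℂ] HTensor E F} {M : X → Matrix κ κ ℂ} {σ : X → X}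
    (hσ : Measure.QuasiMeasurePreserving σ μ μ)
    (h : ∀ x y, ∀ᵐ p ∂μ, (V (R (htmul x y)) p).ofLp =
      (M p).mulVec (V (htmul x y) (σ p)).ofLp) : Acts V R M σ := by
  have hset : {ξ | ∀ᵐ p ∂μ, (V (R ξ) p).ofLp = (M p).mulVec (V ξ (σ p)).ofLp} =
      {ξ | ∀ᵐ p ∂μ, V (R ξ) p = WithLp.toLp 2 ((M p).mulVec (V ξ (σ p)).ofLp)} := by
    ext ξ
    simp only [Set.mem_ofPred_eq]
    refine eventually_congr (Eventually.of_forall fun p => ?_)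
    exact ⟨fun h => by rw [← h], fun h => by rw [h]⟩
  refine htensor_induction ?_ h fun ξ η h1 h2 => ?_
  · rw [hset]
    exact isClosed_setOf_ae_eq (A := V) (B := fun ξ => V (R ξ)) V.continuous
      (V.continuous.comp R.continuous) hσ (L := fun p v => WithLp.toLp 2 ((M p).mulVec v.ofLp))
      fun p => continuous_mulVec_ofLp (M p)
  · rw [map_add, map_add, map_add]
    filter_upwards [h1, h2, Lp.coeFn_add (V (R ξ)) (V (R η)),
      hσ.ae (Lp.coeFn_add (V ξ) (V η))] with p a1 a2 a3 a4
    rw [a3, a4, Pi.add_apply, Pi.add_apply, WithLp.ofLp_add, WithLp.ofLp_add, a1, a2,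
      Matrix.mulVec_add]

/-- `V` maps `x ⊗ y` to the product of the functions `A x` and `B y`. -/
def IsProductRep (V : HTensor E F →L[ℂ] Lp (EuclideanSpace ℂ (κ × κ')) 2 (μ.prod ν))
    (A : E → Lp (EuclideanSpace ℂ κ) 2 μ) (B : F → Lp (EuclideanSpace ℂ κ') 2 ν) : Prop :=
  ∀ x y, ∀ᵐ p ∂(μ.prod ν), ∀ a b, V (htmul x y) p (a, b) = A x p.1 a * B y p.2 b

theorem IsProductRep.inner_map_map [SFinite μ] [SFinite ν]
    {V : HTensor E F →L[ℂ] Lp (EuclideanSpace ℂ (κ × κ')) 2 (μ.prod ν)}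
    {A : E → Lp (EuclideanSpace ℂ κ) 2 μ} {B : F → Lp (EuclideanSpace ℂ κ') 2 ν}
    (h : IsProductRep V A B) (hA : ∀ x x', ⟪A x, A x'⟫_ℂ = ⟪x, x'⟫_ℂ)
    (hB : ∀ y y', ⟪B y, B y'⟫_ℂ = ⟪y, y'⟫_ℂ) (ξ η : HTensor E F) : ⟪V ξ, V η⟫_ℂ = ⟪ξ, η⟫_ℂ := by
  have key : ContinuousLinearMap.adjoint V ∘L V = ContinuousLinearMap.id ℂ _ := by
    refine htensor_ext fun x' y' => htensor_inner_ext fun x y => ?_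
    rw [ContinuousLinearMap.comp_apply, ContinuousLinearMap.adjoint_inner_right,
      ContinuousLinearMap.id_apply, inner_htmul, ← hA, ← hB, L2.inner_def, L2.inner_def,
      L2.inner_def, ← integral_prod_mul]
    refine integral_congr_ae ?_
    filter_upwards [h x y, h x' y'] with p h1 h2
    simp only [PiLp.inner_apply, RCLike.inner_apply, Fintype.sum_prod_type, Finset.sum_mul_sum,
      h1, h2, map_mul]
    refine Finset.sum_congr rfl fun a _ => Finset.sum_congr rfl fun b _ => ?_
    ring
  rw [← ContinuousLinearMap.adjoint_inner_right, ← ContinuousLinearMap.comp_apply, key,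
    ContinuousLinearMap.id_apply]

theorem injective_of_inner_map_map {K L : Type*} [NormedAddCommGroup K] [InnerProductSpace ℂ K]
    [NormedAddCommGroup L] [InnerProductSpace ℂ L] {V : K →L[ℂ] L}
    (h : ∀ ξ η, ⟪V ξ, V η⟫_ℂ = ⟪ξ, η⟫_ℂ) : Function.Injective V := by
  rw [injective_iff_map_eq_zero]
  intro ξ hξ
  rw [← inner_self_eq_zero (𝕜 := ℂ), ← h, hξ, inner_zero_left]

theorem IsProductRep.separates [DecidableEq κ] [DecidableEq κ'] [SFinite μ] [SFinite ν]
    {V : HTensor E F →L[ℂ] Lp (EuclideanSpace ℂ (κ × κ')) 2 (μ.prod ν)}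
    {A : E → Lp (EuclideanSpace ℂ κ) 2 μ} {B : F → Lp (EuclideanSpace ℂ κ') 2 ν}
    (h : IsProductRep V A B) (hA : Separates A) (hB : Separates B) : Separates V := by
  rintro ⟨a, b⟩
  obtain ⟨x, hx⟩ := hA a
  obtain ⟨y, hy⟩ := hB b
  refine ⟨htmul x y, ?_⟩
  filter_upwards [h x y, Measure.quasiMeasurePreserving_fst.ae hx,
    Measure.quasiMeasurePreserving_snd.ae hy] with p h1 ⟨g, hg, h2⟩ ⟨g', hg', h3⟩
  refine ⟨g * g', mul_ne_zero hg hg', ?_⟩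
  funext ⟨a', b'⟩
  rw [h1, h2, h3]
  by_cases ha : a' = a <;> by_cases hb : b' = b <;> simp [ha, hb]

end Weighted

/-! ### Operators commuting with the translations -/

section Commutant

theorem continuous_phase (t : ℝ) : Continuous (phase t) := by
  unfold phase
  fun_prop

theorem norm_phase (t q : ℝ) : ‖phase t q‖ = 1 := by
  rw [phase, mul_comm, Complex.norm_exp_ofReal_mul_I]

theorem conj_phase (t q : ℝ) : conj (phase t q) = phase (-t) q := by
  simp [phase, ← Complex.exp_conj]

theorem integrable_phase_mul {w : ℝ × ℝ → ℂ} (hw : Integrable w volume) (t₁ t₂ : ℝ) :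
    Integrable fun p : ℝ × ℝ => phase t₁ p.1 * phase t₂ p.2 * w p := by
  refine hw.bdd_mul (c := 1) ?_ (Eventually.of_forall fun p => ?_)
  · exact (((continuous_phase t₁).comp continuous_fst).mul
      ((continuous_phase t₂).comp continuous_snd)).aestronglyMeasurable
  · rw [norm_mul, norm_phase, norm_phase, one_mul]

/-- In the momenta (e^{q₁}, e^{q₂}) the hypothesis says that the images of w⁺ dq and w⁻ dq have the
same characteristic function. Finite measures are determined by it, and the exponential map is an
embedding, so w⁺ = w⁻ almost everywhere. -/
theorem ae_eq_zero_of_integral_phase_real {w : ℝ × ℝ → ℝ} (hw : Integrable w volume)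
    (h : ∀ t₁ t₂ : ℝ, ∫ p : ℝ × ℝ, phase t₁ p.1 * phase t₂ p.2 * (w p : ℂ) = 0) :
    ∀ᵐ p : ℝ × ℝ, w p = 0 := by
  set e : ℝ × ℝ → ℝ × ℝ := fun p => (Real.exp p.1, Real.exp p.2) with he
  have hemb : MeasurableEmbedding e := by
    refine Continuous.measurableEmbedding (by fun_prop) fun p p' hp => ?_
    simp only [he, Prod.mk.injEq] at hp
    exact Prod.ext (Real.exp_injective hp.1) (Real.exp_injective hp.2)
  set μ₁ : Measure (ℝ × ℝ) := volume.withDensity fun p => ENNReal.ofReal (w p) with hμ₁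
  set μ₂ : Measure (ℝ × ℝ) := volume.withDensity fun p => ENNReal.ofReal (-w p) with hμ₂
  have f₁ : IsFiniteMeasure μ₁ := isFiniteMeasure_withDensity_ofReal hw.2
  have f₂ : IsFiniteMeasure μ₂ := isFiniteMeasure_withDensity_ofReal hw.neg.2
  have m₁ : AEMeasurable (fun p => ENNReal.ofReal (w p)) volume := hw.1.aemeasurable.ennreal_ofReal
  have m₂ : AEMeasurable (fun p => ENNReal.ofReal (-w p)) volume :=
    hw.neg.1.aemeasurable.ennreal_ofReal
  have hmap : μ₁.map e = μ₂.map e := by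
    refine Measure.ext_of_charFunDual ?_
    funext L
    have hcoord : ∀ p, Complex.exp (L (e p) * Complex.I) =
        phase (L (1, 0)) p.1 * phase (L (0, 1)) p.2 := by
      intro p
      have : e p = Real.exp p.1 • ((1, 0) : ℝ × ℝ) + Real.exp p.2 • ((0, 1) : ℝ × ℝ) := by
        simp [he]
      rw [this, map_add, map_smul, map_smul, phase, phase, ← Complex.exp_add]
      congr 1
      simp only [smul_eq_mul]
      push_cast
      ring
    have i₁ := integrable_phase_mul (w := fun p => ((max (w p) 0 : ℝ) : ℂ))
      hw.pos_part.ofReal (L (1, 0)) (L (0, 1))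
    have i₂ := integrable_phase_mul (w := fun p => ((max (-w p) 0 : ℝ) : ℂ))
      hw.neg_part.ofReal (L (1, 0)) (L (0, 1))
    rw [charFunDual_apply, charFunDual_apply, hemb.integral_map, hemb.integral_map,
      hμ₁, hμ₂, integral_withDensity_eq_integral_toReal_smul₀ m₁ (by simp),
      integral_withDensity_eq_integral_toReal_smul₀ m₂ (by simp), ← sub_eq_zero]
    simp only [hcoord, ENNReal.toReal_ofReal', Complex.real_smul]
    rw [← h (L (1, 0)) (L (0, 1))]
    simp only [mul_comm (Complex.ofReal _)]
    rw [← integral_sub i₁ i₂]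
    refine integral_congr_ae (Eventually.of_forall fun p => ?_)
    simp only [← mul_sub, ← Complex.ofReal_sub]
    congr 2
    rcases le_total (w p) 0 with h0 | h0
    · rw [max_eq_right h0, max_eq_left (by linarith)]
      ring
    · rw [max_eq_left h0, max_eq_right (by linarith)]
      ring
  have hμ : μ₁ = μ₂ := by
    ext s hs
    have h1 := congrArg (fun ν : Measure (ℝ × ℝ) => ν (e '' s)) hmap
    simp only [hemb.map_apply, Set.preimage_image_eq s hemb.injective] at h1
    exact h1
  have hd := (withDensity_eq_iff m₁ m₂ (by
    have := measure_lt_top μ₁ Set.univ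
    rw [hμ₁, withDensity_apply _ MeasurableSet.univ, Measure.restrict_univ] at this
    exact this.ne)).1 hμ
  filter_upwards [hd] with p hp
  rcases le_total (w p) 0 with h0 | h0
  · rw [ENNReal.ofReal_eq_zero.2 h0] at hp
    have := ENNReal.ofReal_eq_zero.1 hp.symm
    linarith
  · rw [ENNReal.ofReal_eq_zero.2 (by linarith : -w p ≤ 0)] at hp
    have := ENNReal.ofReal_eq_zero.1 hp
    linarith

/-- The family of phases is stable under conjugation, which flips the signs of t₁ and t₂. So the
hypothesis passes to the real and imaginary parts. -/
theorem ae_eq_zero_of_integral_phase {w : ℝ × ℝ → ℂ} (hw : Integrable w volume)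
    (h : ∀ t₁ t₂ : ℝ, ∫ p : ℝ × ℝ, phase t₁ p.1 * phase t₂ p.2 * w p = 0) :
    ∀ᵐ p : ℝ × ℝ, w p = 0 := by
  have hc : ∀ t₁ t₂ : ℝ, ∫ p : ℝ × ℝ, phase t₁ p.1 * phase t₂ p.2 * conj (w p) = 0 := by
    intro t₁ t₂
    have h1 := congrArg conj (h (-t₁) (-t₂))
    rw [← integral_conj, map_zero] at h1
    simpa only [map_mul, conj_phase, neg_neg] using h1
  have hwc : Integrable (fun p => conj (w p)) volume :=
    (Complex.conjCLE : ℂ →L[ℝ] ℂ).integrable_comp hw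
  have hre := ae_eq_zero_of_integral_phase_real hw.re fun t₁ t₂ => by
    have e : ∀ p : ℝ × ℝ, phase t₁ p.1 * phase t₂ p.2 * ((RCLike.re (w p) : ℝ) : ℂ) =
        2⁻¹ * (phase t₁ p.1 * phase t₂ p.2 * w p + phase t₁ p.1 * phase t₂ p.2 * conj (w p)) := by
      intro p
      rw [← mul_add, Complex.add_conj]
      simp
      ring
    simp only [e]
    rw [integral_const_mul, integral_add (integrable_phase_mul hw _ _)
      (integrable_phase_mul hwc _ _), h, hc, add_zero, mul_zero]
  have him := ae_eq_zero_of_integral_phase_real hw.im fun t₁ t₂ => by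
    have e : ∀ p : ℝ × ℝ, phase t₁ p.1 * phase t₂ p.2 * ((RCLike.im (w p) : ℝ) : ℂ) =
        (2 * Complex.I)⁻¹ * (phase t₁ p.1 * phase t₂ p.2 * w p -
          phase t₁ p.1 * phase t₂ p.2 * conj (w p)) := by
      intro p
      rw [← mul_sub, Complex.sub_conj]
      simp
      field_simp
      linear_combination (phase t₁ p.1 * phase t₂ p.2 * ((w p).im : ℂ)) * Complex.I_sq
    simp only [e]
    rw [integral_const_mul, integral_sub (integrable_phase_mul hw _ _)
      (integrable_phase_mul hwc _ _), h, hc, sub_zero, mul_zero]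
  filter_upwards [hre, him] with p h1 h2
  exact Complex.ext h1 h2

theorem integrable_sum_conj_mul {X κ : Type*} [Fintype κ] [MeasurableSpace X] {μ : Measure X}
    (f g : Lp (EuclideanSpace ℂ κ) 2 μ) : Integrable (fun p => ∑ a, conj (f p a) * g p a) μ := by
  refine (L2.integrable_inner (𝕜 := ℂ) f g).congr (Eventually.of_forall fun p => ?_)
  simp only [PiLp.inner_apply, RCLike.inner_apply]
  exact Finset.sum_congr rfl fun a _ => mul_comm _ _

theorem inner_eq_integral_sum {X κ : Type*} [Fintype κ] [MeasurableSpace X] {μ : Measure X}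
    (f g : Lp (EuclideanSpace ℂ κ) 2 μ) : ⟪f, g⟫_ℂ = ∫ p, ∑ a, conj (f p a) * g p a ∂μ := by
  rw [L2.inner_def]
  refine integral_congr_ae (Eventually.of_forall fun p => ?_)
  simp only [PiLp.inner_apply, RCLike.inner_apply]
  exact Finset.sum_congr rfl fun a _ => mul_comm _ _

variable {ι : Type*} [Fintype ι] {𝓗 : Type*} [NormedAddCommGroup 𝓗] [InnerProductSpace ℂ 𝓗]
  (U : 𝓗 ≃ₗᵢ[ℂ] L2R ι)

/-- The map `ξ ↦ wave U ξ`. -/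
def waveL : HTensor 𝓗 𝓗 →L[ℂ] L2RR ι :=
  twoParticle ∘L hmap (U : 𝓗 →L[ℂ] L2R ι) (U : 𝓗 →L[ℂ] L2R ι)

theorem wave_eq (ξ : HTensor 𝓗 𝓗) : wave U ξ = waveL U ξ := rfl

theorem waveL_htmul_coe (x y : 𝓗) : waveL U (htmul x y) =ᵐ[volume] prodFun (U x) (U y) := by
  rw [waveL, ContinuousLinearMap.comp_apply, hmap_htmul, twoParticle_htmul]
  exact MemLp.coeFn_toLp _

theorem isProductRep_waveL : IsProductRep (μ := volume) (ν := volume) (waveL U) U U := by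
  intro x y
  have h := waveL_htmul_coe U x y
  filter_upwards [h] with p hp a b
  rw [hp]
  rfl

theorem inner_waveL (ξ η : HTensor 𝓗 𝓗) : ⟪waveL U ξ, waveL U η⟫_ℂ = ⟪ξ, η⟫_ℂ :=
  (isProductRep_waveL U).inner_map_map (fun x x' => U.inner_map_map x x')
    (fun x x' => U.inner_map_map x x') ξ η

theorem injective_waveL : Function.Injective (waveL U) :=
  injective_of_inner_map_map (inner_waveL U)

/-- The Gaussian in the component `α`. -/
theorem memLp_gaussian_single [DecidableEq ι] (α : ι) :
    MemLp (fun q : ℝ => EuclideanSpace.single α ((Real.exp (-1 * (q - 0) ^ 2) : ℝ) : ℂ)) 2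
      volume := by
  have h := (memLp_exp_neg_sq 0 one_pos 1)
  refine MemLp.of_le h ?_ (Eventually.of_forall fun q => ?_)
  · refine Continuous.aestronglyMeasurable ?_
    have : Continuous fun z : ℂ => (EuclideanSpace.single α z : EuclideanSpace ℂ ι) := by
      have := (LinearMap.continuous_of_finiteDimensional
        (LinearMap.toSpanSingleton ℂ (EuclideanSpace ℂ ι) (EuclideanSpace.single α 1)))
      refine this.congr fun z => ?_
      ext i
      simp [LinearMap.toSpanSingleton]
    exact this.comp (by fun_prop)
  · rw [PiLp.norm_single, Complex.norm_real, one_mul]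

/-- A vector supported in the component `α`. -/
def compVec [DecidableEq ι] (α : ι) : 𝓗 := U.symm ((memLp_gaussian_single α).toLp _)

theorem compVec_coe [DecidableEq ι] (α : ι) : ∀ᵐ q : ℝ,
    (U (compVec U α) q).ofLp = Pi.single α ((Real.exp (-1 * (q - 0) ^ 2) : ℝ) : ℂ) := by
  rw [compVec, U.apply_symm_apply]
  filter_upwards [(memLp_gaussian_single α).coeFn_toLp] with q hq
  rw [hq]
  rfl

theorem separates_rep [DecidableEq ι] : Separates (fun x : 𝓗 => U x) := by
  intro α
  refine ⟨compVec U α, ?_⟩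
  filter_upwards [compVec_coe U α] with q hq
  exact ⟨_, by exact_mod_cast (Real.exp_pos _).ne', hq⟩

theorem separates_waveL [DecidableEq ι] :
    Separates (μ := (volume : Measure (ℝ × ℝ))) (fun ξ => waveL U ξ) :=
  (isProductRep_waveL U).separates (separates_rep U) (separates_rep U)

variable {U} {T : ℝ → 𝓗 →L[ℂ] 𝓗}

theorem waveL_translate (hT : ∀ t x, ∀ᵐ q : ℝ, U (T t x) q = phase t q • U x q) (t₁ t₂ : ℝ)
    [DecidableEq ι] :
    Acts (fun ξ => waveL U ξ) (fun ξ => hmap (T t₁) (T t₂) ξ)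
      (fun p => (phase t₁ p.1 * phase t₂ p.2) • (1 : Matrix (ι × ι) (ι × ι) ℂ)) id := by
  refine acts_of_htmul (Measure.QuasiMeasurePreserving.id _) fun x y => ?_
  have h1 := (Measure.quasiMeasurePreserving_fst (μ := (volume : Measure ℝ))
    (ν := (volume : Measure ℝ))).ae (hT t₁ x)
  have h2 := (Measure.quasiMeasurePreserving_snd (μ := (volume : Measure ℝ))
    (ν := (volume : Measure ℝ))).ae (hT t₂ y)
  have h3 := isProductRep_waveL U (T t₁ x) (T t₂ y)
  have h4 := isProductRep_waveL U x y
  filter_upwards [h1, h2, h3, h4] with p a1 a2 a3 a4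
  rw [hmap_htmul, Matrix.smul_mulVec, Matrix.one_mulVec]
  funext ⟨a, b⟩
  rw [a3, a1, a2, Pi.smul_apply, id, a4]
  simp only [PiLp.smul_apply, smul_eq_mul]
  ring

/-- Operators commuting with the translations are multiplication operators (weak form). -/
theorem sum_conj_mul_eq (hT : ∀ t x, ∀ᵐ q : ℝ, U (T t x) q = phase t q • U x q)
    {R : HTensor 𝓗 𝓗 →L[ℂ] HTensor 𝓗 𝓗}
    (hR : ∀ t₁ t₂ : ℝ, R ∘L hmap (T t₁) (T t₂) = hmap (T t₁) (T t₂) ∘L R) (ξ η : HTensor 𝓗 𝓗) :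
    ∀ᵐ p : ℝ × ℝ, ∑ a, conj (waveL U ξ p a) * waveL U (R η) p a =
      ∑ a, conj (waveL U (ContinuousLinearMap.adjoint R ξ) p a) * waveL U η p a := by
  classical
  have i1 := integrable_sum_conj_mul (waveL U ξ) (waveL U (R η))
  have i2 := integrable_sum_conj_mul (waveL U (ContinuousLinearMap.adjoint R ξ)) (waveL U η)
  have key : ∀ (t₁ t₂ : ℝ) (ξ η : HTensor 𝓗 𝓗), ∫ p : ℝ × ℝ, phase t₁ p.1 * phase t₂ p.2 *
      ∑ a, conj (waveL U ξ p a) * waveL U η p a = ⟪ξ, hmap (T t₁) (T t₂) η⟫_ℂ := by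
    intro t₁ t₂ ξ η
    rw [← inner_waveL U, inner_eq_integral_sum]
    refine integral_congr_ae ?_
    filter_upwards [waveL_translate hT t₁ t₂ η] with p hp
    simp only [hp, Matrix.smul_mulVec, Matrix.one_mulVec, Pi.smul_apply, smul_eq_mul, id,
      Finset.mul_sum]
    refine Finset.sum_congr rfl fun a _ => ?_
    ring
  -- Tested against the phases, both densities give the same number: ⟪ξ, T R η⟫ = ⟪ξ, R T η⟫ = ⟪R*
  -- ξ, T η⟫ for T = T(t₁) ⊗ T(t₂).
  have := ae_eq_zero_of_integral_phase (i1.sub i2) fun t₁ t₂ => by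
    simp only [Pi.sub_apply, mul_sub]
    rw [integral_sub (integrable_phase_mul i1 _ _) (integrable_phase_mul i2 _ _), key, key,
      ContinuousLinearMap.adjoint_inner_left, sub_eq_zero, ← ContinuousLinearMap.comp_apply,
      ← hR, ContinuousLinearMap.comp_apply]
  filter_upwards [this] with p hp
  exact sub_eq_zero.1 hp

/-- If χ is supported in the component a, with nowhere vanishing entry g there, the weak form reads
conj g · (R η)_a = ∑_b conj((R* χ)_b) η_b. Dividing by conj g exhibits row a of the multiplier as an
explicit measurable function. -/
theorem exists_acts_of_translation [DecidableEq ι]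
    (hT : ∀ t x, ∀ᵐ q : ℝ, U (T t x) q = phase t q • U x q)
    {R : HTensor 𝓗 𝓗 →L[ℂ] HTensor 𝓗 𝓗}
    (hR : ∀ t₁ t₂ : ℝ, R ∘L hmap (T t₁) (T t₂) = hmap (T t₁) (T t₂) ∘L R) :
    ∃ M : ℝ × ℝ → Matrix (ι × ι) (ι × ι) ℂ, (∀ a b, Measurable fun p => M p a b) ∧
      Acts (fun ξ => waveL U ξ) R M id := by
  choose χ hχ using separates_waveL U
  refine ⟨fun p => Matrix.of fun a b => conj (waveL U (ContinuousLinearMap.adjoint R (χ a)) p b) /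
    conj (waveL U (χ a) p a), fun a b => ?_, fun η => ?_⟩
  · refine Measurable.div ?_ ?_
    · exact (continuous_star.measurable).comp (stronglyMeasurable_coord _ b).measurable
    · exact (continuous_star.measurable).comp (stronglyMeasurable_coord _ a).measurable
  · filter_upwards [ae_all_iff.2 hχ, ae_all_iff.2 fun a => sum_conj_mul_eq hT hR (χ a) η]
      with p h1 h2
    funext a
    obtain ⟨g, hg, h3⟩ := h1 a
    have h4 := h2 a
    have h5 : ∀ c, waveL U (χ a) p c = (Pi.single a g : ι × ι → ℂ) c := fun c => congrFun h3 c
    simp only [h5] at h4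
    rw [Finset.sum_eq_single a (fun c _ hc => by simp [hc]) (by simp)] at h4
    simp only [Pi.single_eq_same] at h4
    simp only [Matrix.mulVec, dotProduct, Matrix.of_apply, h5, Pi.single_eq_same, id, div_mul_eq_mul_div]
    rw [← Finset.sum_div, ← h4]
    have : conj g ≠ 0 := by simpa using hg
    field_simp

/-- A multiplication operator commutes with the translations, so the weak form is available. Tested
on vectors separating the components it identifies the multiplier of the adjoint, without any bound
on M. -/
theorem Acts.adjoint [DecidableEq ι]
    (hT : ∀ t x, ∀ᵐ q : ℝ, U (T t x) q = phase t q • U x q)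
    {R : HTensor 𝓗 𝓗 →L[ℂ] HTensor 𝓗 𝓗} {M : ℝ × ℝ → Matrix (ι × ι) (ι × ι) ℂ}
    (h : Acts (fun ξ => waveL U ξ) R M id) :
    Acts (fun ξ => waveL U ξ) (ContinuousLinearMap.adjoint R) (fun p => (M p).conjTranspose)
      id := by
  have hR : ∀ t₁ t₂ : ℝ, R ∘L hmap (T t₁) (T t₂) = hmap (T t₁) (T t₂) ∘L R := by
    intro t₁ t₂
    apply DFunLike.coe_injective
    refine Acts.eq (injective_waveL U)
      (h.comp (waveL_translate hT t₁ t₂) (Measure.QuasiMeasurePreserving.id _))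
      ((waveL_translate hT t₁ t₂).comp h (Measure.QuasiMeasurePreserving.id _))
      (Eventually.of_forall fun p => ?_)
    simp
  intro ξ
  choose χ hχ using separates_waveL U
  filter_upwards [ae_all_iff.2 hχ, ae_all_iff.2 fun a => sum_conj_mul_eq hT hR ξ (χ a),
    ae_all_iff.2 fun a => h (χ a)] with p h1 h2 h3
  funext a
  obtain ⟨g, hg, h4⟩ := h1 a
  have h5 : ∀ c, waveL U (χ a) p c = (Pi.single a g : ι × ι → ℂ) c := fun c => congrFun h4 c
  have h6 : ∀ c, waveL U (R (χ a)) p c = M p c a * g := by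
    intro c
    have := congrFun (h3 a) c
    rw [this, id, h4, Matrix.mulVec_single]
    simp [mul_comm]
  have h7 := h2 a
  simp only [h5, h6] at h7
  rw [Finset.sum_eq_single a (s := Finset.univ)
    (f := fun c => conj (waveL U (ContinuousLinearMap.adjoint R ξ) p c) *
      (Pi.single a g : ι × ι → ℂ) c) (fun c _ hc => by simp [hc]) (by simp),
    Pi.single_eq_same] at h7
  simp only [← mul_assoc, ← Finset.sum_mul] at h7
  have h8 := congrArg conj (mul_right_cancel₀ hg h7)
  rw [Complex.conj_conj] at h8
  rw [← h8, map_sum]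
  simp only [Matrix.mulVec, dotProduct, Matrix.conjTranspose_apply, id, map_mul, Complex.conj_conj]
  refine Finset.sum_congr rfl fun c _ => ?_
  rw [mul_comm]
  rfl

end Commutant

/-! ### Functions of the difference of the rapidities -/

section Difference

/-- Null sets are preserved by the shear (q₁, q₂) ↦ (q₁ - q₂, q₂); Fubini then removes the second
coordinate. -/
theorem ae_sub_iff {P : ℝ → Prop} : (∀ᵐ p : ℝ × ℝ, P (p.1 - p.2)) ↔ ∀ᵐ q : ℝ, P q := by
  constructor
  · intro h
    have h1 := (measurePreserving_add_prod (volume : Measure ℝ)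
      (volume : Measure ℝ)).quasiMeasurePreserving.ae h
    filter_upwards [Measure.ae_ae_of_ae_prod h1] with q hq
    obtain ⟨s, hs⟩ := hq.exists
    simpa using hs
  · intro h
    exact (measurePreserving_sub_prod (volume : Measure ℝ)
      (volume : Measure ℝ)).quasiMeasurePreserving.ae
        (Measure.quasiMeasurePreserving_fst.ae h)

/-- In the coordinates (q₁ - q₂, q₂) the function is invariant under translation of the second
variable, but with an exceptional null set for each translation. Fubini exchanges the quantifiers,
and a generic slice then serves as S; being a slice, it is automatically measurable. -/
theorem exists_eq_comp_sub {κ : Type*} [Finite κ] {M : ℝ × ℝ → κ → ℂ}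
    (hm : ∀ a, Measurable fun p => M p a)
    (h : ∀ s : ℝ, ∀ᵐ p : ℝ × ℝ, M (p.1 - s, p.2 - s) = M p) :
    ∃ S : ℝ → κ → ℂ, (∀ a, Measurable fun q => S q a) ∧ ∀ᵐ p : ℝ × ℝ, M p = S (p.1 - p.2) := by
  have hM : Measurable M := measurable_pi_iff.2 hm
  set N : ℝ × ℝ → κ → ℂ := fun x => M (x.1 + x.2, x.2) with hN
  have hNm : Measurable N := hM.comp (by fun_prop)
  have h1 : ∀ s : ℝ, ∀ᵐ x : ℝ × ℝ, N (x.1, x.2 - s) = N x := by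
    intro s
    filter_upwards [(measurePreserving_add_prod (volume : Measure ℝ)
      (volume : Measure ℝ)).quasiMeasurePreserving.ae (h s)] with x hx
    simp only [hN]
    rw [← hx]
    congr 2
    ring
  have h2 : ∀ᵐ x : ℝ × ℝ, ∀ᵐ s : ℝ, N (x.1, x.2 - s) = N x := by
    refine (Measure.ae_ae_comm ?_).1 (Eventually.of_forall h1)
    exact measurableSet_eq_fun (hNm.comp (by fun_prop)) (hNm.comp (by fun_prop))
  have h3 : ∀ᵐ x : ℝ × ℝ, ∀ᵐ s : ℝ, N (x.1, s) = N x := by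
    filter_upwards [h2] with x hx
    filter_upwards [(quasiMeasurePreserving_sub_left (volume : Measure ℝ) x.2).ae hx] with s hs
    simpa using hs
  have h4 : ∀ᵐ s : ℝ, ∀ᵐ x : ℝ × ℝ, N (x.1, s) = N x := by
    refine (Measure.ae_ae_comm ?_).1 h3
    exact measurableSet_eq_fun (hNm.comp (by fun_prop)) (hNm.comp (by fun_prop))
  obtain ⟨s, hs⟩ := h4.exists
  refine ⟨fun q => N (q, s), fun a => ?_, ?_⟩
  · exact (measurable_pi_apply a).comp (hNm.comp (by fun_prop))
  · filter_upwards [(measurePreserving_sub_prod (volume : Measure ℝ)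
      (volume : Measure ℝ)).quasiMeasurePreserving.ae hs] with p hp
    rw [hp]
    simp [hN]

variable {ι : Type*}

/-- The matrix-valued multiplier `(q₁, q₂) ↦ (S^{βα}_{γδ}(q₁ - q₂))`. -/
def diffMatrix (S : ℝ → Matrix (ι × ι) (ι × ι) ℂ) (p : ℝ × ℝ) : Matrix (ι × ι) (ι × ι) ℂ :=
  (S (p.1 - p.2)).submatrix Prod.swap id

variable [Fintype ι] {𝓗 : Type*} [NormedAddCommGroup 𝓗] [InnerProductSpace ℂ 𝓗]
  {U : 𝓗 ≃ₗᵢ[ℂ] L2R ι} {R : HTensor 𝓗 𝓗 →L[ℂ] HTensor 𝓗 𝓗}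

theorem comesFrom_iff_acts {S : ℝ → Matrix (ι × ι) (ι × ι) ℂ} :
    ComesFrom U R S ↔ Acts (fun ξ => waveL U ξ) R (diffMatrix S) id := by
  refine forall_congr' fun ξ => eventually_congr (Eventually.of_forall fun p => ?_)
  rw [funext_iff, Prod.forall]
  refine forall_congr' fun α => forall_congr' fun β => ?_
  simp only [Matrix.mulVec, dotProduct, Fintype.sum_prod_type, diffMatrix, Matrix.submatrix_apply,
    Prod.swap_prod_mk, id, wave_eq]

theorem measurePreserving_sub_sub (s : ℝ) : MeasurePreserving (fun p : ℝ × ℝ => (p.1 - s, p.2 - s))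
    volume volume :=
  (measurePreserving_sub_right volume s).prod (measurePreserving_sub_right volume s)

theorem acts_hmap_modGroup [DecidableEq ι] (t : ℝ) :
    Acts (fun ξ => waveL U ξ) (fun ξ => hmap (modGroup U t) (modGroup U t) ξ) (fun _ => 1)
      (fun p => (p.1 - 2 * Real.pi * t, p.2 - 2 * Real.pi * t)) := by
  have hσ := (measurePreserving_sub_sub (2 * Real.pi * t)).quasiMeasurePreserving
  refine acts_of_htmul hσ fun x y => ?_
  have h1 := translateL2_coe t (U x)
  have h2 := translateL2_coe t (U y)
  filter_upwards [(Measure.quasiMeasurePreserving_fst (μ := (volume : Measure ℝ))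
    (ν := (volume : Measure ℝ))).ae h1, (Measure.quasiMeasurePreserving_snd
    (μ := (volume : Measure ℝ)) (ν := (volume : Measure ℝ))).ae h2,
    isProductRep_waveL U (modGroup U t x) (modGroup U t y), hσ.ae (isProductRep_waveL U x y)]
    with p a1 a2 a3 a4
  rw [hmap_htmul, Matrix.one_mulVec]
  funext ⟨a, b⟩
  rw [a3, a4, apply_modGroup, apply_modGroup, a1, a2]

theorem commute_modGroup [DecidableEq ι] {S : ℝ → Matrix (ι × ι) (ι × ι) ℂ}
    (h : ComesFrom U R S) (t : ℝ) :
    R ∘L hmap (modGroup U t) (modGroup U t) = hmap (modGroup U t) (modGroup U t) ∘L R := by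
  rw [comesFrom_iff_acts] at h
  have h1 := h.comp (acts_hmap_modGroup t) (Measure.QuasiMeasurePreserving.id _)
  have h2 := (acts_hmap_modGroup t).comp h
    (measurePreserving_sub_sub (2 * Real.pi * t)).quasiMeasurePreserving
  refine DFunLike.coe_injective (Acts.eq (injective_waveL U) h1 h2
    (Eventually.of_forall fun p => ?_))
  simp [diffMatrix]

theorem commute_translation [DecidableEq ι] {T : ℝ → 𝓗 →L[ℂ] 𝓗}
    (hT : ∀ t x, ∀ᵐ q : ℝ, U (T t x) q = phase t q • U x q)
    {M : ℝ × ℝ → Matrix (ι × ι) (ι × ι) ℂ}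
    (h : Acts (fun ξ => waveL U ξ) R M id) (t₁ t₂ : ℝ) :
    R ∘L hmap (T t₁) (T t₂) = hmap (T t₁) (T t₂) ∘L R := by
  apply DFunLike.coe_injective
  refine Acts.eq (injective_waveL U)
    (h.comp (waveL_translate hT t₁ t₂) (Measure.QuasiMeasurePreserving.id _))
    ((waveL_translate hT t₁ t₂).comp h (Measure.QuasiMeasurePreserving.id _))
    (Eventually.of_forall fun p => ?_)
  simp

theorem exists_comesFrom [DecidableEq ι] {T : ℝ → 𝓗 →L[ℂ] 𝓗}
    (hT : ∀ t x, ∀ᵐ q : ℝ, U (T t x) q = phase t q • U x q)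
    (hR : ∀ t₁ t₂ : ℝ, R ∘L hmap (T t₁) (T t₂) = hmap (T t₁) (T t₂) ∘L R)
    (hD : ∀ t, R ∘L hmap (modGroup U t) (modGroup U t) =
      hmap (modGroup U t) (modGroup U t) ∘L R) :
    ∃ S : ℝ → Matrix (ι × ι) (ι × ι) ℂ, (∀ a b, Measurable fun q => S q a b) ∧
      ComesFrom U R S := by
  obtain ⟨M, hMm, hM⟩ := exists_acts_of_translation hT hR
  have hinv : ∀ s : ℝ, ∀ᵐ p : ℝ × ℝ, M (p.1 - s, p.2 - s) = M p := by
    intro s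
    -- The modular parameter s/(2π) translates both rapidities by s.
    have hs : 2 * Real.pi * (s / (2 * Real.pi)) = s := by
      field_simp
    have h1 := hM.comp (acts_hmap_modGroup (s / (2 * Real.pi)))
      (Measure.QuasiMeasurePreserving.id _)
    have h2 := (acts_hmap_modGroup (s / (2 * Real.pi))).comp hM
      (measurePreserving_sub_sub _).quasiMeasurePreserving
    have h3 : (R ∘ fun ξ => hmap (modGroup U (s / (2 * Real.pi)))
        (modGroup U (s / (2 * Real.pi))) ξ) =
        (fun ξ => hmap (modGroup U (s / (2 * Real.pi))) (modGroup U (s / (2 * Real.pi))) ξ) ∘ R :=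
      congrArg DFunLike.coe (hD (s / (2 * Real.pi)))
    rw [h3] at h1
    filter_upwards [Acts.matrix_ae_eq (separates_waveL U)
      (measurePreserving_sub_sub _).quasiMeasurePreserving h1 h2] with p hp
    rw [hs] at hp
    simpa using hp.symm
  obtain ⟨S, hSm, hS⟩ := exists_eq_comp_sub (κ := (ι × ι) × (ι × ι))
    (M := fun p ab => M p ab.1 ab.2) (fun ab => hMm ab.1 ab.2) (by
      intro s
      filter_upwards [hinv s] with p hp
      rw [hp])
  -- The upper indices of the scattering matrix are in reversed order relative to those of the wave
  -- function.
  refine ⟨fun q => Matrix.of fun a b => S q (a.swap, b), fun a b => hSm _, ?_⟩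
  rw [comesFrom_iff_acts]
  refine hM.congr ?_
  filter_upwards [hS] with p hp
  ext a b
  simp only [diffMatrix, Matrix.submatrix_apply, Matrix.of_apply, Prod.swap_swap, id]
  exact congrFun hp (a, b)

variable [DecidableEq ι] {S : ℝ → Matrix (ι × ι) (ι × ι) ℂ}

theorem diffMatrix_mul_conjTranspose (p : ℝ × ℝ) :
    diffMatrix S p * (diffMatrix S p).conjTranspose = 1 ↔
      S (p.1 - p.2) * (S (p.1 - p.2)).conjTranspose = 1 := by
  have h1 : (diffMatrix S p).conjTranspose =
      ((S (p.1 - p.2)).conjTranspose).submatrix id Prod.swap := rfl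
  have h2 : diffMatrix S p * (diffMatrix S p).conjTranspose =
      (S (p.1 - p.2) * (S (p.1 - p.2)).conjTranspose).submatrix Prod.swap Prod.swap := by
    rw [h1]
    rfl
  rw [h2]
  constructor
  · intro h
    have := congrArg (fun A : Matrix (ι × ι) (ι × ι) ℂ => A.submatrix Prod.swap Prod.swap) h
    simp only [Matrix.submatrix_submatrix, Prod.swap_swap_eq, Matrix.submatrix_id_id] at this
    rw [this]
    exact Matrix.submatrix_one _ Prod.swap_injective
  · intro h
    rw [h]
    exact Matrix.submatrix_one _ Prod.swap_injective

/-- The pattern shared by the conditions below: an operator identity gives a matrix identity because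
multipliers are unique, and the converse holds because wave functions determine vectors. For square
matrices one of the two one-sided relations suffices. -/
theorem unitary_iff {T : ℝ → 𝓗 →L[ℂ] 𝓗}
    (hT : ∀ t x, ∀ᵐ q : ℝ, U (T t x) q = phase t q • U x q) (h : ComesFrom U R S) :
    R ∈ unitary (HTensor 𝓗 𝓗 →L[ℂ] HTensor 𝓗 𝓗) ↔
      ∀ᵐ q : ℝ, S q ∈ Matrix.unitaryGroup (ι × ι) ℂ := by
  rw [comesFrom_iff_acts] at h
  have hid := Measure.QuasiMeasurePreserving.id (volume : Measure (ℝ × ℝ))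
  have hadj := Acts.adjoint hT h
  have h1 : Acts (fun ξ => waveL U ξ) (id : HTensor 𝓗 𝓗 → HTensor 𝓗 𝓗) (fun _ => 1) id :=
    fun ξ => Eventually.of_forall fun p => by simp
  have e : (∀ᵐ q : ℝ, S q ∈ Matrix.unitaryGroup (ι × ι) ℂ) ↔
      ∀ᵐ p : ℝ × ℝ, diffMatrix S p * (diffMatrix S p).conjTranspose = 1 := by
    rw [← ae_sub_iff]
    refine eventually_congr (Eventually.of_forall fun p => ?_)
    rw [diffMatrix_mul_conjTranspose, Matrix.mem_unitaryGroup_iff]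
    rfl
  rw [e, Unitary.mem_iff, ContinuousLinearMap.star_eq_adjoint]
  constructor
  · rintro ⟨-, h2⟩
    have h3 := h.comp hadj hid
    have h4 : (R ∘ ContinuousLinearMap.adjoint R : HTensor 𝓗 𝓗 → HTensor 𝓗 𝓗) = id :=
      congrArg DFunLike.coe h2
    rw [h4] at h3
    exact Acts.matrix_ae_eq (separates_waveL U) hid h3 h1
  · intro h2
    constructor
    · apply DFunLike.coe_injective
      refine Acts.eq (injective_waveL U) (hadj.comp h hid) h1 ?_
      filter_upwards [h2] with p hp
      exact mul_eq_one_comm.1 hp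
    · apply DFunLike.coe_injective
      exact Acts.eq (injective_waveL U) (h.comp hadj hid) h1 h2

theorem acts_hflip : Acts (fun ξ => waveL U ξ) (fun ξ : HTensor 𝓗 𝓗 => hflip ξ)
    (fun _ => (1 : Matrix (ι × ι) (ι × ι) ℂ).submatrix Prod.swap id) Prod.swap := by
  have hσ := (Measure.measurePreserving_swap (μ := (volume : Measure ℝ))
    (ν := (volume : Measure ℝ))).quasiMeasurePreserving
  refine acts_of_htmul hσ fun x y => ?_
  filter_upwards [isProductRep_waveL U y x, hσ.ae (isProductRep_waveL U x y)] with p a1 a2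
  rw [hflip_htmul]
  funext ⟨a, b⟩
  have : (1 : Matrix (ι × ι) (ι × ι) ℂ).submatrix Prod.swap id =
      (1 : Matrix (ι × ι) (ι × ι) ℂ).submatrix (Equiv.prodComm ι ι) (Equiv.refl _) := rfl
  rw [a1, this, Matrix.submatrix_mulVec_equiv]
  simp only [Equiv.refl_symm, Equiv.coe_refl, Function.comp_id, Matrix.one_mulVec,
    Function.comp_apply, Equiv.prodComm_apply, Prod.swap_prod_mk]
  rw [a2]
  simp [mul_comm]

/-- Conjugation with the flip exchanges q₁ and q₂, hence reverses the sign of the argument of S, and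
permutes the indices; the adjoint gives the conjugate transpose. -/
theorem reflection_iff {T : ℝ → 𝓗 →L[ℂ] 𝓗}
    (hT : ∀ t x, ∀ᵐ q : ℝ, U (T t x) q = phase t q • U x q) (h : ComesFrom U R S) :
    hflip ∘L R ∘L hflip = ContinuousLinearMap.adjoint R ↔
      ∀ᵐ q : ℝ, S (-q) = (S q).conjTranspose := by
  rw [comesFrom_iff_acts] at h
  have hid := Measure.QuasiMeasurePreserving.id (volume : Measure (ℝ × ℝ))
  have hσ := (Measure.measurePreserving_swap (μ := (volume : Measure ℝ))
    (ν := (volume : Measure ℝ))).quasiMeasurePreserving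
  have hadj := Acts.adjoint hT h
  have h1 := (acts_hflip (U := U)).comp (h.comp acts_hflip hid) hσ
  have hs : ((Prod.swap ∘ id) ∘ Prod.swap : ℝ × ℝ → ℝ × ℝ) = id := by
    funext p
    simp
  rw [hs] at h1
  have e : (∀ᵐ q : ℝ, S (-q) = (S q).conjTranspose) ↔ ∀ᵐ p : ℝ × ℝ,
      (1 : Matrix (ι × ι) (ι × ι) ℂ).submatrix Prod.swap id *
        (diffMatrix S p.swap * (1 : Matrix (ι × ι) (ι × ι) ℂ).submatrix Prod.swap id) =
      (diffMatrix S p).conjTranspose := by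
    rw [← ae_sub_iff]
    refine eventually_congr (Eventually.of_forall fun p => ?_)
    have e1 : (1 : Matrix (ι × ι) (ι × ι) ℂ).submatrix Prod.swap id *
        (diffMatrix S p.swap * (1 : Matrix (ι × ι) (ι × ι) ℂ).submatrix Prod.swap id) =
        (S (-(p.1 - p.2))).submatrix id Prod.swap := by
      ext ⟨a, b⟩ ⟨c, d⟩
      simp [Matrix.mul_apply, Matrix.one_apply, diffMatrix, Fintype.sum_prod_type,
        Prod.ext_iff, ite_and]
    rw [e1]
    have e2 : (diffMatrix S p).conjTranspose =
      ((S (p.1 - p.2)).conjTranspose).submatrix id Prod.swap := rfl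
    rw [e2]
    constructor
    · intro h
      rw [h]
    · intro h
      have := congrArg (fun A : Matrix (ι × ι) (ι × ι) ℂ => A.submatrix id Prod.swap) h
      simpa only [Matrix.submatrix_submatrix, Prod.swap_swap_eq, Matrix.submatrix_id_id,
        Function.comp_id] using this
  rw [e]
  constructor
  · intro h2
    have h3 : ((fun ξ : HTensor 𝓗 𝓗 => hflip ξ) ∘ (R ∘ fun ξ => hflip ξ) :
        HTensor 𝓗 𝓗 → HTensor 𝓗 𝓗) = ContinuousLinearMap.adjoint R := congrArg DFunLike.coe h2
    rw [h3] at h1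
    exact Acts.matrix_ae_eq (separates_waveL U) hid h1 hadj
  · intro h2
    apply DFunLike.coe_injective
    exact Acts.eq (injective_waveL U) h1 hadj h2

variable {bar : ι → ι} (hbar : Function.Involutive bar)

omit [DecidableEq ι] in
-- An antilinear operator does not fit `Acts`, so the density argument is repeated for it.
theorem waveL_hmapAnti (ξ : HTensor 𝓗 𝓗) : ∀ᵐ p : ℝ × ℝ,
    waveL U (hmapAnti (modConj U hbar) (modConj U hbar) ξ) p =
      WithLp.toLp 2 fun c => conj (waveL U ξ p (bar c.1, bar c.2)) := by
  have hσ := Measure.QuasiMeasurePreserving.id (volume : Measure (ℝ × ℝ))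
  refine htensor_induction (P := fun ξ => ∀ᵐ p : ℝ × ℝ,
    waveL U (hmapAnti (modConj U hbar) (modConj U hbar) ξ) p =
      WithLp.toLp 2 fun c => conj (waveL U ξ p (bar c.1, bar c.2))) ?_ ?_ ?_ ξ
  · exact isClosed_setOf_ae_eq (A := fun ξ => waveL U ξ)
      (B := fun ξ => waveL U (hmapAnti (modConj U hbar) (modConj U hbar) ξ)) (waveL U).continuous
      ((waveL U).continuous.comp (ContinuousLinearMap.continuous _)) hσ
      (L := fun _ v => WithLp.toLp 2 fun c => conj (v (bar c.1, bar c.2)))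
      fun p => by fun_prop
  · intro x y
    rw [hmapAnti_htmul]
    filter_upwards [isProductRep_waveL U x y,
      isProductRep_waveL U (modConj U hbar x) (modConj U hbar y),
      (Measure.quasiMeasurePreserving_fst (μ := (volume : Measure ℝ))
        (ν := (volume : Measure ℝ))).ae (modConj_coe U hbar x),
      (Measure.quasiMeasurePreserving_snd (μ := (volume : Measure ℝ))
        (ν := (volume : Measure ℝ))).ae (modConj_coe U hbar y)] with p a1 a2 a3 a4
    ext ⟨a, b⟩
    simp only [a1, a2, a3, a4, map_mul]
  · intro ξ η h1 h2
    rw [map_add, map_add, map_add]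
    filter_upwards [h1, h2, Lp.coeFn_add (waveL U ξ) (waveL U η),
      Lp.coeFn_add (waveL U (hmapAnti (modConj U hbar) (modConj U hbar) ξ))
        (waveL U (hmapAnti (modConj U hbar) (modConj U hbar) η))] with p a1 a2 a3 a4
    rw [a4, Pi.add_apply, a1, a2, a3]
    ext c
    simp

omit [DecidableEq ι] in
theorem hmapAnti_hmapAnti (ξ : HTensor 𝓗 𝓗) :
    hmapAnti (modConj U hbar) (modConj U hbar)
      (hmapAnti (modConj U hbar) (modConj U hbar) ξ) = ξ := by
  apply injective_waveL U
  refine Lp.ext ?_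
  filter_upwards [waveL_hmapAnti (U := U) hbar ξ, waveL_hmapAnti (U := U) hbar
    (hmapAnti (modConj U hbar) (modConj U hbar) ξ)] with p h1 h2
  rw [h2, h1]
  ext c
  simp [hbar _]

/-- With the involution Θ = J ⊗ J the condition reads Θ R Θ = R*. The left side is linear again and
multiplies by the complex conjugate entries with barred indices; the remaining conjugations cancel
against the adjoint. -/
theorem tcp_iff {T : ℝ → 𝓗 →L[ℂ] 𝓗}
    (hT : ∀ t x, ∀ᵐ q : ℝ, U (T t x) q = phase t q • U x q) (h : ComesFrom U R S) :
    (∀ ξ, R (hmapAnti (modConj U hbar) (modConj U hbar) ξ) =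
      hmapAnti (modConj U hbar) (modConj U hbar) (ContinuousLinearMap.adjoint R ξ)) ↔
      ∀ᵐ q : ℝ, ∀ α β γ δ : ι, S q (α, β) (γ, δ) = S q (bar δ, bar γ) (bar β, bar α) := by
  rw [comesFrom_iff_acts] at h
  have hid := Measure.QuasiMeasurePreserving.id (volume : Measure (ℝ × ℝ))
  have hadj := Acts.adjoint hT h
  set Θ : HTensor 𝓗 𝓗 → HTensor 𝓗 𝓗 := fun ξ => hmapAnti (modConj U hbar) (modConj U hbar) ξ with hΘ
  have hinv : ∀ ξ, Θ (Θ ξ) = ξ := hmapAnti_hmapAnti hbar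
  have h1 : Acts (fun ξ => waveL U ξ) (Θ ∘ R ∘ Θ)
      (fun p => Matrix.of fun a c =>
        conj (diffMatrix S p (bar a.1, bar a.2) (bar c.1, bar c.2))) id := by
    intro ξ
    filter_upwards [waveL_hmapAnti (U := U) hbar ξ, waveL_hmapAnti (U := U) hbar (R (Θ ξ)),
      h (Θ ξ)] with p a1 a2 a3
    have a1' : waveL U (Θ ξ) p =
      WithLp.toLp 2 fun c => conj (waveL U ξ p (bar c.1, bar c.2)) := a1
    have a2' : waveL U (Θ (R (Θ ξ))) p =
      WithLp.toLp 2 fun c => conj (waveL U (R (Θ ξ)) p (bar c.1, bar c.2)) := a2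
    simp only [Function.comp_apply]
    rw [a2']
    funext c
    simp only [a3, id, a1', Matrix.mulVec, dotProduct, map_sum, map_mul, Complex.conj_conj,
      Matrix.of_apply]
    let e : Equiv.Perm (ι × ι) := (hbar.toPerm bar).prodCongr (hbar.toPerm bar)
    refine (Equiv.sum_comp e _).symm.trans ?_
    refine Finset.sum_congr rfl fun d _ => ?_
    simp [e, hbar _, Prod.map]
  have e : (∀ᵐ q : ℝ, ∀ α β γ δ : ι, S q (α, β) (γ, δ) = S q (bar δ, bar γ) (bar β, bar α)) ↔
      ∀ᵐ p : ℝ × ℝ, (Matrix.of fun a c =>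
        conj (diffMatrix S p (bar a.1, bar a.2) (bar c.1, bar c.2)) :
          Matrix (ι × ι) (ι × ι) ℂ) = (diffMatrix S p).conjTranspose := by
    rw [← ae_sub_iff]
    refine eventually_congr (Eventually.of_forall fun p => ?_)
    constructor
    · intro h
      ext ⟨a, b⟩ ⟨c, d⟩
      simp only [Matrix.of_apply, diffMatrix, Matrix.submatrix_apply, Prod.swap_prod_mk, id,
        Matrix.conjTranspose_apply]
      rw [h, hbar, hbar, hbar, hbar]
      rfl
    · intro h α β γ δ
      have h2 := congrFun (congrFun h (bar β, bar α)) (bar γ, bar δ)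
      simp only [Matrix.of_apply, diffMatrix, Matrix.submatrix_apply, Prod.swap_prod_mk, id,
        Matrix.conjTranspose_apply, hbar _] at h2
      exact star_injective h2
  rw [e]
  change (∀ ξ, R (Θ ξ) = Θ (ContinuousLinearMap.adjoint R ξ)) ↔ _
  have e2 : (∀ ξ, R (Θ ξ) = Θ (ContinuousLinearMap.adjoint R ξ)) ↔
      Θ ∘ R ∘ Θ = ContinuousLinearMap.adjoint R := by
    constructor
    · intro h
      funext ξ
      simp only [Function.comp_apply, h, hinv]
    · intro h ξ
      rw [← h]
      simp only [Function.comp_apply, hinv]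
  rw [e2]
  constructor
  · intro h2
    rw [h2] at h1
    exact Acts.matrix_ae_eq (separates_waveL U) hid h1 hadj
  · intro h2
    exact Acts.eq (injective_waveL U) h1 hadj h2

end Difference

/-! ### The threefold tensor product and the Yang–Baxter equation -/

section YangBaxter

/-! ### Wave functions on products of representations -/

section ProductRep

variable {E F : Type*} [NormedAddCommGroup E] [InnerProductSpace ℂ E]
  [NormedAddCommGroup F] [InnerProductSpace ℂ F] {X Y κ κ' : Type*} [Fintype κ] [Fintype κ']
  [MeasurableSpace X] [MeasurableSpace Y] {μ : Measure X} {ν : Measure Y}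

theorem memLp_mul_prod (f : Lp (EuclideanSpace ℂ κ) 2 μ) (g : Lp (EuclideanSpace ℂ κ') 2 ν) :
    MemLp (fun p : X × Y => (WithLp.toLp 2 fun ab : κ × κ' => f p.1 ab.1 * g p.2 ab.2 :
      EuclideanSpace ℂ (κ × κ'))) 2 (μ.prod ν) := by
  have hf := Lp.memLp f
  have hg := Lp.memLp g
  have hm : AEStronglyMeasurable (fun p : X × Y => (WithLp.toLp 2 fun ab : κ × κ' =>
      f p.1 ab.1 * g p.2 ab.2 : EuclideanSpace ℂ (κ × κ'))) (μ.prod ν) := by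
    have hc : Continuous fun v : EuclideanSpace ℂ κ × EuclideanSpace ℂ κ' =>
        (WithLp.toLp 2 fun ab : κ × κ' => v.1 ab.1 * v.2 ab.2 : EuclideanSpace ℂ (κ × κ')) := by
      fun_prop
    exact hc.comp_aestronglyMeasurable (hf.1.comp_fst.prodMk hg.1.comp_snd)
  rw [memLp_two_iff_integrable_sq_norm hm]
  have := (hf.integrable_norm_pow (by norm_num)).mul_prod (hg.integrable_norm_pow (by norm_num))
  refine this.congr (Eventually.of_forall fun p => ?_)
  simp only [EuclideanSpace.norm_sq_eq, norm_mul, Fintype.sum_prod_type, Finset.sum_mul_sum,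
    mul_pow]

variable [SFinite μ] [SFinite ν]

/-- Applied to the two-particle wave functions and `U`, this provides three-particle wave functions,
in which all operators in the Yang–Baxter equation are multiplications. -/
theorem exists_isProductRep (A : E →ₗ[ℂ] Lp (EuclideanSpace ℂ κ) 2 μ)
    (B : F →ₗ[ℂ] Lp (EuclideanSpace ℂ κ') 2 ν) (hA : ∀ x x', ⟪A x, A x'⟫_ℂ = ⟪x, x'⟫_ℂ)
    (hB : ∀ y y', ⟪B y, B y'⟫_ℂ = ⟪y, y'⟫_ℂ) :
    ∃ V : HTensor E F →L[ℂ] Lp (EuclideanSpace ℂ (κ × κ')) 2 (μ.prod ν),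
      IsProductRep V A B := by
  let m : E → F → Lp (EuclideanSpace ℂ (κ × κ')) 2 (μ.prod ν) := fun x y =>
    (memLp_mul_prod (A x) (B y)).toLp _
  have hm : ∀ x y, ∀ᵐ p ∂(μ.prod ν), m x y p =
      WithLp.toLp 2 fun ab : κ × κ' => A x p.1 ab.1 * B y p.2 ab.2 := fun x y =>
    MemLp.coeFn_toLp _
  have q1 := Measure.quasiMeasurePreserving_fst (μ := μ) (ν := ν)
  have q2 := Measure.quasiMeasurePreserving_snd (μ := μ) (ν := ν)
  let b : E →ₗ[ℂ] F →ₗ[ℂ] Lp (EuclideanSpace ℂ (κ × κ')) 2 (μ.prod ν) := LinearMap.mk₂ ℂ m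
    (by
      intro x x' y
      refine Lp.ext ?_
      filter_upwards [hm (x + x') y, hm x y, hm x' y, Lp.coeFn_add (m x y) (m x' y),
        q1.ae (Lp.coeFn_add (A x) (A x'))] with p h1 h2 h3 h4 h5
      rw [h1, h4, Pi.add_apply, h2, h3, map_add, h5]
      ext ab
      simp [add_mul])
    (by
      intro c x y
      refine Lp.ext ?_
      filter_upwards [hm (c • x) y, hm x y, Lp.coeFn_smul c (m x y),
        q1.ae (Lp.coeFn_smul c (A x))] with p h1 h2 h3 h4
      rw [h1, h3, Pi.smul_apply, h2, map_smul, h4]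
      ext ab
      simp [mul_assoc])
    (by
      intro x y y'
      refine Lp.ext ?_
      filter_upwards [hm x (y + y'), hm x y, hm x y', Lp.coeFn_add (m x y) (m x y'),
        q2.ae (Lp.coeFn_add (B y) (B y'))] with p h1 h2 h3 h4 h5
      rw [h1, h4, Pi.add_apply, h2, h3, map_add, h5]
      ext ab
      simp [mul_add])
    (by
      intro c x y
      refine Lp.ext ?_
      filter_upwards [hm x (c • y), hm x y, Lp.coeFn_smul c (m x y),
        q2.ae (Lp.coeFn_smul c (B y))] with p h1 h2 h3 h4
      rw [h1, h3, Pi.smul_apply, h2, map_smul, h4]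
      ext ab
      simp [mul_left_comm])
  have hb : ∀ x y x' y', ⟪b x y, b x' y'⟫_ℂ = ⟪x, x'⟫_ℂ * ⟪y, y'⟫_ℂ := by
    intro x y x' y'
    rw [← hA, ← hB, L2.inner_def, L2.inner_def, L2.inner_def, ← integral_prod_mul]
    refine integral_congr_ae ?_
    filter_upwards [hm x y, hm x' y'] with p h1 h2
    simp only [b, LinearMap.mk₂_apply]
    rw [h1, h2]
    simp only [PiLp.inner_apply, RCLike.inner_apply, map_mul, Fintype.sum_prod_type,
      Finset.sum_mul_sum]
    refine Finset.sum_congr rfl fun a _ => Finset.sum_congr rfl fun b _ => ?_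
    ring
  have hlift : ∀ s t : E ⊗[ℂ] F, ⟪TensorProduct.lift b s, TensorProduct.lift b t⟫_ℂ =
      ⟪s, t⟫_ℂ := by
    intro s t
    induction s with
    | zero => simp
    | tmul x y =>
      induction t with
      | zero => simp
      | tmul x' y' => simp [hb]
      | add t₁ t₂ h₁ h₂ => simp only [map_add, inner_add_right, h₁, h₂]
    | add s₁ s₂ h₁ h₂ => simp only [map_add, inner_add_left, h₁, h₂]
  refine ⟨(((TensorProduct.lift b).isometryOfInner hlift).toContinuousLinearMap).extend
    UniformSpace.Completion.toComplL, fun x y => ?_⟩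
  have h1 : (((TensorProduct.lift b).isometryOfInner hlift).toContinuousLinearMap).extend
      UniformSpace.Completion.toComplL (htmul x y) = m x y :=
    ContinuousLinearMap.extend_eq _ denseRange_toComplL isUniformInducing_toComplL (x ⊗ₜ[ℂ] y)
  rw [h1]
  filter_upwards [hm x y] with p hp a b
  rw [hp]

theorem IsProductRep.acts_hmap_id {G : Type*} [NormedAddCommGroup G] [InnerProductSpace ℂ G]
    [DecidableEq κ'] {A : E → Lp (EuclideanSpace ℂ κ) 2 μ}
    {B : G → Lp (EuclideanSpace ℂ κ') 2 ν}
    {V : HTensor E G →L[ℂ] Lp (EuclideanSpace ℂ (κ × κ')) 2 (μ.prod ν)}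
    (hV : IsProductRep V A B) {R : E →L[ℂ] E} {M : X → Matrix κ κ ℂ} {σ : X → X}
    (hσ : MeasurePreserving σ μ μ) (h : Acts A R M σ) :
    Acts V (fun ξ => hmap R (ContinuousLinearMap.id ℂ G) ξ)
      (fun p => Matrix.kroneckerMap (· * ·) (M p.1) (1 : Matrix κ' κ' ℂ)) (Prod.map σ id) := by
  have hσ' := (hσ.prod (MeasurePreserving.id ν)).quasiMeasurePreserving
  refine acts_of_htmul hσ' fun x y => ?_
  rw [hmap_htmul, ContinuousLinearMap.id_apply]
  filter_upwards [hV (R x) y, hσ'.ae (hV x y),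
    (Measure.quasiMeasurePreserving_fst (μ := μ) (ν := ν)).ae (h x)] with p h1 h2 h3
  funext ⟨a, b⟩
  rw [h1, h3]
  simp only [Matrix.mulVec, dotProduct, Fintype.sum_prod_type, Matrix.kroneckerMap_apply, h2,
    Finset.sum_mul]
  refine Finset.sum_congr rfl fun c _ => ?_
  rw [Finset.sum_eq_single b (fun d _ hd => by simp [Matrix.one_apply_ne hd.symm]) (by simp)]
  simp [mul_assoc]

end ProductRep

/-- Exchange of the last two entries. -/
def swapLast {X : Type*} (p : (X × X) × X) : (X × X) × X := ((p.1.1, p.2), p.1.2)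

theorem measurePreserving_swapLast {X : Type*} [MeasurableSpace X] (μ : Measure X) [SFinite μ] :
    MeasurePreserving (swapLast (X := X)) ((μ.prod μ).prod μ) ((μ.prod μ).prod μ) :=
  (((measurePreserving_prodAssoc μ μ μ).symm).comp
    ((MeasurePreserving.id μ).prod Measure.measurePreserving_swap)).comp
    (measurePreserving_prodAssoc μ μ μ)

variable {ι : Type*} [Fintype ι] {𝓗 : Type*} [NormedAddCommGroup 𝓗] [InnerProductSpace ℂ 𝓗]
  {U : 𝓗 ≃ₗᵢ[ℂ] L2R ι} {R : HTensor 𝓗 𝓗 →L[ℂ] HTensor 𝓗 𝓗}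
  {W : HTensor (HTensor 𝓗 𝓗) 𝓗 →L[ℂ]
    Lp (EuclideanSpace ℂ ((ι × ι) × ι)) 2 (volume : Measure ((ℝ × ℝ) × ℝ))}

theorem measurePreserving_swapLast_real :
    MeasurePreserving (swapLast (X := ℝ)) (volume : Measure ((ℝ × ℝ) × ℝ)) volume :=
  measurePreserving_swapLast (volume : Measure ℝ)

theorem measurePreserving_prodMap_swap :
    MeasurePreserving (Prod.map Prod.swap id : (ℝ × ℝ) × ℝ → (ℝ × ℝ) × ℝ)
      (volume : Measure ((ℝ × ℝ) × ℝ)) volume :=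
  (Measure.measurePreserving_swap (μ := (volume : Measure ℝ)) (ν := (volume : Measure ℝ))).prod
    (MeasurePreserving.id (volume : Measure ℝ))

/-- The flip is known only on fully elementary tensors, so density is used twice: first for the
two-particle factor with the third vector fixed, then for the threefold product. -/
theorem acts_flip23 [DecidableEq ι]
    (hW : IsProductRep (μ := volume) (ν := volume) W (fun ξ => waveL U ξ) U) :
    Acts (fun ξ => W ξ) (fun ξ => flip23 ξ)
      (fun _ => (1 : Matrix ((ι × ι) × ι) ((ι × ι) × ι) ℂ).submatrix swapLast id) swapLast := by
  have hσ := measurePreserving_swapLast_real.quasiMeasurePreserving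
  have hq := (Measure.quasiMeasurePreserving_fst (μ := (volume : Measure (ℝ × ℝ)))
    (ν := (volume : Measure ℝ)))
  have hmul : ∀ v : (ι × ι) × ι → ℂ,
      ((1 : Matrix ((ι × ι) × ι) ((ι × ι) × ι) ℂ).submatrix swapLast id).mulVec v =
        v ∘ swapLast := by
    intro v
    funext a
    simp [Matrix.mulVec, dotProduct, Matrix.one_apply]
  refine acts_of_htmul hσ fun ξ z => ?_
  simp only [hmul]
  have key : ∀ ξ : HTensor 𝓗 𝓗, ∀ᵐ p : (ℝ × ℝ) × ℝ, W (flip23 (htmul ξ z)) p =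
      WithLp.toLp 2 ((W (htmul ξ z) (swapLast p)).ofLp ∘ swapLast) := by
    refine htensor_induction ?_ (fun x y => ?_) fun ξ η h1 h2 => ?_
    · exact isClosed_setOf_ae_eq (A := fun ξ => W (htmul ξ z))
        (B := fun ξ => W (flip23 (htmul ξ z))) (W.continuous.comp (continuous_htmul_left z))
        (W.continuous.comp ((ContinuousLinearMap.continuous _).comp (continuous_htmul_left z)))
        hσ (L := fun _ v => WithLp.toLp 2 (v.ofLp ∘ swapLast))
        fun p => by
          simp only [Function.comp_def]
          fun_prop
    · rw [flip23_htmul]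
      have h1 := hW (htmul x z) y
      have h2 := hσ.ae (hW (htmul x y) z)
      have h3 := hq.ae (isProductRep_waveL U x z)
      have h4 := hσ.ae (hq.ae (isProductRep_waveL U x y))
      filter_upwards [h1, h2, h3, h4] with p a1 a2 a3 a4
      ext ⟨⟨a, b⟩, c⟩
      simp only [Function.comp_apply, swapLast] at a2 a4 ⊢
      rw [a1, a2, a3, a4]
      ring
    · rw [htmul_add_left, map_add, map_add, map_add]
      filter_upwards [h1, h2, Lp.coeFn_add (W (flip23 (htmul ξ z))) (W (flip23 (htmul η z))),
        hσ.ae (Lp.coeFn_add (W (htmul ξ z)) (W (htmul η z)))] with p a1 a2 a3 a4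
      rw [a3, a4, Pi.add_apply, a1, a2]
      rfl
  filter_upwards [key ξ] with p hp
  rw [hp]

theorem one_submatrix_mul_mul {κ : Type*} [Fintype κ] [DecidableEq κ] {f : κ → κ}
    (hf : Function.Involutive f) (A : Matrix κ κ ℂ) :
    (1 : Matrix κ κ ℂ).submatrix f id * (A * (1 : Matrix κ κ ℂ).submatrix f id) =
      A.submatrix f f := by
  ext a b
  have h : ∀ c, (f c = b) = (c = f b) := fun c => propext
    ⟨fun h => by rw [← h, hf], fun h => by rw [h, hf]⟩
  simp [Matrix.mul_apply, Matrix.one_apply, h]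

/-- R₁₃ and R₂₃ arise from R₁₂ by conjugation with flips; the multiplier only has its arguments and
indices permuted. -/
theorem Acts.conj_involutive {X κ K : Type*} [Fintype κ] [DecidableEq κ] [MeasurableSpace X]
    {μ : Measure X} {V : K → Lp (EuclideanSpace ℂ κ) 2 μ} {R F : K → K} {M : X → Matrix κ κ ℂ}
    {σ : X → X} {f : κ → κ} (h : Acts V R M id)
    (hF : Acts V F (fun _ => (1 : Matrix κ κ ℂ).submatrix f id) σ)
    (hσ : Measure.QuasiMeasurePreserving σ μ μ) (hσσ : Function.Involutive σ)
    (hf : Function.Involutive f) :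
    Acts V (F ∘ R ∘ F) (fun p => (M (σ p)).submatrix f f) id := by
  have h1 := hF.comp (h.comp hF (Measure.QuasiMeasurePreserving.id _)) hσ
  have h2 : (σ ∘ id) ∘ σ = id := by
    funext p
    exact hσσ p
  rw [h2] at h1
  exact h1.congr (Eventually.of_forall fun p => one_submatrix_mul_mul hf _)

theorem swapLast_involutive {X : Type*} : Function.Involutive (swapLast (X := X)) := fun _ => rfl

/-- Two measure preserving shears turn (q₁, q₂, q₃) into the two differences and a spectator
variable. The differences appear in the order (q₂ - q₃, q₁ - q₂), so that their sum is q₁ - q₃. -/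
theorem ae_sub_sub_iff {P : ℝ × ℝ → Prop} :
    (∀ᵐ p : (ℝ × ℝ) × ℝ, P (p.1.2 - p.2, p.1.1 - p.1.2)) ↔ ∀ᵐ x : ℝ × ℝ, P x := by
  have a1 := measurePreserving_prodAssoc (volume : Measure ℝ) (volume : Measure ℝ)
    (volume : Measure ℝ)
  have a2 := (measurePreserving_sub_prod (volume : Measure ℝ) (volume : Measure ℝ)).prod
    (MeasurePreserving.id (volume : Measure ℝ))
  have a3 := (MeasurePreserving.id (volume : Measure ℝ)).prod
    (measurePreserving_sub_prod (volume : Measure ℝ) (volume : Measure ℝ))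
  have b2 := (measurePreserving_add_prod (volume : Measure ℝ) (volume : Measure ℝ)).prod
    (MeasurePreserving.id (volume : Measure ℝ))
  have b3 := (MeasurePreserving.id (volume : Measure ℝ)).prod
    (measurePreserving_add_prod (volume : Measure ℝ) (volume : Measure ℝ))
  constructor
  · intro h
    have h1 := (((b2.comp (a1.symm)).comp b3).comp a1).quasiMeasurePreserving.ae h
    have h2 : ∀ᵐ x : ℝ × ℝ, P x.swap := by
      filter_upwards [Measure.ae_ae_of_ae_prod h1] with x hx
      obtain ⟨s, hs⟩ := hx.exists
      simpa [MeasurableEquiv.prodAssoc, Prod.swap] using hs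
    exact (Measure.measurePreserving_swap (μ := (volume : Measure ℝ))
      (ν := (volume : Measure ℝ))).quasiMeasurePreserving.ae h2
  · intro h
    have h2 := (Measure.quasiMeasurePreserving_fst (μ := (volume : Measure (ℝ × ℝ)))
      (ν := (volume : Measure ℝ))).ae ((Measure.measurePreserving_swap (μ := (volume : Measure ℝ))
        (ν := (volume : Measure ℝ))).quasiMeasurePreserving.ae h)
    have h1 := (((a1.symm).comp a3).comp (a1.comp a2)).quasiMeasurePreserving.ae h2
    exact h1

variable [DecidableEq ι] {S : ℝ → Matrix (ι × ι) (ι × ι) ℂ}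

theorem yangBaxter_iff (h : ComesFrom U R S) :
    op12 R ∘L op13 R ∘L op23 R = op23 R ∘L op13 R ∘L op12 R ↔
      ∀ᵐ p : ℝ × ℝ, leg12 (S p.1) * leg23 (S (p.1 + p.2)) * leg12 (S p.2) =
        leg23 (S p.2) * leg12 (S (p.1 + p.2)) * leg23 (S p.1) := by
  rw [comesFrom_iff_acts] at h
  obtain ⟨W, hW⟩ := exists_isProductRep (waveL U).toLinearMap
    (U.toLinearEquiv.toLinearMap) (inner_waveL U) (fun x y => U.inner_map_map x y)
  replace hW : IsProductRep (μ := volume) (ν := volume) W (fun ξ => waveL U ξ) U := hW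
  have hinj : Function.Injective fun ξ => W ξ := injective_of_inner_map_map
    (hW.inner_map_map (inner_waveL U) (fun x y => U.inner_map_map x y))
  have hsep : Separates (μ := (volume : Measure ((ℝ × ℝ) × ℝ))) fun ξ => W ξ :=
    hW.separates (separates_waveL U) (separates_rep U)
  have hid := Measure.QuasiMeasurePreserving.id (volume : Measure ((ℝ × ℝ) × ℝ))
  set K : (ℝ × ℝ) × ℝ → Matrix ((ι × ι) × ι) ((ι × ι) × ι) ℂ := fun p =>
    Matrix.kroneckerMap (· * ·) (diffMatrix S p.1) (1 : Matrix ι ι ℂ) with hK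
  set g : (ι × ι) × ι → (ι × ι) × ι := Prod.map Prod.swap id with hg
  have h12 : Acts (fun ξ => W ξ) (op12 R) K id := by
    have := hW.acts_hmap_id (MeasurePreserving.id _) h
    rw [Prod.map_id] at this
    exact this
  have hF12 : Acts (fun ξ => W ξ) (op12 hflip)
      (fun _ => (1 : Matrix ((ι × ι) × ι) ((ι × ι) × ι) ℂ).submatrix g id)
      (Prod.map Prod.swap id) := by
    have := hW.acts_hmap_id Measure.measurePreserving_swap (acts_hflip (U := U))
    refine Acts.congr this (Eventually.of_forall fun p => ?_)
    ext ⟨a, b⟩ ⟨c, d⟩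
    by_cases hb : b = d <;> simp [Matrix.one_apply, g, Prod.ext_iff, ite_and, hb]
  have h13 : Acts (fun ξ => W ξ) (op13 R) (fun p => (K (swapLast p)).submatrix swapLast swapLast)
      id :=
    h12.conj_involutive (acts_flip23 hW) measurePreserving_swapLast_real.quasiMeasurePreserving
      swapLast_involutive swapLast_involutive
  have h23 := h13.conj_involutive hF12 measurePreserving_prodMap_swap.quasiMeasurePreserving
      (fun _ => rfl) (fun _ => rfl)
  replace h23 : Acts (fun ξ => W ξ) (op23 R) _ id := h23
  have hL := h12.comp (h13.comp h23 hid) hid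
  have hR := h23.comp (h13.comp h12 hid) hid
  -- Because of the reversed upper indices, the multiplier of each R_{ij} is a leg of S with rows
  -- and columns relabelled differently, and it can be read as leg 12 or as leg 23. The relabellings
  -- chain as f₁, f₂, f₃, r in R₁₂R₁₃R₂₃ and as f₁, g₂, g₃, r in R₂₃R₁₃R₁₂, so the inner ones cancel
  -- and the outer ones agree.
  let f₁ : (ι × ι) × ι ≃ ι × ι × ι :=
    ⟨fun a => (a.2, a.1.2, a.1.1), fun a => ((a.2.2, a.2.1), a.1), fun _ => rfl, fun _ => rfl⟩
  let f₂ : (ι × ι) × ι ≃ ι × ι × ι :=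
    ⟨fun a => (a.2, a.1.1, a.1.2), fun a => ((a.2.1, a.2.2), a.1), fun _ => rfl, fun _ => rfl⟩
  let f₃ : (ι × ι) × ι ≃ ι × ι × ι :=
    ⟨fun a => (a.1.1, a.2, a.1.2), fun a => ((a.1, a.2.2), a.2.1), fun _ => rfl, fun _ => rfl⟩
  let g₂ : (ι × ι) × ι ≃ ι × ι × ι :=
    ⟨fun a => (a.1.2, a.2, a.1.1), fun a => ((a.2.2, a.1), a.2.1), fun _ => rfl, fun _ => rfl⟩
  let g₃ : (ι × ι) × ι ≃ ι × ι × ι :=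
    ⟨fun a => (a.1.2, a.1.1, a.2), fun a => ((a.2.1, a.1), a.2.2), fun _ => rfl, fun _ => rfl⟩
  let r : (ι × ι) × ι ≃ ι × ι × ι := Equiv.prodAssoc ι ι ι
  have e12 : ∀ p, K p = (leg23 (S (p.1.1 - p.1.2))).submatrix f₁ f₂ ∧
      K p = (leg12 (S (p.1.1 - p.1.2))).submatrix g₃ r := by
    intro p
    constructor <;> ext ⟨⟨a, b⟩, c⟩ ⟨⟨d, e⟩, f⟩ <;>
      simp [K, f₁, f₂, g₃, r, leg12, leg23, diffMatrix, Matrix.one_apply]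
  have e13 : ∀ p, (K (swapLast p)).submatrix swapLast swapLast =
        (leg12 (S (p.1.1 - p.2))).submatrix f₂ f₃ ∧
      (K (swapLast p)).submatrix swapLast swapLast =
        (leg23 (S (p.1.1 - p.2))).submatrix g₂ g₃ := by
    intro p
    constructor <;> ext ⟨⟨a, b⟩, c⟩ ⟨⟨d, e⟩, f⟩ <;>
      simp [K, swapLast, f₃, f₂, g₂, g₃, leg12, leg23, diffMatrix, Matrix.one_apply]
  have e23 : ∀ p : (ℝ × ℝ) × ℝ, ((K (swapLast (Prod.map Prod.swap id p))).submatrix swapLast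
        swapLast).submatrix g g = (leg23 (S (p.1.2 - p.2))).submatrix f₃ r ∧
      ((K (swapLast (Prod.map Prod.swap id p))).submatrix swapLast
        swapLast).submatrix g g = (leg12 (S (p.1.2 - p.2))).submatrix f₁ g₂ := by
    intro p
    constructor <;> ext ⟨⟨a, b⟩, c⟩ ⟨⟨d, e⟩, f⟩ <;>
      simp [K, swapLast, g, f₁, f₃, r, g₂, leg12, leg23, diffMatrix, Matrix.one_apply]
  have eq : (∀ᵐ p : ℝ × ℝ, leg12 (S p.1) * leg23 (S (p.1 + p.2)) * leg12 (S p.2) =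
        leg23 (S p.2) * leg12 (S (p.1 + p.2)) * leg23 (S p.1)) ↔
      ∀ᵐ p : (ℝ × ℝ) × ℝ, K p * ((K (swapLast p)).submatrix swapLast swapLast *
        ((K (swapLast (Prod.map Prod.swap id p))).submatrix swapLast swapLast).submatrix g g) =
        ((K (swapLast (Prod.map Prod.swap id p))).submatrix swapLast swapLast).submatrix g g *
          ((K (swapLast p)).submatrix swapLast swapLast * K p) := by
    rw [← ae_sub_sub_iff]
    refine eventually_congr (Eventually.of_forall fun p => ?_)
    have hs : p.1.2 - p.2 + (p.1.1 - p.1.2) = p.1.1 - p.2 := by ring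
    have l : K p * ((K (swapLast p)).submatrix swapLast swapLast *
        ((K (swapLast (Prod.map Prod.swap id p))).submatrix swapLast swapLast).submatrix g g) =
        (leg23 (S (p.1.1 - p.1.2)) * leg12 (S (p.1.1 - p.2)) *
          leg23 (S (p.1.2 - p.2))).submatrix f₁ r := by
      rw [(e12 p).1, (e13 p).1, (e23 p).1, Matrix.submatrix_mul_equiv, Matrix.submatrix_mul_equiv,
        Matrix.mul_assoc]
    have l' : ((K (swapLast (Prod.map Prod.swap id p))).submatrix swapLast
        swapLast).submatrix g g * ((K (swapLast p)).submatrix swapLast swapLast * K p) =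
        (leg12 (S (p.1.2 - p.2)) * leg23 (S (p.1.1 - p.2)) *
          leg12 (S (p.1.1 - p.1.2))).submatrix f₁ r := by
      rw [(e12 p).2, (e13 p).2, (e23 p).2, Matrix.submatrix_mul_equiv, Matrix.submatrix_mul_equiv,
        Matrix.mul_assoc]
    simp only [hs]
    rw [l, l']
    constructor
    · intro h
      rw [h]
    · intro h
      -- The product R₁₂R₁₃R₂₃ corresponds to the right-hand side of the matrix equation, which is
      -- why the identity is reversed in the end.
      have := congrArg (fun A => A.submatrix f₁.symm r.symm) h
      simpa only [Matrix.submatrix_submatrix, Equiv.self_comp_symm, Matrix.submatrix_id_id]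
        using this.symm
  rw [eq]
  constructor
  · intro h0
    have h0' : (op12 R ∘ op13 R ∘ op23 R :
        HTensor (HTensor 𝓗 𝓗) 𝓗 → HTensor (HTensor 𝓗 𝓗) 𝓗) = op23 R ∘ op13 R ∘ op12 R :=
      congrArg DFunLike.coe h0
    rw [h0'] at hL
    exact Acts.matrix_ae_eq hsep hid hL hR
  · intro h0
    exact DFunLike.coe_injective (Acts.eq hinj hL hR h0)

end YangBaxter

/-! ### Existence of the Schrödinger representation -/

section Existence

variable {ι : Type*} [Fintype ι] {n : ℕ} (bar : ι → ι)

/-- The functional `v ↦ ((1 - i) v^α + (1 + i) v^(bar α)) / 2`. -/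
def mixFun (α : ι) : EuclideanSpace ℂ ι →L[ℂ] ℂ :=
  ((1 - Complex.I) / 2) • (EuclideanSpace.proj α : EuclideanSpace ℂ ι →L[ℂ] ℂ) +
    ((1 + Complex.I) / 2) • (EuclideanSpace.proj (bar α) : EuclideanSpace ℂ ι →L[ℂ] ℂ)

omit [Fintype ι] in
theorem mixFun_apply (α : ι) (v : EuclideanSpace ℂ ι) :
    mixFun bar α v = (1 - Complex.I) / 2 * v α + (1 + Complex.I) / 2 * v (bar α) := rfl

omit [Fintype ι] in
theorem mixFun_mixFun {bar : ι → ι} (hbar : Function.Involutive bar) (α : ι)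
    (v : EuclideanSpace ℂ ι) :
    (1 + Complex.I) / 2 * mixFun bar α v + (1 - Complex.I) / 2 * mixFun bar (bar α) v = v α := by
  rw [mixFun_apply, mixFun_apply, hbar]
  linear_combination (v (bar α) / 2 - v α / 2) * Complex.I_sq

/-- Unitarity of the mixing: the cross terms between α and bar α carry the coefficients -i/2 and
i/2, which cancel after relabelling the sum by `bar`. -/
theorem sum_conj_mixFun {bar : ι → ι} (hbar : Function.Involutive bar) (v w : EuclideanSpace ℂ ι) :
    ∑ α, mixFun bar α w * conj (mixFun bar α v) = ∑ α, w α * conj (v α) := by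
  have h1 : ∀ F : ι → ℂ, ∑ α, F (bar α) = ∑ α, F α := fun F =>
    Equiv.sum_comp (hbar.toPerm bar) F
  have h2 : ∀ α, mixFun bar α w * conj (mixFun bar α v) =
      2⁻¹ * (w α * conj (v α)) + 2⁻¹ * (w (bar α) * conj (v (bar α))) +
        (-(Complex.I / 2) * (w α * conj (v (bar α))) +
          (Complex.I / 2) * (w (bar α) * conj (v (bar (bar α))))) := by
    intro α
    rw [mixFun_apply, mixFun_apply, hbar]
    simp only [map_add, map_mul, map_sub, map_div₀, map_one, Complex.conj_I, map_ofNat]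
    linear_combination (w α * conj (v (bar α)) / 4 + w (bar α) * conj (v α) / 4
      - w α * conj (v α) / 4 - w (bar α) * conj (v (bar α)) / 4) * Complex.I_sq
  simp only [h2, Finset.sum_add_distrib, ← Finset.mul_sum]
  rw [h1 fun α => w α * conj (v α), h1 fun α => w α * conj (v (bar α))]
  ring

theorem exists_mixL2 {bar : ι → ι} (hbar : Function.Involutive bar) (e : ι ≃ Fin n) :
    ∃ E : L2R ι ≃ₗᵢ[ℂ] PiLp 2 (fun _ : Fin n => Lp ℂ 2 (volume : Measure ℝ)),
      ∀ F α, ∀ᵐ q : ℝ, (E F (e α) : ℝ → ℂ) q = mixFun bar α (F q) := by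
  classical
  let E₀ : L2R ι →ₗ[ℂ] PiLp 2 (fun _ : Fin n => Lp ℂ 2 (volume : Measure ℝ)) :=
    { toFun := fun F => WithLp.toLp 2 fun i => (mixFun bar (e.symm i)).compLp F
      map_add' := fun F G => by
        refine PiLp.ext fun i => ?_
        exact ((mixFun bar (e.symm i)).compLpₗ 2 volume).map_add F G
      map_smul' := fun c F => by
        refine PiLp.ext fun i => ?_
        exact ((mixFun bar (e.symm i)).compLpₗ 2 volume).map_smul c F }
  have hE : ∀ F i, ∀ᵐ q : ℝ, (E₀ F i : ℝ → ℂ) q = mixFun bar (e.symm i) (F q) := fun F i =>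
    (mixFun bar (e.symm i)).coeFn_compLp F
  have hinner : ∀ F G, ⟪E₀ F, E₀ G⟫_ℂ = ⟪F, G⟫_ℂ := by
    intro F G
    rw [PiLp.inner_apply]
    simp only [L2.inner_def]
    rw [← integral_finsetSum _ fun i _ => L2.integrable_inner (𝕜 := ℂ) (E₀ F i) (E₀ G i)]
    refine integral_congr_ae ?_
    filter_upwards [ae_all_iff.2 (hE F), ae_all_iff.2 (hE G)] with q h1 h2
    simp only [PiLp.inner_apply, RCLike.inner_apply, h1, h2]
    rw [← sum_conj_mixFun hbar (F q) (G q)]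
    exact Equiv.sum_comp e.symm fun α => mixFun bar α (G q) * conj (mixFun bar α (F q))
  have hsurj : Function.Surjective (E₀.isometryOfInner hinner) := by
    intro f
    let g : ι → Lp ℂ 2 (volume : Measure ℝ) := fun α =>
      ((1 + Complex.I) / 2) • f (e α) + ((1 - Complex.I) / 2) • f (e (bar α))
    have hg : ∀ α, ∀ᵐ q : ℝ, (g α : ℝ → ℂ) q = (1 + Complex.I) / 2 * (f (e α) : ℝ → ℂ) q +
        (1 - Complex.I) / 2 * (f (e (bar α)) : ℝ → ℂ) q := by
      intro α
      filter_upwards [Lp.coeFn_add (((1 + Complex.I) / 2) • f (e α))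
        (((1 - Complex.I) / 2) • f (e (bar α))), Lp.coeFn_smul ((1 + Complex.I) / 2) (f (e α)),
        Lp.coeFn_smul ((1 - Complex.I) / 2) (f (e (bar α)))] with q h1 h2 h3
      rw [h1, Pi.add_apply, h2, h3]
      rfl
    have hm : MemLp (fun q => (WithLp.toLp 2 fun α => (g α : ℝ → ℂ) q : EuclideanSpace ℂ ι)) 2
        volume := by
      have h1 : ∀ α, MemLp (fun q => (EuclideanSpace.single α ((g α : ℝ → ℂ) q) :
          EuclideanSpace ℂ ι)) 2 volume := fun α =>
        (LinearMap.toContinuousLinearMap (LinearMap.toSpanSingleton ℂ (EuclideanSpace ℂ ι)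
          (EuclideanSpace.single α 1))).comp_memLp' (Lp.memLp (g α)) |>.ae_eq
          (Eventually.of_forall fun q => by
            ext i
            simp [LinearMap.toSpanSingleton])
      refine (memLp_finsetSum Finset.univ fun α _ => h1 α).ae_eq (Eventually.of_forall fun q => ?_)
      ext i
      simp
    refine ⟨hm.toLp _, ?_⟩
    refine PiLp.ext fun i => ?_
    refine Lp.ext ?_
    have h2 := hE (hm.toLp _) i
    filter_upwards [h2, hm.coeFn_toLp, ae_all_iff.2 hg] with q h3 h4 h5
    refine h3.trans ?_
    rw [h4, mixFun_apply]
    simp only [h5, hbar _, Equiv.apply_symm_apply]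
    linear_combination ((f (e (bar (e.symm i))) : ℝ → ℂ) q / 2 -
      (f i : ℝ → ℂ) q / 2) * Complex.I_sq
  refine ⟨LinearIsometryEquiv.ofSurjective _ hsurj, fun F α => ?_⟩
  have := hE F (e α)
  rw [e.symm_apply_apply] at this
  exact this

/-- The two mixing coefficients are complex conjugates of each other. Hence mixing the vector (conj
v^(bar α)) gives the complex conjugates of the mixed components of v, and the twisted reality
condition becomes f(q + iπ) = conj f(q) in each component. The phases act as scalars on ℂ^ι and are
unaffected. -/
theorem exists_isSchrodingerRep {𝓗 : Type*} [NormedAddCommGroup 𝓗] [InnerProductSpace ℂ 𝓗]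
    [CompleteSpace 𝓗] {H : StandardSubspace 𝓗} {T : ℝ → 𝓗 →L[ℂ] 𝓗}
    (hn : HasMultiplicity H T n) (hι : Fintype.card ι = n) {bar : ι → ι}
    (hbar : Function.Involutive bar) : ∃ U : 𝓗 ≃ₗᵢ[ℂ] L2R ι, IsSchrodingerRep H T bar U := by
  obtain ⟨U₀, hT, hH⟩ := hn
  obtain ⟨E, hE⟩ := exists_mixL2 hbar (Fintype.equivFinOfCardEq hι)
  set e := Fintype.equivFinOfCardEq hι
  set U : 𝓗 ≃ₗᵢ[ℂ] L2R ι := U₀.trans E.symm with hU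
  have hf : ∀ x α, ∀ᵐ q : ℝ, (U₀ x (e α) : ℝ → ℂ) q = mixFun bar α (U x q) := by
    intro x α
    have := hE (U x) α
    rwa [hU, LinearIsometryEquiv.trans_apply, E.apply_symm_apply] at this
  have hg : ∀ x α, ∀ᵐ q : ℝ, U x q α = (1 + Complex.I) / 2 * (U₀ x (e α) : ℝ → ℂ) q +
      (1 - Complex.I) / 2 * (U₀ x (e (bar α)) : ℝ → ℂ) q := by
    intro x α
    filter_upwards [hf x α, hf x (bar α)] with q h1 h2
    rw [h1, h2, mixFun_mixFun hbar]
  have m0 : ∀ x i, AEStronglyMeasurable (U₀ x i : ℝ → ℂ) volume := fun x i =>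
    (Lp.memLp (U₀ x i)).1
  have m1 : ∀ x α, AEStronglyMeasurable (fun q => U x q α) volume := fun x α =>
    (stronglyMeasurable_coord (U x) α).aestronglyMeasurable
  have mc : ∀ {f : ℝ → ℂ}, AEStronglyMeasurable f volume →
      AEStronglyMeasurable (fun q => conj (f q)) volume := fun hf =>
    Complex.continuous_conj.comp_aestronglyMeasurable hf
  refine ⟨U, fun t x => ?_, fun x => ?_⟩
  · filter_upwards [ae_all_iff.2 (hg (T t x)), ae_all_iff.2 (hg x),
      ae_all_iff.2 fun i => hT t x i] with q h1 h2 h3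
    ext α
    rw [h1, PiLp.smul_apply, h2, h3, h3, smul_eq_mul]
    ring
  · rw [hH]
    constructor
    · intro h α
      refine (((h (e α)).smul ((1 + Complex.I) / 2)).add
        ((h (e (bar α))).smul ((1 - Complex.I) / 2)) ((m0 _ _).const_mul _)
        ((mc (m0 _ _)).const_mul _) ((m0 _ _).const_mul _)
        ((mc (m0 _ _)).const_mul _)).congr ?_ ?_
      · filter_upwards [hg x α] with q hq
        rw [hq]
      · filter_upwards [hg x (bar α)] with q hq
        rw [hq, hbar]
        simp only [map_add, map_mul, map_sub, map_div₀, map_one, Complex.conj_I, map_ofNat]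
        ring
    · intro h i
      obtain ⟨α, rfl⟩ := e.surjective i
      refine (((h α).smul ((1 - Complex.I) / 2)).add
        ((h (bar α)).smul ((1 + Complex.I) / 2)) ((m1 _ _).const_mul _)
        ((mc (m1 _ _)).const_mul _) ((m1 _ _).const_mul _)
        ((mc (m1 _ _)).const_mul _)).congr ?_ ?_
      · filter_upwards [hf x α] with q hq
        rw [hq, mixFun_apply]
      · filter_upwards [hf x α] with q hq
        rw [hq, mixFun_apply, hbar]
        simp only [map_add, map_mul, map_sub, map_div₀, map_one, Complex.conj_I, map_ofNat]
        ring

end Existence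

/-! ### Reconstruction of a bounded analytic function on the strip from its boundary values -/

section Cauchy

theorem integral_inv_sq_add_sq (x : ℝ) {d : ℝ} (hd : 0 < d) :
    ∫ q : ℝ, ((q - x) ^ 2 + d ^ 2)⁻¹ = Real.pi / d := by
  rw [integral_sub_right_eq_self (fun q : ℝ => (q ^ 2 + d ^ 2)⁻¹) x]
  have h := Measure.integral_comp_div (fun q : ℝ => (1 + q ^ 2)⁻¹) d
  rw [integral_univ_inv_one_add_sq, abs_of_pos hd, smul_eq_mul] at h
  have e : ∀ q : ℝ, (q ^ 2 + d ^ 2)⁻¹ = (d ^ 2)⁻¹ * (1 + (q / d) ^ 2)⁻¹ := by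
    intro q
    rw [← mul_inv]
    congr 1
    field_simp
    ring
  simp only [e]
  rw [integral_const_mul, h]
  field_simp

/-- The integral of `K` against `(q - a)⁻¹ (q - b)⁻¹`. -/
def cauchyPair (K : ℝ → ℂ) (a b : ℂ) : ℂ := ∫ q : ℝ, ((q : ℂ) - a)⁻¹ * ((q : ℂ) - b)⁻¹ * K q

theorem ofReal_sub_ne_zero {a : ℂ} (ha : a.im ≠ 0) (q : ℝ) : (q : ℂ) - a ≠ 0 := by
  intro h
  have := congrArg Complex.im h
  simp at this
  exact ha this

variable {K K₁ : ℝ → ℂ} {C : ℝ}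

theorem integrable_cauchyPair (hK : AEStronglyMeasurable K) (hC : ∀ᵐ q, ‖K q‖ ≤ C) {a b : ℂ}
    (ha : a.im ≠ 0) (hb : b.im ≠ 0) :
    Integrable fun q : ℝ => ((q : ℂ) - a)⁻¹ * ((q : ℂ) - b)⁻¹ * K q :=
  integrable_mul_mul (memLp_inv_sub ha) (memLp_inv_sub hb) hK hC

/-- Partial fractions: (z - b)/((q - z)(q - b)) = 1/(q - z) - 1/(q - b). A single Cauchy kernel is
not integrable against a bounded function, so only such differences are available, and this identity
changes the subtracted pole. -/
theorem cauchyPair_resolvent (hK : AEStronglyMeasurable K) (hC : ∀ᵐ q, ‖K q‖ ≤ C) {z b c : ℂ}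
    (hz : z.im ≠ 0) (hb : b.im ≠ 0) (hc : c.im ≠ 0) :
    (z - b) * cauchyPair K z b - (z - c) * cauchyPair K z c = (c - b) * cauchyPair K b c := by
  simp only [cauchyPair, ← integral_const_mul]
  rw [← integral_sub ((integrable_cauchyPair hK hC hz hb).const_mul _)
    ((integrable_cauchyPair hK hC hz hc).const_mul _)]
  refine integral_congr_ae (Eventually.of_forall fun q => ?_)
  have h1 := ofReal_sub_ne_zero hz q
  have h2 := ofReal_sub_ne_zero hb q
  have h3 := ofReal_sub_ne_zero hc q
  simp only []
  field_simp
  ring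

theorem differentiableAt_cauchyPair (hK : AEStronglyMeasurable K) (hC : ∀ᵐ q, ‖K q‖ ≤ C)
    {z b : ℂ} (hz : z.im ≠ 0) (hb : b.im ≠ 0) :
    DifferentiableAt ℂ (fun w => cauchyPair K w b) z := by
  have hd : 0 < |z.im| / 2 := by positivity
  have hball : ∀ w ∈ Metric.ball z (|z.im| / 2), |z.im| / 2 ≤ |w.im| ∧ |w.re - z.re| ≤ |z.im| / 2 := by
    intro w hw
    rw [Metric.mem_ball, Complex.dist_eq] at hw
    have h1 := Complex.abs_im_le_norm (w - z)
    have h2 := Complex.abs_re_le_norm (w - z)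
    rw [Complex.sub_im] at h1
    rw [Complex.sub_re] at h2
    have h3 := abs_sub_abs_le_abs_sub z.im w.im
    rw [abs_sub_comm] at h3
    constructor <;> linarith
  have hne : ∀ w ∈ Metric.ball z (|z.im| / 2), w.im ≠ 0 := fun w hw =>
    abs_pos.1 (hd.trans_le (hball w hw).1)
  -- With d = |Im z|/2 the root is at most |q - Re z| + d ≤ |q - Re w| + 2d ≤ 3|q - w|, because d ≤
  -- |Im w| ≤ |q - w|.
  have hbd : ∀ w ∈ Metric.ball z (|z.im| / 2), ∀ q : ℝ,
      ‖((q : ℂ) - w)⁻¹‖ ≤ 3 * (√((q - z.re) ^ 2 + (|z.im| / 2) ^ 2))⁻¹ := by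
    intro w hw q
    have hw' : 0 < ‖(q : ℂ) - w‖ := norm_pos_iff.2 (ofReal_sub_ne_zero (hne w hw) q)
    have hs : 0 < √((q - z.re) ^ 2 + (|z.im| / 2) ^ 2) := Real.sqrt_pos.2 (by positivity)
    rw [norm_inv, ← div_eq_mul_inv, ← one_div, div_le_div_iff₀ hw' hs, one_mul]
    have h1 : √((q - z.re) ^ 2 + (|z.im| / 2) ^ 2) ≤ |q - z.re| + |z.im| / 2 := by
      rw [Real.sqrt_le_left (by positivity), ← sq_abs (q - z.re)]
      nlinarith [abs_nonneg (q - z.re)]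
    have h2 := Complex.abs_im_le_norm ((q : ℂ) - w)
    have h3 := Complex.abs_re_le_norm ((q : ℂ) - w)
    rw [Complex.sub_im, Complex.ofReal_im, zero_sub, abs_neg] at h2
    rw [Complex.sub_re, Complex.ofReal_re] at h3
    have h4 := abs_sub_le q w.re z.re
    obtain ⟨h5, h6⟩ := hball w hw
    linarith
  refine differentiableAt_integral_of_dominated hd
    (bound := fun q => 3 * (√((q - z.re) ^ 2 + (|z.im| / 2) ^ 2))⁻¹ * ‖((q : ℂ) - b)⁻¹‖ * C)
    (fun w hw => ?_) (fun q => ?_) ?_ ?_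
  · exact (integrable_cauchyPair hK hC (hne w hw) hb).1
  · refine DifferentiableOn.mul_const (DifferentiableOn.mul_const ?_ _) _
    exact DifferentiableOn.inv (by fun_prop) fun w hw => ofReal_sub_ne_zero (hne w hw) q
  · filter_upwards [hC] with q hq w hw
    rw [norm_mul, norm_mul]
    exact mul_le_mul (mul_le_mul_of_nonneg_right (hbd w hw q) (norm_nonneg _)) hq (norm_nonneg _)
      (by positivity)
  · exact (((memLp_inv_sqrt z.re hd).const_mul 3).integrable_mul (memLp_inv_sub hb).norm).mul_const C

theorem norm_cauchyPair_le (hC : ∀ᵐ q, ‖K q‖ ≤ C) {a b : ℂ} {d : ℝ} (hd : 0 < d)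
    (ha : d ≤ |a.im|) (hb : d ≤ |b.im|) (hab : a.re = b.re) :
    ‖cauchyPair K a b‖ ≤ C * (Real.pi / d) := by
  rw [← integral_inv_sq_add_sq a.re hd, ← integral_const_mul]
  refine norm_integral_le_of_norm_le ((integrable_inv_sq_add_sq a.re hd).const_mul C) ?_
  filter_upwards [hC] with q hq
  have h1 := norm_inv_sub_le (p := a) (z := q) hd (by simpa using ha)
  have h2 := norm_inv_sub_le (p := b) (z := q) hd (by simpa using hb)
  rw [← hab] at h2
  rw [Complex.ofReal_re] at h1 h2
  rw [norm_mul, norm_mul, mul_comm C]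
  refine mul_le_mul ?_ hq (norm_nonneg _) (by positivity)
  calc ‖((q : ℂ) - a)⁻¹‖ * ‖((q : ℂ) - b)⁻¹‖
      ≤ (√((q - a.re) ^ 2 + d ^ 2))⁻¹ * (√((q - a.re) ^ 2 + d ^ 2))⁻¹ := by gcongr
    _ = ((q - a.re) ^ 2 + d ^ 2)⁻¹ := by
      rw [← mul_inv, Real.mul_self_sqrt (by positivity)]

theorem inv_mul_inv_conj (x y q : ℝ) : ((q : ℂ) - (x + y * Complex.I))⁻¹ *
    ((q : ℂ) - (x - y * Complex.I))⁻¹ = (((q - x) ^ 2 + y ^ 2)⁻¹ : ℝ) := by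
  rw [← mul_inv]
  push_cast
  congr 1
  linear_combination (-(y : ℂ) ^ 2) * Complex.I_sq

/-- Poisson integrals of bounded functions converge vertically almost everywhere. -/
theorem ae_tendsto_poisson_of_forall (hK : AEStronglyMeasurable K) (hC : ∀ q, ‖K q‖ ≤ C) :
    ∀ᵐ x : ℝ, Tendsto (fun y : ℝ => (y / Real.pi : ℂ) *
      cauchyPair K (x + y * Complex.I) (x - y * Complex.I)) (𝓝[>] 0) (𝓝 (K x)) := by
  have hC0 : 0 ≤ C := (norm_nonneg _).trans (hC 0)
  have hloc : LocallyIntegrable K volume := fun x =>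
    ⟨Metric.closedBall x 1, Metric.closedBall_mem_nhds x one_pos,
      Measure.integrableOn_of_bounded (M := C) (by simp) hK (ae_restrict_of_ae (.of_forall hC))⟩
  filter_upwards [IsUnifLocDoublingMeasure.ae_tendsto_average_norm_sub volume hloc 1] with x hx
  have havg : ∀ A : ℝ, 0 < A → Tendsto (fun y : ℝ => ⨍ q in Metric.closedBall x (A * y),
      ‖K q - K x‖) (𝓝[>] 0) (𝓝 0) := by
    intro A hA
    refine hx (fun _ => x) (fun y => A * y) ?_ ?_
    · refine tendsto_nhdsWithin_iff.2 ⟨?_, ?_⟩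
      · have : Tendsto (fun y : ℝ => A * y) (𝓝 0) (𝓝 (A * 0)) :=
          (continuous_const.mul continuous_id).tendsto 0
        rw [mul_zero] at this
        exact this.mono_left nhdsWithin_le_nhds
      · filter_upwards [self_mem_nhdsWithin] with y hy
        exact mul_pos hA hy
    · filter_upwards [self_mem_nhdsWithin] with y hy
      rw [one_mul]
      exact Metric.mem_closedBall_self (mul_pos hA hy).le
  -- Split at |q - x| = Ay. Inside, the kernel is at most y⁻² and an average over the ball appears,
  -- which tends to 0 at Lebesgue points. Outside, it is at most twice the kernel of width Ay, whose
  -- total mass contributes 4C/A.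
  have hbound : ∀ A : ℝ, 1 ≤ A → ∀ y : ℝ, 0 < y → ‖(y / Real.pi : ℂ) *
      cauchyPair K (x + y * Complex.I) (x - y * Complex.I) - K x‖ ≤
      2 * A / Real.pi * (⨍ q in Metric.closedBall x (A * y), ‖K q - K x‖) + 4 * C / A := by
    intro A hA y hy
    have hAy : 0 < A * y := by positivity
    have hKx : ∀ q, ‖K q - K x‖ ≤ 2 * C := fun q =>
      (norm_sub_le _ _).trans (by linarith [hC q, hC x])
    have hm : AEStronglyMeasurable (fun q => K q - K x) := hK.sub aestronglyMeasurable_const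
    have hi := integrable_inv_sq_add_sq x hy
    have hiA := integrable_inv_sq_add_sq x hAy
    have hpi := Real.pi_pos
    have e1 : (y / Real.pi : ℂ) * cauchyPair K (x + y * Complex.I) (x - y * Complex.I) - K x =
        (y / Real.pi : ℂ) * ∫ q : ℝ, (((q - x) ^ 2 + y ^ 2)⁻¹ : ℝ) * (K q - K x) := by
      have i1 : Integrable fun q : ℝ => ((((q - x) ^ 2 + y ^ 2)⁻¹ : ℝ) : ℂ) * K q :=
        hi.ofReal.mul_bdd hK (.of_forall hC)
      have i2 : Integrable fun q : ℝ => ((((q - x) ^ 2 + y ^ 2)⁻¹ : ℝ) : ℂ) * K x :=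
        hi.ofReal.mul_const _
      simp only [mul_sub, cauchyPair, inv_mul_inv_conj]
      rw [integral_sub i1 i2, integral_mul_const, integral_complex_ofReal,
        integral_inv_sq_add_sq x hy, mul_sub]
      congr 1
      have h1 : (Real.pi : ℂ) ≠ 0 := by exact_mod_cast hpi.ne'
      have h2 : (y : ℂ) ≠ 0 := by exact_mod_cast hy.ne'
      push_cast
      field_simp
    have e2 : ‖(y / Real.pi : ℂ)‖ = y / Real.pi := by
      rw [← Complex.ofReal_div, Complex.norm_real, Real.norm_of_nonneg (by positivity)]
    have iB : Integrable (fun q => (y ^ 2)⁻¹ * ((Metric.closedBall x (A * y)).indicator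
        (fun q => ‖K q - K x‖) q)) := by
      refine Integrable.const_mul ?_ _
      refine (integrable_indicator_iff Metric.isClosed_closedBall.measurableSet).2 ?_
      exact Measure.integrableOn_of_bounded (M := 2 * C) measure_closedBall_lt_top.ne hm.norm
        (ae_restrict_of_ae (.of_forall fun q => by rw [norm_norm]; exact hKx q))
    have e3 : ‖∫ q : ℝ, ((((q - x) ^ 2 + y ^ 2)⁻¹ : ℝ) : ℂ) * (K q - K x)‖ ≤
        ∫ q : ℝ, ((y ^ 2)⁻¹ * ((Metric.closedBall x (A * y)).indicator
          (fun q => ‖K q - K x‖) q) + 4 * C * ((q - x) ^ 2 + (A * y) ^ 2)⁻¹) := by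
      refine norm_integral_le_of_norm_le (iB.add (hiA.const_mul _)) (.of_forall fun q => ?_)
      rw [norm_mul, Complex.norm_real, Real.norm_of_nonneg (by positivity)]
      by_cases hq : q ∈ Metric.closedBall x (A * y)
      · rw [Set.indicator_of_mem hq]
        have h1 : ((q - x) ^ 2 + y ^ 2)⁻¹ ≤ (y ^ 2)⁻¹ :=
          inv_anti₀ (by positivity) (by nlinarith [sq_nonneg (q - x)])
        have h2 : 0 ≤ 4 * C * ((q - x) ^ 2 + (A * y) ^ 2)⁻¹ := by positivity
        nlinarith [mul_le_mul_of_nonneg_right h1 (norm_nonneg (K q - K x))]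
      · rw [Set.indicator_of_notMem hq, mul_zero, zero_add]
        rw [Metric.mem_closedBall, not_le, Real.dist_eq] at hq
        have h0 : (A * y) ^ 2 ≤ (q - x) ^ 2 := by
          rw [← sq_abs (q - x)]
          gcongr
        have h1 : ((q - x) ^ 2 + y ^ 2)⁻¹ ≤ 2 * ((q - x) ^ 2 + (A * y) ^ 2)⁻¹ := by
          rw [← div_eq_mul_inv, ← one_div, div_le_div_iff₀ (by positivity) (by positivity)]
          nlinarith [sq_nonneg y]
        calc ((q - x) ^ 2 + y ^ 2)⁻¹ * ‖K q - K x‖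
            ≤ 2 * ((q - x) ^ 2 + (A * y) ^ 2)⁻¹ * (2 * C) :=
              mul_le_mul h1 (hKx q) (norm_nonneg _) (by positivity)
          _ = _ := by ring
    rw [integral_add iB (hiA.const_mul _), integral_const_mul, integral_const_mul,
      integral_inv_sq_add_sq x hAy,
      integral_indicator Metric.isClosed_closedBall.measurableSet] at e3
    have e4 : ∫ q in Metric.closedBall x (A * y), ‖K q - K x‖ =
        2 * (A * y) * ⨍ q in Metric.closedBall x (A * y), ‖K q - K x‖ := by
      rw [setAverage_eq, measureReal_def, Real.volume_closedBall,
        ENNReal.toReal_ofReal (by positivity), smul_eq_mul]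
      field_simp
    rw [e4] at e3
    rw [e1, norm_mul, e2]
    calc y / Real.pi * _ ≤ y / Real.pi * ((y ^ 2)⁻¹ * (2 * (A * y) *
          ⨍ q in Metric.closedBall x (A * y), ‖K q - K x‖) + 4 * C * (Real.pi / (A * y))) := by
          gcongr
      _ = _ := by
          field_simp
  rw [tendsto_iff_norm_sub_tendsto_zero]
  refine tendsto_order.2 ⟨fun a ha => .of_forall fun y => ha.trans_le (norm_nonneg _),
    fun ε hε => ?_⟩
  -- A is chosen so that the tail 4C/A is below ε/2; it stays fixed while y → 0.
  set A : ℝ := max 1 (8 * C / ε + 1) with hA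
  have hA1 : 1 ≤ A := le_max_left _ _
  have hA2 : 4 * C / A < ε / 2 := by
    have h1 : 8 * C / ε < A := lt_of_lt_of_le (by linarith) (le_max_right _ _)
    rw [div_lt_iff₀ hε] at h1
    rw [div_lt_iff₀ (by linarith)]
    linarith
  have h1 := ((havg A (by linarith)).const_mul (2 * A / Real.pi)).eventually_lt_const
    (u := ε / 2) (by rw [mul_zero]; positivity)
  filter_upwards [h1, self_mem_nhdsWithin] with y h2 h3
  exact (hbound A hA1 y h3).trans_lt (by linarith)

theorem ae_tendsto_poisson (hK : AEStronglyMeasurable K) (hC : ∀ᵐ q, ‖K q‖ ≤ C) :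
    ∀ᵐ x : ℝ, Tendsto (fun y : ℝ => (y / Real.pi : ℂ) *
      cauchyPair K (x + y * Complex.I) (x - y * Complex.I)) (𝓝[>] 0) (𝓝 (K x)) := by
  obtain ⟨q₀, hq₀⟩ := hC.exists
  have hC0 : 0 ≤ C := (norm_nonneg _).trans hq₀
  set K' : ℝ → ℂ := fun q => if ‖K q‖ ≤ C then K q else 0 with hK'
  have he : K =ᵐ[volume] K' := by
    filter_upwards [hC] with q hq
    simp [hK', hq]
  have h := ae_tendsto_poisson_of_forall (hK.congr he) (C := C) fun q => by
    by_cases hq : ‖K q‖ ≤ C <;> simp [hK', hq, hC0]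
  have e : ∀ a b, cauchyPair K' a b = cauchyPair K a b := fun a b => integral_congr_ae (by
    filter_upwards [he] with q hq
    rw [hq])
  simp only [e] at h
  filter_upwards [h, he] with x h1 h2
  rwa [h2]

/-- The function on the strip with the boundary values `K` and `K₁`. -/
def cauchyExt (K K₁ : ℝ → ℂ) (b z : ℂ) : ℂ :=
  (2 * Real.pi * Complex.I)⁻¹ * ((z - b) * (cauchyPair K z b -
    cauchyPair K₁ (z - Real.pi * Complex.I) (b - Real.pi * Complex.I)))

theorem im_sub_pi_mul_I (z : ℂ) : (z - Real.pi * Complex.I).im = z.im - Real.pi := by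
  simp

variable (hK : AEStronglyMeasurable K) (hC : ∀ᵐ q, ‖K q‖ ≤ C) (hK₁ : AEStronglyMeasurable K₁)
  (hC₁ : ∀ᵐ q, ‖K₁ q‖ ≤ C)
  (h : ∀ a b : ℂ, a ≠ b → a.im < 0 ∨ Real.pi < a.im → b.im < 0 ∨ Real.pi < b.im →
    cauchyPair K a b = cauchyPair K₁ (a - Real.pi * Complex.I) (b - Real.pi * Complex.I))

include hK hC hK₁ hC₁ h in
-- Independence of the auxiliary pole. By the resolvent identities for K and K₁ the change from b to
-- c is the same multiple of two quantities, and the hypothesis says that these are equal. The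
-- freedom to move the pole is what produces bounds and boundary values.
theorem cauchyExt_eq {b c z : ℂ} (hb : b.im < 0 ∨ Real.pi < b.im)
    (hc : c.im < 0 ∨ Real.pi < c.im) (hz0 : z.im ≠ 0) (hz1 : z.im ≠ Real.pi) :
    cauchyExt K K₁ b z = cauchyExt K K₁ c z := by
  rcases eq_or_ne b c with rfl | hbc
  · rfl
  have ne : ∀ {b : ℂ}, b.im < 0 ∨ Real.pi < b.im →
      b.im ≠ 0 ∧ (b - Real.pi * Complex.I).im ≠ 0 := by
    intro b hb
    rw [im_sub_pi_mul_I]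
    have := Real.pi_pos
    rcases hb with hb | hb <;> constructor <;> intro h0 <;> linarith
  have hz2 : (z - Real.pi * Complex.I).im ≠ 0 := by
    rw [im_sub_pi_mul_I]
    exact sub_ne_zero.2 hz1
  have r1 := cauchyPair_resolvent hK hC hz0 (ne hb).1 (ne hc).1
  have r2 := cauchyPair_resolvent hK₁ hC₁ hz2 (ne hb).2 (ne hc).2
  rw [cauchyExt, cauchyExt]
  congr 1
  simp only [sub_sub_sub_cancel_right] at r2
  rw [h b c hbc hb hc] at r1
  linear_combination r1 - r2

include hK hC hK₁ hC₁ in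
theorem differentiableOn_cauchyExt {b : ℂ} (hb : b.im < 0 ∨ Real.pi < b.im) :
    DifferentiableOn ℂ (cauchyExt K K₁ b) {z | 0 < z.im ∧ z.im < Real.pi} := by
  intro z hz
  have hpi := Real.pi_pos
  have hb0 : b.im ≠ 0 := by rcases hb with hb | hb <;> intro h0 <;> linarith
  have hb1 : (b - Real.pi * Complex.I).im ≠ 0 := by
    rw [im_sub_pi_mul_I]
    rcases hb with hb | hb <;> intro h0 <;> linarith
  have hz1 : (z - Real.pi * Complex.I).im ≠ 0 := by
    rw [im_sub_pi_mul_I]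
    intro h0
    linarith [hz.2]
  have d1 := differentiableAt_cauchyPair hK hC hz.1.ne' hb0
  have d2 := differentiableAt_cauchyPair hK₁ hC₁ hz1 hb1
  have d3 : DifferentiableAt ℂ (fun w => cauchyPair K₁ (w - Real.pi * Complex.I)
      (b - Real.pi * Complex.I)) z :=
    DifferentiableAt.comp z (g := fun w => cauchyPair K₁ w (b - Real.pi * Complex.I)) d2
      (by fun_prop)
  exact (DifferentiableAt.const_mul ((by fun_prop : DifferentiableAt ℂ (fun w : ℂ => w - b) z).mul
    (d1.sub d3)) _).differentiableWithinAt

include hK hC hK₁ hC₁ h in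
-- For z in the strip, conj z lies below it and is an admissible pole. With this choice (2πi)⁻¹(z -
-- conj z) = y/π, and the first term is the Poisson integral of K.
theorem cauchyExt_eq_poisson {b : ℂ} (hb : b.im < 0 ∨ Real.pi < b.im) {x y : ℝ} (hy : 0 < y)
    (hy' : y < Real.pi) : cauchyExt K K₁ b (x + y * Complex.I) =
      (y / Real.pi : ℂ) * cauchyPair K (x + y * Complex.I) (x - y * Complex.I) -
      (y / Real.pi : ℂ) * cauchyPair K₁ (x + y * Complex.I - Real.pi * Complex.I)
        (x - y * Complex.I - Real.pi * Complex.I) := by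
  rw [cauchyExt_eq hK hC hK₁ hC₁ h hb (c := x - y * Complex.I) (Or.inl (by simpa using hy))
    (by simpa using hy.ne') (by simpa using hy'.ne), cauchyExt]
  have h1 : (Real.pi : ℂ) ≠ 0 := by exact_mod_cast Real.pi_pos.ne'
  field_simp
  ring

/-- Near the lower edge both poles stay at distance at least π/2 from the line carrying K₁, so the
second term is of order y. -/
theorem norm_poisson_error_le (hC₁ : ∀ᵐ q, ‖K₁ q‖ ≤ C) {x y : ℝ} (hy : 0 < y)
    (hy' : y ≤ Real.pi / 2) : ‖(y / Real.pi : ℂ) *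
      cauchyPair K₁ (x + y * Complex.I - Real.pi * Complex.I)
        (x - y * Complex.I - Real.pi * Complex.I)‖ ≤ C * (2 / Real.pi) * y := by
  have hpi := Real.pi_pos
  have h1 := norm_cauchyPair_le hC₁ (a := x + y * Complex.I - Real.pi * Complex.I)
    (b := x - y * Complex.I - Real.pi * Complex.I) (d := Real.pi / 2) (by positivity)
    (by simp; rw [abs_of_neg (by linarith)]; linarith)
    (by simp; rw [abs_of_neg (by linarith)]; linarith) (by simp)
  have e2 : ‖(y / Real.pi : ℂ)‖ = y / Real.pi := by
    rw [← Complex.ofReal_div, Complex.norm_real, Real.norm_of_nonneg (by positivity)]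
  rw [norm_mul, e2]
  refine (mul_le_mul_of_nonneg_left h1 (by positivity)).trans (le_of_eq ?_)
  field_simp

include hK hC hK₁ hC₁ h in
-- Only the lower half of the strip is estimated, where the Poisson integral and the error are each
-- at most C. The upper half follows by reflection.
theorem norm_cauchyExt_le {b : ℂ} (hb : b.im < 0 ∨ Real.pi < b.im) {z : ℂ} (hz : 0 < z.im)
    (hz' : z.im ≤ Real.pi / 2) : ‖cauchyExt K K₁ b z‖ ≤ 2 * C := by
  have hpi := Real.pi_pos
  obtain ⟨q₀, hq₀⟩ := hC.exists
  have hC0 : 0 ≤ C := (norm_nonneg _).trans hq₀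
  have h0 := cauchyExt_eq_poisson hK hC hK₁ hC₁ h hb (x := z.re) hz (by linarith)
  rw [Complex.re_add_im] at h0
  rw [h0, ← Complex.re_add_im z]
  refine (norm_sub_le _ _).trans ?_
  have h1 := norm_cauchyPair_le hC (a := z.re + z.im * Complex.I)
    (b := z.re - z.im * Complex.I) (d := z.im) hz (by simp [le_abs_self])
    (by simp [le_abs_self]) (by simp)
  have e2 : ‖(z.im / Real.pi : ℂ)‖ = z.im / Real.pi := by
    rw [← Complex.ofReal_div, Complex.norm_real, Real.norm_of_nonneg (by positivity)]
  have h2 := norm_poisson_error_le hC₁ (x := z.re) hz hz'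
  have h3 : C * (2 / Real.pi) * z.im ≤ C := by
    rw [mul_assoc]
    refine mul_le_of_le_one_right hC0 ?_
    rw [div_mul_eq_mul_div, div_le_one hpi]
    linarith
  have h4 : ‖(z.im / Real.pi : ℂ) * cauchyPair K (z.re + z.im * Complex.I)
      (z.re - z.im * Complex.I)‖ ≤ C := by
    rw [norm_mul, e2]
    refine (mul_le_mul_of_nonneg_left h1 (by positivity)).trans (le_of_eq ?_)
    field_simp
  simp only [Complex.re_add_im] at h2 h4 ⊢
  linarith

include hK hC hK₁ hC₁ h in
theorem ae_tendsto_cauchyExt {b : ℂ} (hb : b.im < 0 ∨ Real.pi < b.im) : ∀ᵐ x : ℝ,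
    Tendsto (fun y : ℝ => cauchyExt K K₁ b (x + y * Complex.I)) (𝓝[>] 0) (𝓝 (K x)) := by
  have hpi := Real.pi_pos
  filter_upwards [ae_tendsto_poisson hK hC] with x hx
  have h1 : Tendsto (fun y : ℝ => (y / Real.pi : ℂ) *
      cauchyPair K₁ (x + y * Complex.I - Real.pi * Complex.I)
        (x - y * Complex.I - Real.pi * Complex.I)) (𝓝[>] 0) (𝓝 0) := by
    have h2 : Tendsto (fun y : ℝ => C * (2 / Real.pi) * y) (𝓝[>] 0) (𝓝 0) := by
      have : Tendsto (fun y : ℝ => C * (2 / Real.pi) * y) (𝓝 0) (𝓝 (C * (2 / Real.pi) * 0)) :=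
        (continuous_const.mul continuous_id).tendsto 0
      rw [mul_zero] at this
      exact this.mono_left nhdsWithin_le_nhds
    refine squeeze_zero_norm' ?_ h2
    filter_upwards [Ioo_mem_nhdsGT (show (0 : ℝ) < Real.pi / 2 by positivity)] with y hy
    exact norm_poisson_error_le hC₁ hy.1 hy.2.le
  have h3 := hx.sub h1
  rw [sub_zero] at h3
  refine h3.congr' ?_
  filter_upwards [Ioo_mem_nhdsGT hpi] with y hy
  exact (cauchyExt_eq_poisson hK hC hK₁ hC₁ h hb hy.1 hy.2).symm

theorem cauchyPair_neg (K : ℝ → ℂ) (a b : ℂ) :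
    cauchyPair (fun q => K (-q)) a b = cauchyPair K (-a) (-b) := by
  rw [cauchyPair, cauchyPair, ← integral_neg_eq_self]
  refine integral_congr_ae (.of_forall fun q => ?_)
  simp only [neg_neg]
  congr 1
  rw [← mul_inv, ← mul_inv]
  congr 1
  push_cast
  ring

/-- The reflection z ↦ iπ - z exchanges the roles of K and K₁, so estimates and limits are needed at
the lower edge only. -/
theorem cauchyExt_reflect (K K₁ : ℝ → ℂ) (b z : ℂ) :
    cauchyExt (fun q => K₁ (-q)) (fun q => K (-q)) (Real.pi * Complex.I - b)
      (Real.pi * Complex.I - z) = cauchyExt K K₁ b z := by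
  simp only [cauchyExt, cauchyPair_neg, neg_sub]
  have e : ∀ w : ℂ, Real.pi * Complex.I - (Real.pi * Complex.I - w) = w := fun w => by ring
  rw [e, e]
  ring

include hK hC hK₁ hC₁ h in
/-- Functions `K`, `K₁` that satisfy Cauchy's theorem on the strip are the boundary values of a
bounded analytic function. -/
theorem exists_bounded_analytic : ∃ Φ : ℂ → ℂ,
    DifferentiableOn ℂ Φ {z | 0 < z.im ∧ z.im < Real.pi} ∧
    (∀ z : ℂ, 0 < z.im → z.im < Real.pi → ‖Φ z‖ ≤ 2 * C) ∧
    (∀ᵐ x : ℝ, Tendsto (fun y : ℝ => Φ (x + y * Complex.I)) (𝓝[>] 0) (𝓝 (K x))) ∧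
    ∀ᵐ x : ℝ, Tendsto (fun y : ℝ => Φ (x + y * Complex.I)) (𝓝[<] Real.pi) (𝓝 (K₁ x)) := by
  have hb : (-Complex.I).im < 0 ∨ Real.pi < (-Complex.I).im := Or.inl (by simp)
  have hb' : (Real.pi * Complex.I - -Complex.I).im < 0 ∨
      Real.pi < (Real.pi * Complex.I - -Complex.I).im := Or.inr (by simp)
  have hneg := (Measure.measurePreserving_neg (volume : Measure ℝ)).quasiMeasurePreserving
  have hK' : AEStronglyMeasurable (fun q => K (-q)) := hK.comp_quasiMeasurePreserving hneg
  have hK₁' : AEStronglyMeasurable (fun q => K₁ (-q)) := hK₁.comp_quasiMeasurePreserving hneg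
  have h' : ∀ a b : ℂ, a ≠ b → a.im < 0 ∨ Real.pi < a.im → b.im < 0 ∨ Real.pi < b.im →
      cauchyPair (fun q => K₁ (-q)) a b = cauchyPair (fun q => K (-q)) (a - Real.pi * Complex.I)
        (b - Real.pi * Complex.I) := by
    intro a b hab ha hb
    have key : ∀ {a : ℂ}, a.im < 0 ∨ Real.pi < a.im →
        (Real.pi * Complex.I - a).im < 0 ∨ Real.pi < (Real.pi * Complex.I - a).im := by
      intro a ha
      simp only [Complex.sub_im, Complex.im_ofReal_mul, Complex.I_im,
        mul_one]
      rcases ha with ha | ha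
      · right
        linarith
      · left
        linarith
    rw [cauchyPair_neg, cauchyPair_neg, neg_sub, neg_sub, h _ _ (fun h0 => hab (sub_right_injective h0)) (key ha) (key hb)]
    congr 1 <;> ring
  -- The pole -i is an arbitrary point off the closed strip.
  refine ⟨cauchyExt K K₁ (-Complex.I), differentiableOn_cauchyExt hK hC hK₁ hC₁ hb,
    fun z hz hz' => ?_, ae_tendsto_cauchyExt hK hC hK₁ hC₁ h hb, ?_⟩
  · rcases le_total z.im (Real.pi / 2) with h0 | h0
    · exact norm_cauchyExt_le hK hC hK₁ hC₁ h hb hz h0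
    · rw [← cauchyExt_reflect]
      refine norm_cauchyExt_le hK₁' (hneg.ae hC₁) hK' (hneg.ae hC) h' hb' ?_ ?_
      · simpa using hz'
      · simp
        linarith
  · have h1 := hneg.ae (ae_tendsto_cauchyExt hK₁' (hneg.ae hC₁) hK' (hneg.ae hC) h' hb')
    filter_upwards [h1] with x hx
    rw [neg_neg] at hx
    have h2 : Tendsto (fun y : ℝ => Real.pi - y) (𝓝[<] Real.pi) (𝓝[>] 0) := by
      refine tendsto_nhdsWithin_iff.2 ⟨?_, ?_⟩
      · have : Tendsto (fun y : ℝ => Real.pi - y) (𝓝 Real.pi) (𝓝 (Real.pi - Real.pi)) :=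
          (continuous_const.sub continuous_id).tendsto _
        rw [sub_self] at this
        exact this.mono_left nhdsWithin_le_nhds
      · filter_upwards [self_mem_nhdsWithin] with y hy
        exact Set.mem_Ioi.2 (sub_pos.2 (Set.mem_Iio.1 hy))
    refine (hx.comp h2).congr fun y => ?_
    rw [Function.comp_apply, ← cauchyExt_reflect K K₁]
    congr 1
    push_cast
    ring

end Cauchy

/-! ### Locality in terms of wave functions -/

section Locality

variable {ι : Type*} [Fintype ι] {𝓗 : Type*} [NormedAddCommGroup 𝓗] [InnerProductSpace ℂ 𝓗]
  {U : 𝓗 ≃ₗᵢ[ℂ] L2R ι} {A R : HTensor 𝓗 𝓗 →L[ℂ] HTensor 𝓗 𝓗}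
  {N : ℝ × ℝ → Matrix (ι × ι) (ι × ι) ℂ} {C : ℝ}

/-- The kernel by which `⟪y ⊗ η, A (x ⊗ ξ)⟫` depends on `η` and `ξ`, for an operator `A` that
multiplies by `N`. -/
def partialKernel (U : 𝓗 ≃ₗᵢ[ℂ] L2R ι) (N : ℝ × ℝ → Matrix (ι × ι) (ι × ι) ℂ) (y x : 𝓗) (β δ : ι)
    (s : ℝ) : ℂ :=
  ∑ α, ∑ γ, ∫ q : ℝ, conj (U y q α) * U x q γ * N (q, s) (α, β) (γ, δ)

theorem memLp_conj_coord (x : 𝓗) (α : ι) : MemLp (fun q => conj (U x q α)) 2 volume :=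
  (memLp_coord (U x) α).star

theorem integrable_kernel (hN : ∀ a b, Measurable fun p => N p a b)
    (hC : ∀ᵐ p, ∀ a b, ‖N p a b‖ ≤ C) (x y ξ η : 𝓗) (α β γ δ : ι) :
    Integrable (fun p : ℝ × ℝ => conj (U y p.1 α) * U x p.1 γ * (conj (U η p.2 β) * U ξ p.2 δ) *
      N p (α, β) (γ, δ)) volume := by
  have h1 := (memLp_conj_coord (U := U) y α).integrable_mul (memLp_coord (U x) γ)
  have h2 := (memLp_conj_coord (U := U) η β).integrable_mul (memLp_coord (U ξ) δ)
  refine (h1.mul_prod h2).mul_bdd (c := C) (hN _ _).aestronglyMeasurable ?_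
  filter_upwards [hC] with p hp
  exact hp _ _

theorem integrable_partialKernel (hN : ∀ a b, Measurable fun p => N p a b)
    (hC : ∀ᵐ p, ∀ a b, ‖N p a b‖ ≤ C) (x y ξ η : 𝓗) (β δ : ι) :
    Integrable fun s : ℝ => conj (U η s β) * U ξ s δ * partialKernel U N y x β δ s := by
  simp only [partialKernel, Finset.mul_sum, ← integral_const_mul]
  refine integrable_finsetSum _ fun α _ => integrable_finsetSum _ fun γ _ => ?_
  refine (integrable_kernel (U := U) hN hC x y ξ η α β γ δ).integral_prod_right.congr
    (.of_forall fun s => integral_congr_ae (.of_forall fun q => ?_))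
  simp only []
  ring

/-- Fubini with the second rapidity outside. The locality condition concerns only the inner integral
over the first rapidity, since ξ and η are arbitrary. -/
theorem Acts.inner_htmul (h : Acts (fun ξ => waveL U ξ) A N id)
    (hN : ∀ a b, Measurable fun p => N p a b) (hC : ∀ᵐ p, ∀ a b, ‖N p a b‖ ≤ C)
    (x y ξ η : 𝓗) : ⟪htmul y η, A (htmul x ξ)⟫_ℂ =
      ∑ β, ∑ δ, ∫ s : ℝ, conj (U η s β) * U ξ s δ * partialKernel U N y x β δ s := by
  have e1 : ⟪htmul y η, A (htmul x ξ)⟫_ℂ = ∫ p : ℝ × ℝ, ∑ α, ∑ β, ∑ γ, ∑ δ,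
      conj (U y p.1 α) * U x p.1 γ * (conj (U η p.2 β) * U ξ p.2 δ) * N p (α, β) (γ, δ) := by
    rw [← inner_waveL U, inner_eq_integral_sum]
    refine integral_congr_ae ?_
    filter_upwards [h (htmul x ξ), isProductRep_waveL U x ξ, isProductRep_waveL U y η]
      with p h1 h2 h3
    simp only [h1, Fintype.sum_prod_type, h3, Matrix.mulVec, dotProduct, id, h2, map_mul,
      Finset.mul_sum]
    refine Finset.sum_congr rfl fun α _ => Finset.sum_congr rfl fun β _ =>
      Finset.sum_congr rfl fun γ _ => Finset.sum_congr rfl fun δ _ => ?_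
    ring
  have hi := integrable_kernel (U := U) hN hC x y ξ η
  have e2 : ∀ α β γ δ, ∫ p : ℝ × ℝ, conj (U y p.1 α) * U x p.1 γ *
      (conj (U η p.2 β) * U ξ p.2 δ) * N p (α, β) (γ, δ) =
      ∫ s : ℝ, conj (U η s β) * U ξ s δ *
        ∫ q : ℝ, conj (U y q α) * U x q γ * N (q, s) (α, β) (γ, δ) := by
    intro α β γ δ
    refine (integral_prod_symm _ (hi α β γ δ)).trans ?_
    refine integral_congr_ae (.of_forall fun s => ?_)
    simp only [← integral_const_mul]
    refine integral_congr_ae (.of_forall fun q => ?_)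
    simp only []
    ring
  have hi2 : ∀ α β γ δ, Integrable fun s : ℝ => conj (U η s β) * U ξ s δ *
      ∫ q : ℝ, conj (U y q α) * U x q γ * N (q, s) (α, β) (γ, δ) := by
    intro α β γ δ
    refine (hi α β γ δ).integral_prod_right.congr (.of_forall fun s => ?_)
    simp only [← integral_const_mul]
    refine integral_congr_ae (.of_forall fun q => ?_)
    simp only []
    ring
  rw [e1, integral_finsetSum _ fun α _ => integrable_finsetSum _ fun β _ =>
    integrable_finsetSum _ fun γ _ => integrable_finsetSum _ fun δ _ => hi α β γ δ]
  simp only [partialKernel, Finset.mul_sum]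
  have e3 : ∀ α, ∫ p : ℝ × ℝ, ∑ β, ∑ γ, ∑ δ, conj (U y p.1 α) * U x p.1 γ *
      (conj (U η p.2 β) * U ξ p.2 δ) * N p (α, β) (γ, δ) = ∑ β, ∑ γ, ∑ δ,
      ∫ s : ℝ, conj (U η s β) * U ξ s δ *
        ∫ q : ℝ, conj (U y q α) * U x q γ * N (q, s) (α, β) (γ, δ) := by
    intro α
    rw [integral_finsetSum _ fun β _ => integrable_finsetSum _ fun γ _ =>
      integrable_finsetSum _ fun δ _ => hi α β γ δ]
    refine Finset.sum_congr rfl fun β _ => ?_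
    rw [integral_finsetSum _ fun γ _ => integrable_finsetSum _ fun δ _ => hi α β γ δ]
    refine Finset.sum_congr rfl fun γ _ => ?_
    rw [integral_finsetSum _ fun δ _ => hi α β γ δ]
    exact Finset.sum_congr rfl fun δ _ => e2 α β γ δ
  have e4 : ∀ β δ, ∫ s : ℝ, ∑ α, ∑ γ, conj (U η s β) * U ξ s δ *
      ∫ q : ℝ, conj (U y q α) * U x q γ * N (q, s) (α, β) (γ, δ) = ∑ α, ∑ γ,
      ∫ s : ℝ, conj (U η s β) * U ξ s δ *
        ∫ q : ℝ, conj (U y q α) * U x q γ * N (q, s) (α, β) (γ, δ) := by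
    intro β δ
    rw [integral_finsetSum _ fun α _ => integrable_finsetSum _ fun γ _ => hi2 α β γ δ]
    refine Finset.sum_congr rfl fun α _ => ?_
    rw [integral_finsetSum _ fun γ _ => hi2 α β γ δ]
  simp only [e3, e4]
  rw [Finset.sum_comm]
  refine Finset.sum_congr rfl fun β _ => ?_
  rw [Finset.sum_comm]
  calc _ = ∑ γ, ∑ δ, ∑ α, _ := Finset.sum_congr rfl fun γ _ => Finset.sum_comm
    _ = ∑ δ, ∑ γ, ∑ α, _ := Finset.sum_comm
    _ = _ := Finset.sum_congr rfl fun δ _ => Finset.sum_comm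

/-- The kernels agree if the matrix elements do. -/
theorem partialKernel_ae_eq [DecidableEq ι] {N' : ℝ × ℝ → Matrix (ι × ι) (ι × ι) ℂ}
    (hN : ∀ a b, Measurable fun p => N p a b) (hC : ∀ᵐ p, ∀ a b, ‖N p a b‖ ≤ C)
    (hN' : ∀ a b, Measurable fun p => N' p a b) (hC' : ∀ᵐ p, ∀ a b, ‖N' p a b‖ ≤ C)
    {x y x' y' : 𝓗} (h : ∀ ξ η : 𝓗,
      ∑ β, ∑ δ, ∫ s : ℝ, conj (U η s β) * U ξ s δ * partialKernel U N y x β δ s =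
      ∑ β, ∑ δ, ∫ s : ℝ, conj (U η s β) * U ξ s δ * partialKernel U N' y' x' β δ s) (β δ : ι) :
    ∀ᵐ s : ℝ, partialKernel U N y x β δ s = partialKernel U N' y' x' β δ s := by
  -- For ξ take a nowhere vanishing Gaussian in the component δ, for η indicators of sets of finite
  -- measure in the component β. This isolates one pair of indices and all set integrals of the
  -- kernel times the Gaussian.
  set ξ : 𝓗 := compVec U δ with hξ
  have hξc := compVec_coe U δ
  have hη : ∀ (E : Set ℝ) (hE : MeasurableSet E) (hμ : volume E < ∞), ∀ᵐ s : ℝ, ∀ b,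
      U (U.symm (indicatorConstLp 2 hE hμ.ne (EuclideanSpace.single β (1 : ℂ)))) s b =
        E.indicator (fun _ => if b = β then 1 else 0) s := by
    intro E hE hμ
    rw [U.apply_symm_apply]
    filter_upwards [indicatorConstLp_coeFn (p := 2) (hs := hE) (hμs := hμ.ne)
      (c := EuclideanSpace.single β (1 : ℂ))] with s hs b
    rw [hs]
    by_cases hsE : s ∈ E <;> simp [hsE]
  have key : ∀ {N : ℝ × ℝ → Matrix (ι × ι) (ι × ι) ℂ} {y x : 𝓗},
      (∀ a b, Measurable fun p => N p a b) → (∀ᵐ p, ∀ a b, ‖N p a b‖ ≤ C) →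
      ∀ (E : Set ℝ) (hE : MeasurableSet E) (hμ : volume E < ∞),
      IntegrableOn (fun s => ((Real.exp (-1 * (s - 0) ^ 2) : ℝ) : ℂ) *
        partialKernel U N y x β δ s) E ∧ ∑ b, ∑ d, ∫ s : ℝ, conj (U (U.symm (indicatorConstLp 2 hE
          hμ.ne (EuclideanSpace.single β (1 : ℂ)))) s b) * U ξ s d * partialKernel U N y x b d s =
        ∫ s in E, ((Real.exp (-1 * (s - 0) ^ 2) : ℝ) : ℂ) * partialKernel U N y x β δ s := by
    intro N y x hN hC E hE hμ
    set η : 𝓗 := U.symm (indicatorConstLp 2 hE hμ.ne (EuclideanSpace.single β (1 : ℂ)))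
    have e : ∀ b d, (fun s => conj (U η s b) * U ξ s d * partialKernel U N y x b d s) =ᵐ[volume]
        E.indicator fun s => if b = β ∧ d = δ then ((Real.exp (-1 * (s - 0) ^ 2) : ℝ) : ℂ) *
          partialKernel U N y x β δ s else 0 := by
      intro b d
      filter_upwards [hη E hE hμ, hξc] with s h1 h2
      rw [h1, h2]
      by_cases hsE : s ∈ E <;> by_cases hb : b = β <;> by_cases hd : d = δ <;>
        simp [hsE, hb, hd]
    constructor
    · rw [← integrable_indicator_iff hE]
      refine (integrable_partialKernel hN hC x y ξ η β δ).congr ((e β δ).trans ?_)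
      simp
    · have e2 : ∀ b d, ∫ s : ℝ, conj (U η s b) * U ξ s d * partialKernel U N y x b d s =
          if b = β ∧ d = δ then ∫ s in E, ((Real.exp (-1 * (s - 0) ^ 2) : ℝ) : ℂ) *
            partialKernel U N y x β δ s else 0 := by
        intro b d
        rw [integral_congr_ae (e b d), integral_indicator hE]
        by_cases hbd : b = β ∧ d = δ <;> simp [hbd]
      simp only [e2, ite_and]
      simp
  have h1 := ae_eq_of_forall_setIntegral_eq_of_sigmaFinite
    (f := fun s => ((Real.exp (-1 * (s - 0) ^ 2) : ℝ) : ℂ) * partialKernel U N y x β δ s)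
    (g := fun s => ((Real.exp (-1 * (s - 0) ^ 2) : ℝ) : ℂ) * partialKernel U N' y' x' β δ s)
    (fun E hE hμ => (key hN hC E hE hμ).1) (fun E hE hμ => (key hN' hC' E hE hμ).1)
    fun E hE hμ => by
      rw [← (key hN hC E hE hμ).2, ← (key hN' hC' E hE hμ).2, h]
  filter_upwards [h1] with s hs
  exact mul_left_cancel₀ (by exact_mod_cast (Real.exp_pos _).ne') hs

end Locality

/-! ### Locality, analyticity and crossing symmetry -/

section Crossing

variable {ι : Type*} [Fintype ι] {𝓗 : Type*} [NormedAddCommGroup 𝓗] [InnerProductSpace ℂ 𝓗]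
  {U : 𝓗 ≃ₗᵢ[ℂ] L2R ι} {R : HTensor 𝓗 𝓗 →L[ℂ] HTensor 𝓗 𝓗}
  {S : ℝ → Matrix (ι × ι) (ι × ι) ℂ} {bar : ι → ι}

/-- The multiplier of the adjoint operator, for a hermitian analytic `S`. -/
def adjMatrix (S : ℝ → Matrix (ι × ι) (ι × ι) ℂ) (p : ℝ × ℝ) : Matrix (ι × ι) (ι × ι) ℂ :=
  (S (p.2 - p.1)).submatrix id Prod.swap

omit [Fintype ι] in
theorem measurable_diffMatrix (hS : ∀ a b, Measurable fun q => S q a b) (a b : ι × ι) :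
    Measurable fun p => diffMatrix S p a b :=
  (hS a.swap b).comp (measurable_fst.sub measurable_snd)

omit [Fintype ι] in
theorem measurable_adjMatrix (hS : ∀ a b, Measurable fun q => S q a b) (a b : ι × ι) :
    Measurable fun p => adjMatrix S p a b :=
  (hS a b.swap).comp (measurable_snd.sub measurable_fst)

omit [Fintype ι] in
theorem norm_diffMatrix_le {C : ℝ} (hS : ∀ᵐ q, ∀ a b, ‖S q a b‖ ≤ C) :
    ∀ᵐ p : ℝ × ℝ, ∀ a b, ‖diffMatrix S p a b‖ ≤ C := by
  filter_upwards [ae_sub_iff.2 hS] with p hp a b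
  exact hp _ _

omit [Fintype ι] in
theorem norm_adjMatrix_le {C : ℝ} (hS : ∀ᵐ q, ∀ a b, ‖S q a b‖ ≤ C) :
    ∀ᵐ p : ℝ × ℝ, ∀ a b, ‖adjMatrix S p a b‖ ≤ C := by
  have h := (Measure.measurePreserving_swap (μ := (volume : Measure ℝ))
    (ν := (volume : Measure ℝ))).quasiMeasurePreserving.ae (ae_sub_iff.2 hS)
  filter_upwards [h] with p hp a b
  exact hp _ _

theorem acts_adjoint [DecidableEq ι] {T : ℝ → 𝓗 →L[ℂ] 𝓗}
    (hT : ∀ t x, ∀ᵐ q : ℝ, U (T t x) q = phase t q • U x q) (h : ComesFrom U R S)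
    (hS : ∀ᵐ q : ℝ, S (-q) = (S q).conjTranspose) :
    Acts (fun ξ => waveL U ξ) (ContinuousLinearMap.adjoint R) (adjMatrix S) id := by
  rw [comesFrom_iff_acts] at h
  refine (Acts.adjoint hT h).congr ?_
  filter_upwards [ae_sub_iff.2 hS] with p hp
  rw [neg_sub] at hp
  rw [adjMatrix, hp]
  rfl

/-- For f, k in H the integrand of ⟪f, J k⟫ is the complex conjugate of a product of Hardy
functions. Moving the contour of that product from ℝ to ℝ + iπ conjugates it up to a relabelling by
`bar`, so the inner product is real. -/
theorem conj_mem_symplComp [CompleteSpace 𝓗] {H : StandardSubspace 𝓗}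
    (hbar : Function.Involutive bar) (hH : ∀ x, x ∈ H.toClosedSubmodule ↔
      ∀ α, IsHardyPair (fun q => U x q α) (fun q => conj (U x q (bar α))))
    {k : 𝓗} (hk : k ∈ H.toClosedSubmodule) :
    modConj U hbar k ∈ H.symplComp.toClosedSubmodule := by
  refine ClosedSubmodule.mem_symplComp_iff.2 fun f hf => ?_
  rw [← Complex.conj_eq_iff_im, ← U.inner_map_map, inner_eq_integral_sum, ← integral_conj]
  have hi : ∀ α, Integrable fun q : ℝ => U f q α * U k q (bar α) := fun α =>
    (memLp_coord (U f) α).integrable_mul (memLp_coord (U k) (bar α))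
  have hi' : ∀ α, Integrable fun q : ℝ => conj (U f q (bar α)) * conj (U k q α) := fun α =>
    (memLp_conj_coord f (bar α)).integrable_mul (memLp_conj_coord k α)
  have e : ∀ α, ∫ q : ℝ, U f q α * U k q (bar α) =
      ∫ q : ℝ, conj (U f q (bar α)) * conj (U k q α) := by
    intro α
    have h1 := (hH f).1 hf α
    have h2 := (hH k).1 hk (bar α)
    rw [hbar] at h2
    exact h1.integral_mul_eq' h2 (memLp_coord _ _) (memLp_conj_coord _ _) (memLp_coord _ _)
      (memLp_conj_coord _ _)
  calc ∫ q : ℝ, conj (∑ α, conj (U f q α) * U (modConj U hbar k) q α)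
      = ∫ q : ℝ, ∑ α, U f q α * U k q (bar α) := by
        refine integral_congr_ae ?_
        filter_upwards [modConj_coe U hbar k] with q hq
        simp only [hq, map_sum, map_mul, Complex.conj_conj]
    _ = ∫ q : ℝ, ∑ α, conj (U f q (bar α)) * conj (U k q α) := by
        rw [integral_finsetSum _ fun α _ => hi α, integral_finsetSum _ fun α _ => hi' α]
        exact Finset.sum_congr rfl fun α _ => e α
    _ = ∫ q : ℝ, ∑ α, conj (U f q α) * U (modConj U hbar k) q α := by
        refine integral_congr_ae ?_
        filter_upwards [modConj_coe U hbar k] with q hq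
        simp only [hq]
        rw [← Equiv.sum_comp (hbar.toPerm bar)]
        simp [hbar _]

/-- Write g = J k with k in H. For fixed second rapidity s, the kernel of the left side integrates
two Hardy functions against S(q - s); the contour shift to ℝ + iπ conjugates both functions and
replaces S by its crossed version at s - q, which is the kernel of the right side. -/
theorem locality_of_analytic [CompleteSpace 𝓗] [DecidableEq ι] {H : StandardSubspace 𝓗}
    {T : ℝ → 𝓗 →L[ℂ] 𝓗} (hbar : Function.Involutive bar) (hU : IsSchrodingerRep H T bar U)
    (h : ComesFrom U R S) (hS : IsScatteringMatrix bar S) {f g : 𝓗}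
    (hf : f ∈ H.toClosedSubmodule) (hg : g ∈ H.symplComp.toClosedSubmodule) (ξ η : 𝓗) :
    ⟪htmul g η, R (htmul f ξ)⟫_ℂ = ⟪htmul f η, ContinuousLinearMap.adjoint R (htmul g ξ)⟫_ℂ := by
  have hM := isModularPair_modGroup (U := U) hbar hU.mem_iff
  obtain ⟨k, hk, rfl⟩ : ∃ k ∈ H.toClosedSubmodule, modConj U hbar k = g :=
    ⟨_, hM.conj_mem hg, modConj_modConj hbar g⟩
  have hb : ∀ᵐ q : ℝ, ∀ a b, ‖S q a b‖ ≤ 1 := by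
    filter_upwards [hS.unitarity] with q hq
    exact entry_norm_bound_of_unitary hq
  rw [Acts.inner_htmul (comesFrom_iff_acts.1 h) (measurable_diffMatrix hS.measurable)
      (norm_diffMatrix_le hb),
    Acts.inner_htmul (acts_adjoint hU.translation h hS.hermitian)
      (measurable_adjMatrix hS.measurable) (norm_adjMatrix_le hb)]
  refine Finset.sum_congr rfl fun β _ => Finset.sum_congr rfl fun δ _ =>
    integral_congr_ae (.of_forall fun s => ?_)
  simp only []
  congr 1
  obtain ⟨Φ, hΦd, ⟨C, hΦC⟩, hΦ0, hΦ1⟩ := hS.analytic_crossing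
  have key : ∀ α γ, ∫ q : ℝ, U k q (bar α) * U f q γ * S (q - s) (β, α) (γ, δ) =
      ∫ q : ℝ, conj (U k q α) * conj (U f q (bar γ)) * S (s - q) (bar γ, β) (δ, bar α) := by
    intro α γ
    have h1 := (hU.mem_iff k).1 hk (bar α)
    rw [hbar] at h1
    have h2 := (hU.mem_iff f).1 hf γ
    have him : ∀ z : ℂ, (z - s : ℂ).im = z.im := fun z => by simp
    have hq := (measurePreserving_sub_right (volume : Measure ℝ) s).quasiMeasurePreserving
    have hq' := quasiMeasurePreserving_sub_left (volume : Measure ℝ) s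
    refine h1.integral_mul_eq h2 (memLp_coord _ _) (memLp_conj_coord _ _) (memLp_coord _ _)
      (memLp_conj_coord _ _) (S := fun z => Φ (z - s) (β, α) (γ, δ)) (C := C) ?_ ?_ ?_ ?_ ?_ ?_
    · refine (hΦd (β, α) (γ, δ)).comp (by fun_prop) fun z hz => ?_
      simpa only [Set.mem_ofPred_eq, him] using hz
    · intro z hz hz'
      exact hΦC _ (by rwa [him]) (by rwa [him]) _ _
    · exact ((hS.measurable _ _).comp (measurable_id.sub_const s)).aestronglyMeasurable
    · exact ((hS.measurable _ _).comp (measurable_const.sub measurable_id)).aestronglyMeasurable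
    · filter_upwards [hq.ae hΦ0] with q h0
      refine (h0 (β, α) (γ, δ)).congr fun y => ?_
      congr 3
      push_cast
      ring
    · filter_upwards [hq'.ae hΦ1] with q h0
      refine (h0 β α γ δ).congr fun y => ?_
      have e : (y * Complex.I - (s - q : ℝ) : ℂ) = q + y * Complex.I - s := by
        push_cast
        ring
      rw [e]
  have hJ := modConj_coe U hbar k
  have e1 : partialKernel U (diffMatrix S) (modConj U hbar k) f β δ s =
      ∑ α, ∑ γ, ∫ q : ℝ, U k q (bar α) * U f q γ * S (q - s) (β, α) (γ, δ) := by
    refine Finset.sum_congr rfl fun α _ => Finset.sum_congr rfl fun γ _ => integral_congr_ae ?_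
    filter_upwards [hJ] with q hq
    simp only [hq, Complex.conj_conj]
    rfl
  have e2 : partialKernel U (adjMatrix S) f (modConj U hbar k) β δ s =
      ∑ α, ∑ γ, ∫ q : ℝ, conj (U k q (bar γ)) * conj (U f q α) * S (s - q) (α, β) (δ, γ) := by
    refine Finset.sum_congr rfl fun α _ => Finset.sum_congr rfl fun γ _ => integral_congr_ae ?_
    filter_upwards [hJ] with q hq
    simp only [hq, mul_comm (conj (U f q α))]
    rfl
  rw [e1, e2]
  simp only [key]
  -- Crossing exchanges and bars the two summation indices; relabelling the double sum undoes this.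
  rw [Finset.sum_comm, ← Equiv.sum_comp (hbar.toPerm bar)]
  refine Finset.sum_congr rfl fun γ _ => ?_
  rw [← Equiv.sum_comp (hbar.toPerm bar)]
  simp [hbar _]

/-- For all complex c, d the vectors cx + conj c · J w and dv + conj d · J u lie in H and H'. Both
sides of locality are then real bilinear in c and d, and comparing the coefficients of c · conj d
gives the claim, now complex linear in x and free of any reality condition. -/
theorem extended_locality [CompleteSpace 𝓗] {H : StandardSubspace 𝓗}
    (hbar : Function.Involutive bar) (hH : ∀ x, x ∈ H.toClosedSubmodule ↔
      ∀ α, IsHardyPair (fun q => U x q α) (fun q => conj (U x q (bar α))))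
    (hloc : ∀ f ∈ H.toClosedSubmodule, ∀ g ∈ H.symplComp.toClosedSubmodule, ∀ ξ η : 𝓗,
      ⟪htmul g η, R (htmul f ξ)⟫_ℂ = ⟪htmul f η, ContinuousLinearMap.adjoint R (htmul g ξ)⟫_ℂ)
    {x w u v : 𝓗} (hx : IsSqrtValue (modGroup U) x w) (hu : IsSqrtValue (modGroup U) u v)
    (ξ η : 𝓗) : ⟪htmul v η, R (htmul x ξ)⟫_ℂ = ⟪htmul (modConj U hbar w) η,
      ContinuousLinearMap.adjoint R (htmul (modConj U hbar u) ξ)⟫_ℂ := by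
  set J := modConj U hbar with hJ
  have hsmul : ∀ (c : ℂ) (a b : 𝓗), htmul (c • a) b = c • htmul a b := fun c a b => by
    rw [htmul, htmul, ← TensorProduct.smul_tmul', UniformSpace.Completion.coe_smul]
  have key : ∀ c d : ℂ, ⟪htmul (d • v + conj d • J u) η, R (htmul (c • x + conj c • J w) ξ)⟫_ℂ =
      ⟪htmul (c • x + conj c • J w) η,
        ContinuousLinearMap.adjoint R (htmul (d • v + conj d • J u) ξ)⟫_ℂ := by
    intro c d
    refine hloc _ (mem_of_isSqrtValue hbar hH hx c) _ ?_ ξ η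
    have h1 := conj_mem_symplComp hbar hH (mem_of_isSqrtValue hbar hH hu d)
    rw [map_add, LinearIsometryEquiv.map_smulₛₗ, LinearIsometryEquiv.map_smulₛₗ,
      modConj_modConj, Complex.conj_conj, add_comm] at h1
    exact h1
  simp only [htmul_add_left, hsmul, map_add, map_smul, inner_add_left, inner_add_right,
    inner_smul_left, inner_smul_right, Complex.conj_conj] at key
  have k1 := key 1 1
  have k2 := key Complex.I Complex.I
  have k3 := key 1 Complex.I
  have k4 := key Complex.I 1
  simp only [map_one, Complex.conj_I] at k1 k2 k3 k4
  have hI := Complex.I_sq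
  set a₁ := ⟪htmul v η, R (htmul x ξ)⟫_ℂ
  set a₂ := ⟪htmul v η, R (htmul (J w) ξ)⟫_ℂ
  set a₃ := ⟪htmul (J u) η, R (htmul x ξ)⟫_ℂ
  set a₄ := ⟪htmul (J u) η, R (htmul (J w) ξ)⟫_ℂ
  set b₁ := ⟪htmul x η, ContinuousLinearMap.adjoint R (htmul v ξ)⟫_ℂ
  set b₂ := ⟪htmul x η, ContinuousLinearMap.adjoint R (htmul (J u) ξ)⟫_ℂ
  set b₃ := ⟪htmul (J w) η, ContinuousLinearMap.adjoint R (htmul v ξ)⟫_ℂ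
  set b₄ := ⟪htmul (J w) η, ContinuousLinearMap.adjoint R (htmul (J u) ξ)⟫_ℂ
  -- The four choices of c and d in {1, i}, weighted so that only the coefficient of c · conj d
  -- survives.
  linear_combination (k1 + k2 + Complex.I * k3 - Complex.I * k4) / 4 +
    ((3 * a₁ - a₂ - a₃ - a₄) - (3 * b₄ - b₁ - b₂ - b₃)) / 4 * hI

theorem exists_single {φ : ℝ → ℂ} (hφ : MemLp φ 2 volume) [DecidableEq ι] (γ : ι) :
    ∃ x : 𝓗, ∀ᵐ q : ℝ, (U x q).ofLp = Pi.single γ (φ q) := by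
  have hm : MemLp (fun q => (EuclideanSpace.single γ (φ q) : EuclideanSpace ℂ ι)) 2 volume :=
    ((LinearMap.toContinuousLinearMap (LinearMap.toSpanSingleton ℂ (EuclideanSpace ℂ ι)
      (EuclideanSpace.single γ 1))).comp_memLp' hφ).ae_eq (.of_forall fun q => by
        ext i
        simp [LinearMap.toSpanSingleton])
  refine ⟨U.symm (hm.toLp _), ?_⟩
  rw [U.apply_symm_apply]
  filter_upwards [hm.coeFn_toLp] with q hq
  rw [hq]
  rfl

theorem isSqrtValue_single [CompleteSpace 𝓗] [DecidableEq ι] {φ φ₁ : ℝ → ℂ}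
    (h : IsHardyPair φ φ₁) {γ : ι} {x w : 𝓗}
    (hx : ∀ᵐ q : ℝ, (U x q).ofLp = Pi.single γ (φ q))
    (hw : ∀ᵐ q : ℝ, (U w q).ofLp = Pi.single γ (φ₁ q)) : IsSqrtValue (modGroup U) x w := by
  refine isSqrtValue_of_isHardyPair U fun α => ?_
  refine (h.smul (if α = γ then 1 else 0)).congr ?_ ?_
  · filter_upwards [hx] with q hq
    rw [hq, Pi.single_apply]
    split_ifs <;> simp
  · filter_upwards [hw] with q hq
    rw [hq, Pi.single_apply]
    split_ifs <;> simp

theorem modConj_single [DecidableEq ι] (hbar : Function.Involutive bar) {φ : ℝ → ℂ} {γ : ι}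
    {x : 𝓗} (hx : ∀ᵐ q : ℝ, (U x q).ofLp = Pi.single γ (φ q)) :
    ∀ᵐ q : ℝ, (U (modConj U hbar x) q).ofLp = Pi.single (bar γ) (conj (φ q)) := by
  filter_upwards [hx, modConj_coe U hbar x] with q h1 h2
  funext α
  rw [h2, h1, Pi.single_apply, Pi.single_apply]
  by_cases hα : α = bar γ
  · simp [hα, hbar _]
  · rw [if_neg hα, if_neg (fun h => hα (by rw [← h, hbar])), map_zero]

theorem partialKernel_single [DecidableEq ι] {N : ℝ × ℝ → Matrix (ι × ι) (ι × ι) ℂ}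
    {φ ψ : ℝ → ℂ} {α γ : ι} {x y : 𝓗} (hy : ∀ᵐ q : ℝ, (U y q).ofLp = Pi.single α (ψ q))
    (hx : ∀ᵐ q : ℝ, (U x q).ofLp = Pi.single γ (φ q)) (β δ : ι) (s : ℝ) :
    partialKernel U N y x β δ s = ∫ q : ℝ, conj (ψ q) * φ q * N (q, s) (α, β) (γ, δ) := by
  have e : ∀ a c, ∫ q : ℝ, conj (U y q a) * U x q c * N (q, s) (a, β) (c, δ) =
      if a = α then (if c = γ then ∫ q : ℝ, conj (ψ q) * φ q * N (q, s) (α, β) (γ, δ) else 0)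
        else 0 := by
    intro a c
    have : ∫ q : ℝ, conj (U y q a) * U x q c * N (q, s) (a, β) (c, δ) =
        ∫ q : ℝ, if a = α then (if c = γ then conj (ψ q) * φ q * N (q, s) (α, β) (γ, δ) else 0)
          else 0 := by
      refine integral_congr_ae ?_
      filter_upwards [hy, hx] with q h1 h2
      rw [h1, h2, Pi.single_apply, Pi.single_apply]
      by_cases ha : a = α <;> by_cases hc : c = γ <;> simp [ha, hc]
    rw [this]
    by_cases ha : a = α <;> by_cases hc : c = γ <;> simp [ha, hc]
  simp only [partialKernel, e]
  simp

/-- Continuity in s is needed because locality determines kernels only for almost every s. The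
resolvent identity reduces it to pairs in which one pole is fixed at i, where analyticity in the
other pole applies. -/
theorem continuous_cauchyPair_sub {K : ℝ → ℂ} {C : ℝ} (hK : AEStronglyMeasurable K)
    (hC : ∀ᵐ q, ‖K q‖ ≤ C) {a b : ℂ} (hab : a ≠ b) (ha : a.im ≠ 0) (hb : b.im ≠ 0) :
    Continuous fun s : ℝ => cauchyPair K (a - s) (b - s) := by
  have him : ∀ (z : ℂ) (s : ℝ), (z - s : ℂ).im = z.im := fun z s => by simp
  have hI : Complex.I.im ≠ 0 := by simp
  have h1 : ∀ {z : ℂ}, z.im ≠ 0 → Continuous fun s : ℝ => cauchyPair K (z - s) Complex.I := by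
    intro z hz
    refine continuous_iff_continuousAt.2 fun s => ?_
    have h := (differentiableAt_cauchyPair hK hC (z := z - s) (b := Complex.I)
      (by rwa [him]) hI).continuousAt
    exact ContinuousAt.comp (f := fun s : ℝ => z - (s : ℂ))
      (g := fun w => cauchyPair K w Complex.I) h (by fun_prop)
  have h2 : (fun s : ℝ => cauchyPair K (a - s) (b - s)) = fun s : ℝ => (a - b)⁻¹ *
      ((a - s - Complex.I) * cauchyPair K (a - s) Complex.I +
        (Complex.I - (b - s)) * cauchyPair K (b - s) Complex.I) := by
    funext s
    have h3 := cauchyPair_resolvent hK hC (z := a - s) (b := b - s) (c := Complex.I)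
      (by rwa [him]) (by rwa [him]) hI
    rw [← h3, sub_sub_sub_cancel_right, add_sub_cancel, inv_mul_cancel_left₀ (sub_ne_zero.2 hab)]
  rw [h2]
  have h3 := h1 ha
  have h4 := h1 hb
  fun_prop

theorem integral_shift_eq_cauchyPair (K : ℝ → ℂ) (a b : ℂ) (s : ℝ) :
    ∫ q : ℝ, ((q : ℂ) - a)⁻¹ * ((q : ℂ) - b)⁻¹ * K (q - s) = cauchyPair K (a - s) (b - s) := by
  rw [← integral_add_right_eq_self _ s]
  refine integral_congr_ae (.of_forall fun q => ?_)
  simp only [add_sub_cancel_right]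
  congr 3 <;> · push_cast; ring

/-- Locality is tested on simple fractions in single components with poles a and b off the closed
strip, whose continuation to ℝ + iπ just moves the poles. The kernels of both sides are then
translates by s of the two Cauchy integrals. They agree for almost every s, hence by continuity at s
= 0. -/
theorem cauchyPair_eq_of_locality [CompleteSpace 𝓗] [DecidableEq ι] {H : StandardSubspace 𝓗}
    {T : ℝ → 𝓗 →L[ℂ] 𝓗} (hbar : Function.Involutive bar) (hU : IsSchrodingerRep H T bar U)
    (h : ComesFrom U R S) (hm : ∀ a b, Measurable fun q => S q a b)
    (hb : ∀ᵐ q : ℝ, ∀ a b, ‖S q a b‖ ≤ 1) (hh : ∀ᵐ q : ℝ, S (-q) = (S q).conjTranspose)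
    (hloc : ∀ f ∈ H.toClosedSubmodule, ∀ g ∈ H.symplComp.toClosedSubmodule, ∀ ξ η : 𝓗,
      ⟪htmul g η, R (htmul f ξ)⟫_ℂ = ⟪htmul f η, ContinuousLinearMap.adjoint R (htmul g ξ)⟫_ℂ)
    (α β γ δ : ι) {a b : ℂ} (hab : a ≠ b) (ha : a.im < 0 ∨ Real.pi < a.im)
    (hb' : b.im < 0 ∨ Real.pi < b.im) :
    cauchyPair (fun q => S q (β, α) (γ, δ)) a b = cauchyPair
      (fun q => S (-q) (bar γ, β) (δ, bar α)) (a - Real.pi * Complex.I)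
      (b - Real.pi * Complex.I) := by
  have hpi := Real.pi_pos
  have ne : ∀ {b : ℂ}, b.im < 0 ∨ Real.pi < b.im →
      b.im ≠ 0 ∧ (b - Real.pi * Complex.I).im ≠ 0 := by
    intro b hb
    rw [im_sub_pi_mul_I]
    rcases hb with hb | hb <;> constructor <;> intro h0 <;> linarith
  have eπ : ∀ (q : ℝ) (b : ℂ), (q : ℂ) + Real.pi * Complex.I - b =
      q - (b - Real.pi * Complex.I) := fun q b => by ring
  have hφ := isHardyPair_inv_sub hb'
  have hψ := isHardyPair_inv_sub ha
  simp only [eπ] at hφ hψ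
  obtain ⟨x, hx⟩ := exists_single (U := U) (memLp_inv_sub (ne hb').1) γ
  obtain ⟨w, hw⟩ := exists_single (U := U) (memLp_inv_sub (ne hb').2) γ
  -- The vector v enters antilinearly, so the conjugate fraction is used. Reflection at the middle
  -- of the strip makes v the value of Δ^{1/2} on u.
  obtain ⟨v, hv⟩ := exists_single (U := U) (memLp_inv_sub (ne ha).1).star α
  obtain ⟨u, hu⟩ := exists_single (U := U) (memLp_inv_sub (ne ha).2).star α
  have hxw := isSqrtValue_single hφ hx hw
  have huv := isSqrtValue_single hψ.reflect hu hv
  have h1 := partialKernel_ae_eq (measurable_diffMatrix hm) (norm_diffMatrix_le hb)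
    (measurable_adjMatrix hm) (norm_adjMatrix_le hb) (x := x) (y := v)
    (y' := modConj U hbar w) (x' := modConj U hbar u) (U := U) (fun ξ η => by
      rw [← Acts.inner_htmul (comesFrom_iff_acts.1 h) (measurable_diffMatrix hm)
          (norm_diffMatrix_le hb),
        ← Acts.inner_htmul (acts_adjoint hU.translation h hh)
          (measurable_adjMatrix hm) (norm_adjMatrix_le hb)]
      exact extended_locality hbar hU.mem_iff hloc hxw huv ξ η) β δ
  have hneg := (Measure.measurePreserving_neg (volume : Measure ℝ)).quasiMeasurePreserving
  have hb0 : ∀ᵐ q : ℝ, ‖S q (β, α) (γ, δ)‖ ≤ 1 := by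
    filter_upwards [hb] with q hq
    exact hq _ _
  have hb1 : ∀ᵐ q : ℝ, ‖S (-q) (bar γ, β) (δ, bar α)‖ ≤ 1 := by
    filter_upwards [hneg.ae hb] with q hq
    exact hq _ _
  have c0 := continuous_cauchyPair_sub (hm (β, α) (γ, δ)).aestronglyMeasurable hb0 hab (ne ha).1
    (ne hb').1
  have c1 := continuous_cauchyPair_sub (K := fun q => S (-q) (bar γ, β) (δ, bar α))
    ((hm (bar γ, β) (δ, bar α)).comp measurable_neg).aestronglyMeasurable hb1
    (a := a - Real.pi * Complex.I) (b := b - Real.pi * Complex.I)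
    (fun h0 => hab (sub_left_injective h0)) (ne ha).2 (ne hb').2
  have h2 : (fun s : ℝ => cauchyPair (fun q => S q (β, α) (γ, δ)) (a - s) (b - s)) =ᵐ[volume]
      fun s : ℝ => cauchyPair (fun q => S (-q) (bar γ, β) (δ, bar α))
        (a - Real.pi * Complex.I - s) (b - Real.pi * Complex.I - s) := by
    filter_upwards [h1] with s hs
    rw [partialKernel_single hv hx, partialKernel_single (modConj_single hbar hw)
      (modConj_single hbar hu)] at hs
    rw [← integral_shift_eq_cauchyPair, ← integral_shift_eq_cauchyPair]
    refine Eq.trans (integral_congr_ae (.of_forall fun q => ?_))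
      (hs.trans (integral_congr_ae (.of_forall fun q => ?_)))
    · simp [diffMatrix]
    · simp only [Complex.conj_conj, Pi.star_apply, ← starRingEnd_apply, adjMatrix,
        Matrix.submatrix_apply, Prod.swap_prod_mk, id, neg_sub]
      ring
  have h3 := congrFun ((Continuous.ae_eq_iff_eq volume c0 c1).1 h2) 0
  simpa using h3

end Crossing

/-! ### Scattering operators and scattering matrices -/

section Correspondence

variable {ι : Type*} [Fintype ι] [DecidableEq ι] {𝓗 : Type*} [NormedAddCommGroup 𝓗]
  [InnerProductSpace ℂ 𝓗] [CompleteSpace 𝓗] {U : 𝓗 ≃ₗᵢ[ℂ] L2R ι}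
  {R : HTensor 𝓗 𝓗 →L[ℂ] HTensor 𝓗 𝓗} {S : ℝ → Matrix (ι × ι) (ι × ι) ℂ} {bar : ι → ι}
  {H : StandardSubspace 𝓗} {T : ℝ → 𝓗 →L[ℂ] 𝓗}

/-- Each entry of S is paired with the entry of S(-q) that crossing prescribes as its upper boundary
value, and locality supplies the compatibility of the Cauchy integrals. The bounded analytic
function reconstructed from such a pair has crossing built in. -/
theorem analytic_crossing_of_locality (hbar : Function.Involutive bar)
    (hU : IsSchrodingerRep H T bar U) (h : ComesFrom U R S)
    (hm : ∀ a b, Measurable fun q => S q a b)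
    (hb : ∀ᵐ q : ℝ, ∀ a b, ‖S q a b‖ ≤ 1) (hh : ∀ᵐ q : ℝ, S (-q) = (S q).conjTranspose)
    (hloc : ∀ f ∈ H.toClosedSubmodule, ∀ g ∈ H.symplComp.toClosedSubmodule, ∀ ξ η : 𝓗,
      ⟪htmul g η, R (htmul f ξ)⟫_ℂ =
        ⟪htmul f η, ContinuousLinearMap.adjoint R (htmul g ξ)⟫_ℂ) :
    ∃ Φ : ℂ → Matrix (ι × ι) (ι × ι) ℂ,
      (∀ a b, DifferentiableOn ℂ (fun z => Φ z a b) {z | 0 < z.im ∧ z.im < Real.pi}) ∧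
      (∃ C : ℝ, ∀ z : ℂ, 0 < z.im → z.im < Real.pi → ∀ a b, ‖Φ z a b‖ ≤ C) ∧
      (∀ᵐ q : ℝ, ∀ a b,
        Tendsto (fun y : ℝ => Φ (q + y * Complex.I) a b) (𝓝[>] 0) (𝓝 (S q a b))) ∧
      ∀ᵐ q : ℝ, ∀ α β γ δ : ι,
        Tendsto (fun y : ℝ => Φ (y * Complex.I - q) (α, β) (γ, δ)) (𝓝[<] Real.pi)
          (𝓝 (S q (bar γ, α) (δ, bar β))) := by
  have hneg := (Measure.measurePreserving_neg (volume : Measure ℝ)).quasiMeasurePreserving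
  have key := fun a b : ι × ι => exists_bounded_analytic
    (K := fun q => S q a b) (K₁ := fun q => S (-q) (bar b.1, a.1) (b.2, bar a.2)) (C := 1)
    (hm _ _).aestronglyMeasurable (by
      filter_upwards [hb] with q hq
      exact hq _ _)
    ((hm (bar b.1, a.1) (b.2, bar a.2)).comp measurable_neg).aestronglyMeasurable (by
      filter_upwards [hneg.ae hb] with q hq
      exact hq _ _)
    fun _ _ hne h1 h2 =>
      cauchyPair_eq_of_locality hbar hU h hm hb hh hloc a.2 a.1 b.1 b.2 hne h1 h2
  choose Φ h1 h2 h3 h4 using key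
  refine ⟨fun z => Matrix.of fun a b => Φ a b z, h1, ⟨2 * 1, fun z hz hz' a b => h2 a b z hz hz'⟩,
    ?_, ?_⟩
  · exact ae_all_iff.2 fun a => ae_all_iff.2 fun b => h3 a b
  · have h5 : ∀ᵐ q : ℝ, ∀ a b : ι × ι, Tendsto (fun y : ℝ => Φ a b (q + y * Complex.I))
        (𝓝[<] Real.pi) (𝓝 (S (-q) (bar b.1, a.1) (b.2, bar a.2))) :=
      ae_all_iff.2 fun a => ae_all_iff.2 fun b => h4 a b
    filter_upwards [hneg.ae h5] with q hq α β γ δ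
    have := hq (α, β) (γ, δ)
    rw [neg_neg] at this
    refine this.congr fun y => ?_
    have e : ((-q : ℝ) + y * Complex.I : ℂ) = y * Complex.I - q := by
      push_cast
      ring
    rw [e]
    rfl

theorem isScatteringOperator_iff (hbar : Function.Involutive bar)
    (hU : IsSchrodingerRep H T bar U) : IsScatteringOperator H T R ↔
      ∃ S : ℝ → Matrix (ι × ι) (ι × ι) ℂ, ComesFrom U R S ∧ IsScatteringMatrix bar S := by
  have hM := isModularPair_modGroup (U := U) hbar hU.mem_iff
  constructor
  · intro hR
    obtain ⟨D, J, hDJ, hD, hJ⟩ := hR.dilationTCP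
    -- Uniqueness of the modular objects replaces the given pair by translation and componentwise
    -- conjugation.
    obtain rfl : D = modGroup U := hDJ.group_unique hM
    obtain rfl : J = modConj U hbar := hDJ.conj_unique hM
    obtain ⟨S, hm, hS⟩ := exists_comesFrom hU.translation hR.translation hD
    have hu := (unitary_iff hU.translation hS).1 hR.unitary
    have hh := (reflection_iff hU.translation hS).1 hR.reflection
    have hb : ∀ᵐ q : ℝ, ∀ a b, ‖S q a b‖ ≤ 1 := by
      filter_upwards [hu] with q hq
      exact entry_norm_bound_of_unitary hq
    exact ⟨S, hS, hm, hu, hh, (yangBaxter_iff hS).1 hR.yangBaxter,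
      (tcp_iff hbar hU.translation hS).1 hJ,
      analytic_crossing_of_locality hbar hU hS hm hb hh hR.locality⟩
  · rintro ⟨S, hS, h⟩
    exact ⟨(unitary_iff hU.translation hS).2 h.unitarity,
      (reflection_iff hU.translation hS).2 h.hermitian, (yangBaxter_iff hS).2 h.yangBaxter,
      commute_translation hU.translation (comesFrom_iff_acts.1 hS),
      ⟨modGroup U, modConj U hbar, hM, commute_modGroup hS,
        (tcp_iff hbar hU.translation hS).2 h.tcp⟩,
      fun f hf g hg ξ η => locality_of_analytic hbar hU hS h hf hg ξ η⟩

end Correspondence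

end Scattering

end

theorem mainTheorem3 {𝓗 : Type*} [NormedAddCommGroup 𝓗] [InnerProductSpace ℂ 𝓗] [CompleteSpace 𝓗]
    (H : StandardSubspace 𝓗) (T : ℝ → 𝓗 →L[ℂ] 𝓗) (hHT : Scattering.IsStandardPair H T)
    (n : ℕ) (hn : Scattering.HasMultiplicity H T n)
    {ι : Type*} [Fintype ι] [DecidableEq ι] (hι : Fintype.card ι = n)
    (bar : ι → ι) (hbar : Function.Involutive bar) :
    (∃ U : 𝓗 ≃ₗᵢ[ℂ] Scattering.L2R ι, Scattering.IsSchrodingerRep H T bar U) ∧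
    ∀ U : 𝓗 ≃ₗᵢ[ℂ] Scattering.L2R ι, Scattering.IsSchrodingerRep H T bar U →
      ∀ R : Scattering.HTensor 𝓗 𝓗 →L[ℂ] Scattering.HTensor 𝓗 𝓗,
        Scattering.IsScatteringOperator H T R ↔
          ∃ S : ℝ → Matrix (ι × ι) (ι × ι) ℂ,
            Scattering.ComesFrom U R S ∧ Scattering.IsScatteringMatrix bar S :=
  ⟨Scattering.exists_isSchrodingerRep hn hι hbar,
    fun _ hU _ => Scattering.isScatteringOperator_iff hbar hU⟩
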